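/- **Setting.** Let $F$ be a finite extension of $\mathbb{Q}_p$ ($p$ any prime), with valuation ring $\mathcal{O}$, maximal ideal $\mathfrak{m}$, uniformizer $\varpi$, residue field $k$ of cardinality $q=p^f$ and ramification index $e\ge 2$, where $p\mathcal{O}=\mathfrak{m}^e$. (A local field of characteristic $p$ is also allowed, with $e=\infty$.) Put $\mathcal{O}_2=\mathcal{O}/\mathfrak{m}^2$ and $G=\mathrm{GL}_2(\mathcal{O}_2)$, and let $B\le G$ be the upper triangular subgroup. For $\lambda\in\mathcal{O}_2$ write $\lambda=[\lambda_0]+[\lambda_1]\varpi$ with $\lambda_0,\lambda_1\in k$ and $[\cdot]$ the Teichmüller lift. Let $E\supseteq k$ be a field. **Exponents.** Let $\widetilde{\mathbb N}=\mathbb{Z}_{\ge0}/\!\sim$, where $a\sim b$ if $a=b=0$, or $a,b>0$ and $a\equiv b \bmod q-1$. Every $\alpha\in\widetilde{\mathbb N}$ has a unique representative $\sum_{i=0}^{f-1}\alpha_ip^i$ with digits $0\le\alpha_i\le p-1$; indices $i$ are viewed in $\mathbb{Z}/f\mathbb{Z}$. Write $\alpha\preceq\beta$ if $\alpha_i\le\beta_i$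 for all $i$, and then let $\beta\dotdiv\alpha$ be the class with digits $\beta_i-\alpha_i$. For $a\ne0$ let $a-b$ be the unique $c\neq0$ with $b+c=a$. The carry set $I(\alpha,\beta)\subseteq\mathbb{Z}/f\mathbb{Z}$ is the unique set $I$ such that, for every $i$, one has $i\in I$ if and only if $\alpha_i+\beta_i+\varepsilon_i\ge p$, where $\varepsilon_i=1$ if $i-1\in I$ and $\varepsilon_i=0$ otherwise, and such that $I=\varnothing$ if $\alpha_i+\beta_i=p-1$ for all $i$. **Principal series.** Fix $r\in\widetilde{\mathbb N}\setminus\{0\}=\mathbb{Z}/(q-1)\mathbb{Z}$, and let $V_{2,r}=\mathrm{Ind}_B^G\chi_r$ over $E$, where $\chi_r\begin{pmatrix}a&b\\0&d\end{pmatrix}=d_0^r$. It consists of the functions $\varphi:G\to E$ with $\varphi(bg)=\chi_r(b)\varphi(g)$, and $G$ acts by right translation; $g\otimes v$ denotes the function supported on $Bg^{-1}$ with $bg^{-1}\mapsto\chi_r(b)v$. For $j_0,j_1\in\widetilde{\mathbb N}$ put $$f_{(j_0,j_1)}=\sum_{\lambda\in\mathcal{O}_2}\begin{pmatrix}\lambda&1\\1&0\end{pmatrix}\otimes\lambda_0^{j_0}\lambda_1^{j_1},\qquad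 f_{(\infty,j_1)}=\begin{pmatrix}0&1\\1&0\end{pmatrix}f_{(0,j_1)}.$$ **Types.** Let $\le_r$ be the preorder on $\Theta=(\widetilde{\mathbb N}\cup\{\infty\})\times\widetilde{\mathbb N}$ generated by the following relations, for $j_0,j_1\in\widetilde{\mathbb N}$ and $0\le m\le f-1$: 1. $(j_0\dotdiv p^m,j_1)\le_r(j_0,j_1)$ if $p^m\preceq j_0$; 2. $(j_0,j_1\dotdiv p^m)\le_r(j_0,j_1)$ if $p^m\preceq j_1$; 3. $(j_0+p^m,j_1\dotdiv p^m)\le_r(j_0,j_1)$ if $p^m\preceq j_1$; 4. $(r-2j_1-j_0,j_1)\le_r(j_0,j_1)$ if $j_0\ne0$; 5. $(r-2j_1,j_1\dotdiv p^m)\le_r(\infty,j_1)$ if $p^m\preceq j_1$; 6. $((r-2j_1)\dotdiv p^m,j_1)\le_r(\infty,j_1)$ if $p^m\preceq r-2j_1$; 7. $(0,j_1)\le_r(\infty,j_1)$ and $(\infty,j_1)\le_r(0,j_1)$. Types are the equivalence classes in $\Theta$ for this preorder; they are partially ordered by $\le_r$. The type $[(j_0,\gamma)]$ with $j_0\in\widetilde{\mathbb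 N}$ is denoted $(I,\gamma)$, where $I=I(j_0,r-2\gamma-j_0)$; every type is of this form. For a type $\theta$, let $V_\theta\subseteq V_{2,r}$ be the span of the $f_x$ with $x\in\Theta$ and $[x]\le_r\theta$. **Serre weights.** For integers $0\le a_1-a_2\le q-1$ with $a_1-a_2=\sum_in_ip^i$ in base $p$, let $F(a_1,a_2)=\det^{a_2}\otimes\bigotimes_{i=0}^{f-1}(\mathrm{Sym}^{n_i}k^2)^{(i)}$, extended to $E$, where $(i)$ is the twist by the $i$-th power of Frobenius; $G$ acts through $\mathrm{GL}_2(k)$. For $J\subseteq\mathbb{Z}/f\mathbb{Z}$ and $\rho\in\widetilde{\mathbb N}\setminus\{0\}$ let $s_J(\rho)=\sum_is_{J,i}(\rho)p^i$, where $s_{J,i}(\rho)=0$ if $i\notin J$, $s_{J,i}(\rho)=\rho_i+1$ if $i\in J$ and $i-1\notin J$, and $s_{J,i}(\rho)=\rho_i$ if $i,i-1\in J$. Set $\sigma_J(\rho)=F(a_1,s_J(\rho))$. Here, if $J\ne\varnothing$, $a_1$ is the integer with $a_1\equiv \rho-s_J(\rho)\bmod q-1$ and $0\le a_1-s_J(\rho)<q-1$;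 if $J=\varnothing$, $a_1\in\{1,\dots,q-1\}$ is the representative of $\rho$ (so $\sigma_\varnothing(q-1)=F(q-1,0)$ has dimension $q$). **Statement.** Every $V_\theta$ is $G$-stable, and for every type $\theta=(I,\gamma)$ the $G$-module $$L(I,\gamma)=V_{(I,\gamma)}\Big/\sum_{(I',\gamma')<_r(I,\gamma)}V_{(I',\gamma')}$$ is irreducible and isomorphic to $\det^\gamma\otimes\sigma_I(r-2\gamma)$. -/

import Mathlib

open ValuativeRel IsLocalRing

noncomputable section

namespace PrincipalSeries

/-! ### The monoid of exponents -/

/-- For `q = p ^ f`, the congruence `a ∼ b` on `ℕ`: either `a = b = 0`, or `a, b > 0` and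
`a ≡ b` modulo `q - 1`. -/
def expCon (p f : ℕ) : AddCon ℕ where
  r a b := (a = 0 ↔ b = 0) ∧ a ≡ b [MOD p ^ f - 1]
  iseqv := ⟨fun _ => ⟨Iff.rfl, rfl⟩, fun h => ⟨h.1.symm, h.2.symm⟩,
    fun h h' => ⟨h.1.trans h'.1, h.2.trans h'.2⟩⟩
  add' := by
    rintro a b c d ⟨h1, h2⟩ ⟨h3, h4⟩
    exact ⟨by omega, h2.add h4⟩

/-- The monoid `Ñ = ℕ / ∼`. -/
def NTilde (p f : ℕ) : Type := (expCon p f).Quotient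

instance (p f : ℕ) : AddCommMonoid (NTilde p f) :=
  inferInstanceAs (AddCommMonoid (expCon p f).Quotient)

namespace NTilde

variable {p f : ℕ}

/-- The class of a natural number. -/
def mk (n : ℕ) : NTilde p f := ((n : ℕ) : (expCon p f).Quotient)

/-- The least natural number in a class; it lies in `{0, …, q - 1}`. -/
def rep (α : NTilde p f) : ℕ := sInf {n : ℕ | mk n = α}

/-- The base-`p` digits `α_i`, indexed by `ℤ / f`. -/
def digit (α : NTilde p f) (i : ZMod f) : ℕ := α.rep / p ^ i.val % p

/-- The order `α ⪯ β`: digitwise comparison. -/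
def Prec (α β : NTilde p f) : Prop := ∀ i : ZMod f, α.digit i ≤ β.digit i

/-- The class of `p ^ m`. -/
def ppow (m : ZMod f) : NTilde p f := mk (p ^ m.val)

/-- The difference `a - b` for `a ≠ 0`: the unique `c ≠ 0` with `b + c = a`
(see `sub_spec` and `sub_unique`). -/
def sub (a b : NTilde p f) : NTilde p f := a + (p ^ f - 2) • b

/-- The digitwise difference `β ∸ α`, used for `α ⪯ β` only. -/
def tsub (β α : NTilde p f) : NTilde p f := mk (β.rep - α.rep)

theorem mk_eq_mk {a b : ℕ} :
    (mk a : NTilde p f) = mk b ↔ (a = 0 ↔ b = 0) ∧ a ≡ b [MOD p ^ f - 1] :=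
  (expCon p f).eq

theorem mk_surjective (α : NTilde p f) : ∃ n : ℕ, mk n = α :=
  Quotient.inductionOn α fun n => ⟨n, rfl⟩

theorem mk_add (a b : ℕ) : (mk (a + b) : NTilde p f) = mk a + mk b := rfl

theorem mk_nsmul (n a : ℕ) : (mk (n * a) : NTilde p f) = n • mk a := by
  induction n with
  | zero => simp only [Nat.zero_mul, zero_nsmul]; rfl
  | succ n ih => rw [Nat.succ_mul, mk_add, ih, succ_nsmul]

theorem mk_zero : (mk 0 : NTilde p f) = 0 := rfl

theorem mk_rep (α : NTilde p f) : mk α.rep = α :=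
  Nat.sInf_mem (s := {n : ℕ | mk n = α}) (mk_surjective α)

theorem rep_lt (hq : 2 ≤ p ^ f) (α : NTilde p f) : α.rep < p ^ f := by
  obtain ⟨n, rfl⟩ := mk_surjective α
  rcases Nat.eq_zero_or_pos n with rfl | hn
  · have : (mk 0 : NTilde p f).rep ≤ 0 := Nat.sInf_le rfl
    omega
  · have h : (mk n : NTilde p f).rep ≤ (n - 1) % (p ^ f - 1) + 1 := by
      refine Nat.sInf_le (mk_eq_mk.2 ⟨by omega, ?_⟩)
      have := (Nat.mod_modEq (n - 1) (p ^ f - 1)).add_right 1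
      rwa [Nat.sub_add_cancel hn] at this
    have := Nat.mod_lt (n - 1) (show 0 < p ^ f - 1 by omega)
    omega

theorem sub_spec (hq : 2 ≤ p ^ f) {a : NTilde p f} (ha : a ≠ 0) (b : NTilde p f) :
    sub a b ≠ 0 ∧ b + sub a b = a := by
  obtain ⟨m, rfl⟩ := mk_surjective a
  obtain ⟨n, rfl⟩ := mk_surjective b
  have hm : m ≠ 0 := by rintro rfl; exact ha rfl
  rw [sub, ← mk_nsmul, ← mk_add, ← mk_add, ← mk_zero, Ne, mk_eq_mk, mk_eq_mk]
  refine ⟨fun h => by have := h.1; omega, by omega, ?_⟩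
  have h : n + (m + (p ^ f - 2) * n) = m + (p ^ f - 1) * n := by
    obtain ⟨t, ht⟩ := Nat.exists_eq_add_of_le hq
    have h1 : p ^ f - 2 = t := by omega
    have h2 : p ^ f - 1 = t + 1 := by omega
    rw [h1, h2]; ring
  rw [h]
  simp [Nat.ModEq]

theorem sub_unique (hq : 2 ≤ p ^ f) {a : NTilde p f} (ha : a ≠ 0) (b c : NTilde p f)
    (hc : c ≠ 0) (h : b + c = a) : c = sub a b := by
  obtain ⟨h1, h2⟩ := sub_spec hq ha b
  generalize sub a b = d at h1 h2 ⊢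
  rw [← h2] at h
  obtain ⟨m, rfl⟩ := mk_surjective b
  obtain ⟨n, rfl⟩ := mk_surjective c
  obtain ⟨k, rfl⟩ := mk_surjective d
  have hn : n ≠ 0 := by rintro rfl; exact hc rfl
  have hk : k ≠ 0 := by rintro rfl; exact h1 rfl
  rw [← mk_add, ← mk_add, mk_eq_mk] at h
  exact mk_eq_mk.2 ⟨by omega, Nat.ModEq.add_left_cancel' m h.2⟩

end NTilde

open NTilde

/-! ### Carry sets -/

/-- Carrying in column `i` of the cyclic base-`p` addition of `α` and `β`, each column `i`
receiving the carry of column `i - 1`. -/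
inductive Carry {p f : ℕ} (α β : NTilde p f) : ZMod f → Prop
  | start (i : ZMod f) : p ≤ α.digit i + β.digit i → Carry α β i
  | step (i : ZMod f) : Carry α β (i - 1) → p ≤ α.digit i + β.digit i + 1 → Carry α β i

/-- The carry set `I(α, β) ⊆ ℤ / f`. It is the unique set satisfying the conditions listed
in `isCarrySet_iff`. -/
def carrySet {p f : ℕ} (α β : NTilde p f) : Set (ZMod f) := {i | Carry α β i}

/-- The conditions characterizing the carry set. -/
structure IsCarrySet {p f : ℕ} (α β : NTilde p f) (I : Set (ZMod f)) : Prop where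
  out_out : ∀ i, i - 1 ∉ I → i ∉ I → α.digit i + β.digit i + 1 ≤ p
  in_out : ∀ i, i - 1 ∈ I → i ∉ I → α.digit i + β.digit i + 2 ≤ p
  out_in : ∀ i, i - 1 ∉ I → i ∈ I → p ≤ α.digit i + β.digit i
  in_in : ∀ i, i - 1 ∈ I → i ∈ I → p ≤ α.digit i + β.digit i + 1
  empty : (∀ i, α.digit i + β.digit i + 1 = p) → I = ∅

theorem isCarrySet_carrySet {p f : ℕ} (α β : NTilde p f) : IsCarrySet α β (carrySet α β) where
  out_out i _ h := by
    by_contra h'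
    exact h (Carry.start i (by omega))
  in_out i h1 h := by
    by_contra h'
    exact h (Carry.step i h1 (by omega))
  out_in i h1 h := by
    cases h with
    | start _ h => exact h
    | step _ h _ => exact absurd h h1
  in_in i _ h := by
    cases h with
    | start _ h => omega
    | step _ _ h => exact h
  empty h := by
    refine Set.eq_empty_of_forall_notMem fun i hi => ?_
    induction hi with
    | start i h' => have := h i; omega
    | step i _ _ ih => exact ih

theorem isCarrySet_iff {p f : ℕ} [NeZero f] (α β : NTilde p f) (I : Set (ZMod f)) :
    IsCarrySet α β I ↔ I = carrySet α β := by
  refine ⟨fun h => ?_, fun h => h ▸ isCarrySet_carrySet α β⟩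
  have h' := isCarrySet_carrySet α β
  by_cases hall : ∀ i, α.digit i + β.digit i + 1 = p
  · rw [h.empty hall, h'.empty hall]
  · obtain ⟨i, hi⟩ := not_forall.1 hall
    clear hall
    have base : i ∈ I ↔ i ∈ carrySet α β := by
      have a1 := h.out_out i; have a2 := h.in_out i; have a3 := h.out_in i
      have a4 := h.in_in i
      have b1 := h'.out_out i; have b2 := h'.in_out i; have b3 := h'.out_in i
      have b4 := h'.in_in i
      by_cases c1 : i - 1 ∈ I <;> by_cases c2 : i ∈ I <;>
        by_cases c3 : i - 1 ∈ carrySet α β <;> by_cases c4 : i ∈ carrySet α β <;>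
        simp only [c1, c2, c3, c4, not_true_eq_false, not_false_eq_true, forall_const,
          IsEmpty.forall_iff] at a1 a2 a3 a4 b1 b2 b3 b4 ⊢ <;> omega
    have key : ∀ n : ℕ, (i + n ∈ I ↔ i + n ∈ carrySet α β) := by
      intro n
      induction n with
      | zero => simpa using base
      | succ n ih =>
        set j : ZMod f := i + ((n + 1 : ℕ) : ZMod f) with hj
        have hjn : j - 1 = i + n := by rw [hj]; push_cast; ring
        rw [← hjn] at ih
        have a1 := h.out_out j; have a2 := h.in_out j; have a3 := h.out_in j
        have a4 := h.in_in j
        have b1 := h'.out_out j; have b2 := h'.in_out j; have b3 := h'.out_in j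
        have b4 := h'.in_in j
        by_cases c1 : j - 1 ∈ I <;> by_cases c2 : j ∈ I <;>
          by_cases c4 : j ∈ carrySet α β <;>
          simp only [c1, c2, c4, ← ih, not_true_eq_false, not_false_eq_true, forall_const,
            IsEmpty.forall_iff] at a1 a2 a3 a4 b1 b2 b3 b4 ⊢ <;> omega
    ext j
    have := key (j - i).val
    simpa using this

/-! ### Types -/

/-- The set `Θ = (Ñ ∪ {∞}) × Ñ`. It carries a preorder depending on `r`. -/
inductive Theta (p f : ℕ) (r : NTilde p f) : Type
  | fin (j₀ j₁ : NTilde p f) : Theta p f r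
  | infty (j₁ : NTilde p f) : Theta p f r

/-- The generating relations of the preorder `≤_r`; `GenRel x y` stands for `x ≤_r y`. -/
inductive GenRel {p f : ℕ} {r : NTilde p f} : Theta p f r → Theta p f r → Prop
  | rel1 (j₀ j₁ : NTilde p f) (m : ZMod f) :
      Prec (ppow m) j₀ → GenRel (.fin (tsub j₀ (ppow m)) j₁) (.fin j₀ j₁)
  | rel2 (j₀ j₁ : NTilde p f) (m : ZMod f) :
      Prec (ppow m) j₁ → GenRel (.fin j₀ (tsub j₁ (ppow m))) (.fin j₀ j₁)
  | rel3 (j₀ j₁ : NTilde p f) (m : ZMod f) :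
      Prec (ppow m) j₁ → GenRel (.fin (j₀ + ppow m) (tsub j₁ (ppow m))) (.fin j₀ j₁)
  | rel4 (j₀ j₁ : NTilde p f) :
      j₀ ≠ 0 → GenRel (.fin (sub (sub r (2 • j₁)) j₀) j₁) (.fin j₀ j₁)
  | rel5 (j₁ : NTilde p f) (m : ZMod f) :
      Prec (ppow m) j₁ → GenRel (.fin (sub r (2 • j₁)) (tsub j₁ (ppow m))) (.infty j₁)
  | rel6 (j₁ : NTilde p f) (m : ZMod f) :
      Prec (ppow m) (sub r (2 • j₁)) →
        GenRel (.fin (tsub (sub r (2 • j₁)) (ppow m)) j₁) (.infty j₁)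
  | rel7 (j₁ : NTilde p f) : GenRel (.fin 0 j₁) (.infty j₁)
  | rel7' (j₁ : NTilde p f) : GenRel (.infty j₁) (.fin 0 j₁)

instance {p f : ℕ} {r : NTilde p f} : Preorder (Theta p f r) where
  le := Relation.ReflTransGen GenRel
  le_refl _ := Relation.ReflTransGen.refl
  le_trans _ _ _ := Relation.ReflTransGen.trans

/-- The partially ordered set of types: equivalence classes in `Θ`. -/
abbrev Types (p f : ℕ) (r : NTilde p f) : Type := Antisymmetrization (Theta p f r) (· ≤ ·)

/-- The type `[x]` of an element `x` of `Θ`. -/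
def typeOf {p f : ℕ} {r : NTilde p f} (x : Theta p f r) : Types p f r :=
  toAntisymmetrization (· ≤ ·) x

/-- The type `θ` is written `(I, γ)`: it is the class of some `(j₀, γ)` with
`I = I(j₀, r - 2γ - j₀)`. -/
def IsPair {p f : ℕ} {r : NTilde p f} (θ : Types p f r) (I : Set (ZMod f))
    (γ : NTilde p f) : Prop :=
  ∃ j₀ : NTilde p f, θ = typeOf (.fin j₀ γ) ∧ I = carrySet j₀ (sub (sub r (2 • γ)) j₀)

theorem exists_isPair {p f : ℕ} {r : NTilde p f} (θ : Types p f r) :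
    ∃ I γ, IsPair θ I γ := by
  obtain ⟨x, rfl⟩ : ∃ x, typeOf x = θ := Quotient.inductionOn θ fun x => ⟨x, rfl⟩
  cases x with
  | fin j₀ j₁ => exact ⟨_, j₁, j₀, rfl, rfl⟩
  | infty j₁ =>
    refine ⟨_, j₁, 0, Quotient.sound ⟨?_, ?_⟩, rfl⟩
    · exact Relation.ReflTransGen.single (GenRel.rel7' j₁)
    · exact Relation.ReflTransGen.single (GenRel.rel7 j₁)

/-! ### The group `GL₂(𝒪 / 𝔪²)` and the principal series -/

section Rep

variable (R : Type*) [CommRing R] [IsLocalRing R]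

/-- The ring `𝒪₂ = 𝒪 / 𝔪²`. -/
abbrev R₂ : Type _ := R ⧸ maximalIdeal R ^ 2

/-- The reduction map `𝒪₂ → k`, written `λ ↦ λ₀`. -/
def red : R₂ R →+* ResidueField R :=
  Ideal.Quotient.lift _ (residue R) fun a ha =>
    (residue_eq_zero_iff a).2 (Ideal.pow_le_self two_ne_zero ha)

theorem red_surjective : Function.Surjective (red R) := fun x => by
  obtain ⟨y, rfl⟩ := residue_surjective (R := R) x
  exact ⟨Ideal.Quotient.mk _ y, rfl⟩

/-- The image in `𝒪₂` of the Teichmüller lift of `x ∈ k`: the `q`-th power of any lift of `x`,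
where `q` is the cardinality of `k`. It is the unique `t ∈ 𝒪₂` lifting `x` with `t ^ q = t`
(see `teich_spec` and `teich_unique`). -/
def teich (x : ResidueField R) : R₂ R :=
  Function.surjInv (red_surjective R) x ^ Nat.card (ResidueField R)

theorem pow_card_eq_of_red_eq [Finite (ResidueField R)] {a b : R₂ R} (h : red R a = red R b) :
    a ^ Nat.card (ResidueField R) = b ^ Nat.card (ResidueField R) := by
  set q := Nat.card (ResidueField R) with hq
  have hq0 : (q : ResidueField R) = 0 := by
    let := Fintype.ofFinite (ResidueField R)
    rw [hq, Nat.card_eq_fintype_card, Nat.cast_card_eq_zero]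
  obtain ⟨x, rfl⟩ := Ideal.Quotient.mk_surjective a
  obtain ⟨y, rfl⟩ := Ideal.Quotient.mk_surjective b
  have h' : residue R x = residue R y := h
  rw [← map_pow, ← map_pow, Ideal.Quotient.eq, ← (Commute.all x y).geom_sum₂_mul, pow_two]
  refine Ideal.mul_mem_mul ?_ ?_
  · rw [← residue_eq_zero_iff, map_sum]
    simp only [map_mul, map_pow, h']
    rw [Finset.sum_congr rfl (g := fun _ => residue R y ^ (q - 1))]
    · simp [hq0]
    · intro i hi
      have := Finset.mem_range.1 hi
      rw [← pow_add]
      congr 1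
      omega
  · rw [← residue_eq_zero_iff, map_sub, h', sub_self]

theorem teich_spec [Finite (ResidueField R)] (x : ResidueField R) :
    red R (teich R x) = x ∧ teich R x ^ Nat.card (ResidueField R) = teich R x := by
  have h : red R (teich R x) = x := by
    let := Fintype.ofFinite (ResidueField R)
    rw [teich, map_pow, Function.surjInv_eq (red_surjective R), Nat.card_eq_fintype_card,
      FiniteField.pow_card]
  refine ⟨h, ?_⟩
  conv_rhs => rw [teich]
  exact pow_card_eq_of_red_eq R (h.trans (Function.surjInv_eq _ _).symm)

theorem teich_unique [Finite (ResidueField R)] (x : ResidueField R) (t : R₂ R)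
    (h : red R t = x) (ht : t ^ Nat.card (ResidueField R) = t) : t = teich R x := by
  obtain ⟨h1, h2⟩ := teich_spec R x
  rw [← ht, ← h2]
  exact pow_card_eq_of_red_eq R (h.trans h1.symm)

/-- The group `GL₂(𝒪₂)`. -/
abbrev G₂ : Type _ := Matrix.GeneralLinearGroup (Fin 2) (R₂ R)

/-- The subgroup `B₂` of upper triangular matrices. -/
def borel : Subgroup (G₂ R) where
  carrier := {g | (g : Matrix (Fin 2) (Fin 2) (R₂ R)) 1 0 = 0}
  one_mem' := by simp
  mul_mem' {a b} ha hb := by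
    simp only [Set.mem_ofPred_eq] at ha hb ⊢
    simp [Matrix.mul_apply, Fin.sum_univ_two, ha, hb]
  inv_mem' {a} ha := by
    simp only [Set.mem_ofPred_eq] at ha ⊢
    rw [Matrix.coe_units_inv, Matrix.inv_def, Matrix.adjugate_fin_two]
    simp [ha]

theorem mem_borel {g : G₂ R} :
    g ∈ borel R ↔ (g : Matrix (Fin 2) (Fin 2) (R₂ R)) 1 0 = 0 := Iff.rfl

/-- The invertible matrix `(x 1; 1 0)`. For `x = 0` it is the element `w`. -/
def flipMat (x : R₂ R) : G₂ R where
  val := !![x, 1; 1, 0]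
  inv := !![0, 1; 1, -x]
  val_inv := by ext i j; fin_cases i <;> fin_cases j <;> simp
  inv_val := by ext i j; fin_cases i <;> fin_cases j <;> simp

variable (E : Type*) [Field E] [Algebra (ResidueField R) E] {p f : ℕ} (r : NTilde p f)

/-- The character `χ_r : (a b; 0 d) ↦ d₀ ^ r`, with values in `E`. -/
def chi : borel R →* E where
  toFun b := algebraMap (ResidueField R) E
    (red R (((b : G₂ R) : Matrix (Fin 2) (Fin 2) (R₂ R)) 1 1)) ^ r.rep
  map_one' := by simp
  map_mul' a b := by
    have ha := (mem_borel R).1 a.2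
    simp [Matrix.mul_apply, Fin.sum_univ_two, ha, mul_pow]

/-- The one-dimensional representation of `B₂` on `E` given by `χ_r`. -/
def chiRep : Representation E (borel R) E where
  toFun b := chi R E r b • LinearMap.id
  map_one' := by ext; simp
  map_mul' a b := by ext; simp [mul_comm]

/-- The underlying space of the principal series `V_{2,r}`: functions `φ : GL₂(𝒪₂) → E` with
`φ (b g) = χ_r(b) φ(g)` for `b ∈ B₂`. -/
def V : Type _ := Representation.coindV (borel R).subtype (chiRep R E r)

instance : AddCommGroup (V R E r) :=
  inferInstanceAs (AddCommGroup (Representation.coindV (borel R).subtype (chiRep R E r)))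

instance : Module E (V R E r) :=
  inferInstanceAs (Module E (Representation.coindV (borel R).subtype (chiRep R E r)))

/-- The principal series `V_{2,r} = Ind_{B₂}^{GL₂(𝒪₂)} χ_r`, where the group acts by right
translation of functions. -/
def principalSeries : Representation E (G₂ R) (V R E r) :=
  Representation.coind (borel R).subtype (chiRep R E r)

open Classical in
/-- The element `g ⊗ v` of the principal series: the function supported on `B₂ g⁻¹` with
`b g⁻¹ ↦ χ_r(b) v`. -/
def pureTensor (g : G₂ R) (v : E) : V R E r :=
  ⟨fun y => if h : y * g ∈ borel R then chi R E r ⟨y * g, h⟩ * v else 0, by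
    intro b y
    have hiff : (b : G₂ R) * y * g ∈ borel R ↔ y * g ∈ borel R := by
      rw [mul_assoc]; exact (borel R).mul_mem_cancel_left b.2
    by_cases h : y * g ∈ borel R
    · have h' := hiff.2 h
      have e : (⟨(b : G₂ R) * y * g, h'⟩ : borel R) = b * ⟨y * g, h⟩ :=
        Subtype.ext (mul_assoc _ _ _)
      simp only [Subgroup.subtype_apply, dif_pos h, dif_pos h', e, map_mul]
      simp [chiRep, mul_assoc]
    · have h' := fun h0 => h (hiff.1 h0)
      simp only [Subgroup.subtype_apply, dif_neg h, map_zero]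
      exact dif_neg h'⟩

variable [Finite (ResidueField R)]

/-- The vector `f_{(j₀, j₁)} = ∑_λ (λ 1; 1 0) ⊗ λ₀^{j₀} λ₁^{j₁}`, the sum running over
`λ = [λ₀] + [λ₁] ϖ ∈ 𝒪₂`, that is, over all `λ₀, λ₁ ∈ k`. -/
def fVec (ϖ : R) (j₀ j₁ : NTilde p f) : V R E r :=
  letI := Fintype.ofFinite (ResidueField R)
  ∑ a : ResidueField R, ∑ b : ResidueField R,
    pureTensor R E r (flipMat R (teich R a + teich R b * Ideal.Quotient.mk _ ϖ))
      (algebraMap (ResidueField R) E (a ^ j₀.rep * b ^ j₁.rep))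

/-- The basis vectors `f_x`, `x ∈ Θ`, where `f_{(∞, j₁)} = w f_{(0, j₁)}`. -/
def basisVec (ϖ : R) : Theta p f r → V R E r
  | .fin j₀ j₁ => fVec R E r ϖ j₀ j₁
  | .infty j₁ => principalSeries R E r (flipMat R 0) (fVec R E r ϖ 0 j₁)

/-- The subspace `V_θ`, spanned by the `f_x` with `[x] ≤_r θ`. -/
def VSub (ϖ : R) (θ : Types p f r) : Submodule E (V R E r) :=
  Submodule.span E {v | ∃ x : Theta p f r, typeOf x ≤ θ ∧ v = basisVec R E r ϖ x}

/-- The sum of the subspaces `V_θ'` over all types `θ' <_r θ`. -/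
def VSubLT (ϖ : R) (θ : Types p f r) : Submodule E (V R E r) :=
  ⨆ θ' : {θ' : Types p f r // θ' < θ}, VSub R E r ϖ θ'.1

/-- All subspaces `V_θ` are stable under `GL₂(𝒪₂)`. -/
def AllStable (ϖ : R) : Prop :=
  ∀ (θ : Types p f r) (g : G₂ R),
    VSub R E r ϖ θ ≤ (VSub R E r ϖ θ).comap (principalSeries R E r g)

variable {R E r}

/-- The representation of `GL₂(𝒪₂)` on `V_θ`. -/
def subRep {ϖ : R} (h : AllStable R E r ϖ) (θ : Types p f r) :
    Representation E (G₂ R) (VSub R E r ϖ θ) :=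
  (principalSeries R E r).subrepresentation (VSub R E r ϖ θ) (h θ)

theorem VSubLT_stable {ϖ : R} (h : AllStable R E r ϖ) (θ : Types p f r) (g : G₂ R) :
    VSubLT R E r ϖ θ ≤ (VSubLT R E r ϖ θ).comap (principalSeries R E r g) :=
  iSup_le fun θ' => (h θ'.1 g).trans
    (Submodule.comap_mono (le_iSup (fun θ' : {θ' : Types p f r // θ' < θ} =>
      VSub R E r ϖ θ'.1) θ'))

/-- The representation `L(θ) = V_θ / ∑_{θ' <_r θ} V_θ'` of `GL₂(𝒪₂)`. -/
def headRep {ϖ : R} (h : AllStable R E r ϖ) (θ : Types p f r) :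
    Representation E (G₂ R)
      (VSub R E r ϖ θ ⧸ (VSubLT R E r ϖ θ).comap (VSub R E r ϖ θ).subtype) :=
  (subRep h θ).quotient _ fun g _ hv => VSubLT_stable h θ g hv

end Rep

/-! ### Serre weights -/

section Serre

variable (k : Type*) [Field k] (E : Type*) [Field E] [Algebra k E]

variable {E} in
/-- The substitution `X_j ↦ ∑ i, g_{ij} X_i` on polynomials in two variables `X₀, X₁`. -/
def subst (g : Matrix (Fin 2) (Fin 2) E) :
    MvPolynomial (Fin 2) E →ₐ[E] MvPolynomial (Fin 2) E :=
  MvPolynomial.aeval fun j => ∑ i, MvPolynomial.C (g i j) * MvPolynomial.X i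

variable {E} in
theorem subst_one : subst (1 : Matrix (Fin 2) (Fin 2) E) = AlgHom.id E _ := by
  ext j : 1
  simp only [subst, MvPolynomial.aeval_X, AlgHom.id_apply, Fin.sum_univ_two]
  fin_cases j <;> simp [Matrix.one_apply]

variable {E} in
theorem subst_mul (g h : Matrix (Fin 2) (Fin 2) E) :
    subst (g * h) = (subst g).comp (subst h) := by
  ext j : 1
  simp only [subst, MvPolynomial.aeval_X, AlgHom.comp_apply, Matrix.mul_apply, Fin.sum_univ_two,
    map_add, map_mul, MvPolynomial.aeval_C, MvPolynomial.algebraMap_eq]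
  ring

variable {E} in
theorem subst_mem (g : Matrix (Fin 2) (Fin 2) E) (t : ℕ) {P : MvPolynomial (Fin 2) E}
    (hP : P ∈ MvPolynomial.homogeneousSubmodule (Fin 2) E t) :
    subst g P ∈ MvPolynomial.homogeneousSubmodule (Fin 2) E t := by
  have := MvPolynomial.IsHomogeneous.aeval (m := t) (n := 1) hP
    (fun j => ∑ i, MvPolynomial.C (g i j) * MvPolynomial.X i : Fin 2 → MvPolynomial (Fin 2) E)
    (fun j => MvPolynomial.IsHomogeneous.sum _ _ _ fun i _ =>
      MvPolynomial.isHomogeneous_C_mul_X _ _)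
  rw [one_mul] at this
  exact this

/-- `Sym^t` of the standard two-dimensional representation: homogeneous polynomials of degree
`t` in two variables, a matrix `g` acting by the substitution `X_j ↦ ∑ i, g_{ij} X_i`. -/
def symRep (t : ℕ) :
    Matrix (Fin 2) (Fin 2) E →* Module.End E (MvPolynomial.homogeneousSubmodule (Fin 2) E t) where
  toFun g := (subst g).toLinearMap.restrict fun _ hP => subst_mem g t hP
  map_one' := by
    refine LinearMap.ext fun P => Subtype.ext ?_
    change subst 1 P.1 = P.1
    rw [subst_one, AlgHom.id_apply]
  map_mul' g h := by
    refine LinearMap.ext fun P => Subtype.ext ?_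
    change subst (g * h) P.1 = subst g (subst h P.1)
    rw [subst_mul, AlgHom.comp_apply]

variable (p f : ℕ) [Fact p.Prime] [CharP k p]

/-- The space `⨂_{i < f} Sym^{n_i}`, where `n_0, …, n_{f-1}` are the base-`p` digits of `n`. -/
abbrev SerreSpace (n : ℕ) : Type _ :=
  PiTensorProduct E fun i : Fin f =>
    MvPolynomial.homogeneousSubmodule (Fin 2) E (n / p ^ (i : ℕ) % p)

/-- The Serre weight `F(a₁, a₂)` for integers with `0 ≤ a₁ - a₂ ≤ q - 1`, over `E`:
the representation `det^{a₂} ⊗ ⨂_i (Sym^{n_i} k²)^{(i)}` of `GL₂(k)`, where the `n_i` are the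
base-`p` digits of `a₁ - a₂` and `(i)` is the twist by the `i`-th power of Frobenius. -/
def serreWeight (a₁ a₂ : ℤ) :
    Representation E (Matrix.GeneralLinearGroup (Fin 2) k)
      (SerreSpace E p f (a₁ - a₂).toNat) where
  toFun g := algebraMap k E ((Matrix.GeneralLinearGroup.det g ^ a₂ : kˣ) : k) •
    PiTensorProduct.map fun i : Fin f => symRep E _
      ((Matrix.GeneralLinearGroup.map
        ((algebraMap k E).comp (iterateFrobenius k p (i : ℕ))) g : _ ) : Matrix (Fin 2) (Fin 2) E)
  map_one' := by
    simp only [map_one, one_zpow, Units.val_one, one_smul]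
    exact PiTensorProduct.map_one
  map_mul' g h := by
    simp only [map_mul, mul_zpow, Units.val_mul]
    rw [smul_mul_smul_comm, ← PiTensorProduct.map_mul]

/-- The integer `s_J(r) = ∑_i s_{J,i}(r) p^i`, where `s_{J,i}(r)` is `0` if `i ∉ J`,
`r_i + 1` if `i ∈ J` and `i - 1 ∉ J`, and `r_i` if `i, i - 1 ∈ J`. -/
def sJ {p f : ℕ} [NeZero f] (J : Set (ZMod f)) (r : NTilde p f) : ℕ :=
  open Classical in
  ∑ i : ZMod f, (if i ∉ J then 0 else if i - 1 ∉ J then r.digit i + 1 else r.digit i) *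
    p ^ i.val

/-- The first parameter of `σ_J(r)`: for `J ≠ ∅`, the unique integer `a₁ ≡ r - s_J(r)` modulo
`q - 1` with `0 ≤ a₁ - s_J(r) < q - 1`; for `J = ∅`, the representative of `r` in
`{1, …, q - 1}` (so that `σ_∅(q - 1)` is `F(q - 1, 0)`). -/
def aJ {p f : ℕ} [NeZero f] (J : Set (ZMod f)) (r : NTilde p f) : ℤ :=
  open Classical in
  if J = ∅ then r.rep else sJ J r + ((r.rep : ℤ) - 2 * sJ J r) % ((p : ℤ) ^ f - 1)

/-- The Serre weight `σ_J(r) = F(r - s_J(r), s_J(r))`. -/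
def sigmaJ {p f : ℕ} [Fact p.Prime] [CharP k p] [NeZero f] (J : Set (ZMod f))
    (r : NTilde p f) :
    Representation E (Matrix.GeneralLinearGroup (Fin 2) k)
      (SerreSpace E p f (aJ J r - sJ J r).toNat) :=
  serreWeight k E p f (aJ J r) (sJ J r)

variable {k E}

/-- The twist `det^γ ⊗ σ`. -/
def detTwist {p f : ℕ} {W : Type*} [AddCommMonoid W] [Module E W] (γ : NTilde p f)
    (σ : Representation E (Matrix.GeneralLinearGroup (Fin 2) k) W) :
    Representation E (Matrix.GeneralLinearGroup (Fin 2) k) W where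
  toFun g := algebraMap k E ((Matrix.GeneralLinearGroup.det g : kˣ) : k) ^ γ.rep • σ g
  map_one' := by simp
  map_mul' g h := by
    simp only [map_mul, Units.val_mul, mul_pow]
    rw [smul_mul_smul_comm]

end Serre

/-- The inflation of a representation of `GL₂(k)` to `GL₂(𝒪₂)`. -/
def inflate (R : Type*) [CommRing R] [IsLocalRing R] {E : Type*} [Field E] {W : Type*}
    [AddCommMonoid W] [Module E W]
    (σ : Representation E (Matrix.GeneralLinearGroup (Fin 2) (ResidueField R)) W) :
    Representation E (G₂ R) W :=
  σ.comp (Matrix.GeneralLinearGroup.map (red R))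

end PrincipalSeries

end

set_option linter.unusedSectionVars false

noncomputable section

namespace PrincipalSeries

/-! ### Digits -/

/-! Since `p` lies in the square of the maximal ideal, the `q`-th power map is additive on `𝒪₂`, so
the Teichmüller lift is a ring homomorphism and `𝒪₂` is the ring of dual numbers over `k`
(`isDualNumbers`). An element of the principal series depends only on the bottom row `(c, d)` of a
matrix. Solving `cλ + d = 0` shows that `f_x` is, up to sign, the monomial function `c₀^a d₀^b W^γ`,
where `W = c₀ d₁ - c₁ d₀` and `a + b = r - 2γ` (`toFun_basisVec`). So `Θ` is just the set of
admissible exponent triples, `∞` standing for `a = 0`. The monomials are linearly independent by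
Dedekind's theorem on characters (`linearIndependent_monVec`).

Generators of the group substitute `d ↦ d + tc`, or `W ↦ W + tc²`, or rescale `c`, `d` and send `W`
to a multiple of `W` plus a multiple of `cd`, or exchange `c` and `d`. Expanding the powers by the
digitwise binomial theorem moves digits from `b` to `a`, replaces digits of `γ` by `2` units in `a`,
or replaces them by a unit in `a` and one in `b`. These are the generating relations of `≤_r`, which
gives stability (`allStable`).

To separate types, weigh a monomial by `3|γ| + |a| + |b|`, with `|·|` the sum of digits. No relation
increases this rank. It stays constant only if `γ` and all column sums `a_i + b_i` are unchanged; a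
carry, or a loss in `γ`, lowers it strictly. Conversely, monomials with the same `γ` and column sums
are comparable both ways. Hence a type is `γ` together with the column sums (`typeOf_eq_iff`), and
the column sums are governed by the carry set (`digit_add_digit`).

In the head of `V_θ` only monomials of type exactly `θ` survive. Put `e_i = max(0, a_i + b_i - (p -
1))` and `N_i = a_i + b_i - 2 e_i`; the surviving monomials have `a = m + e`, `b = N - m + e` with
`0 ≤ m ≤ N`. Rescaling by `∏ (N_i - m_i)! / (N_i - m_i + e_i)!` turns their matrices into those of
the monomial basis of `det^γ ⊗ ⨂ (det^{e_i} ⊗ Sym^{N_i})^{(i)}` (`isModel_headRep`). Such a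
representation is irreducible because all `N_i < p` (`IsModel.isIrreducible`). The Serre weight has
the same model (`isModel_serreWeight`), because the carry rule gives `s_I = ∑ e_i p^i`
(`sJ_carrySet`) and `a₁ - s_I = ∑ N_i p^i` (`toNat_aJ_sub_sJ`). -/

theorem sum_range_digits (p : ℕ) (n x : ℕ) :
    ∑ j ∈ Finset.range n, x / p ^ j % p * p ^ j = x % p ^ n := by
  induction n with
  | zero => simp [Nat.mod_one]
  | succ n ih => rw [Finset.sum_range_succ, ih, pow_succ, Nat.mod_mul, mul_comm (p ^ n)]

theorem sum_range_lt_pow {p : ℕ} (n : ℕ) (u : ℕ → ℕ) (hu : ∀ j < n, u j < p) :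
    ∑ j ∈ Finset.range n, u j * p ^ j < p ^ n := by
  induction n with
  | zero => simp
  | succ n ih =>
    rw [Finset.sum_range_succ, pow_succ]
    have h1 := ih fun j hj => hu j (by omega)
    have h2 : (u n + 1) * p ^ n ≤ p * p ^ n := Nat.mul_le_mul_right _ (hu n (by omega))
    nlinarith

theorem digit_sum_range {p : ℕ} (n : ℕ) (u : ℕ → ℕ) (hu : ∀ j < n, u j < p) {i : ℕ} (hi : i < n) :
    (∑ j ∈ Finset.range n, u j * p ^ j) / p ^ i % p = u i := by
  have hp : 0 < p := by have := hu i hi; omega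
  -- Cut the sum at column `i`: the part below is less than `p ^ i`, and the part above is divisible
  -- by `p ^ (i + 1)`.
  obtain ⟨d, rfl⟩ : ∃ d, n = i + 1 + d := ⟨n - (i + 1), by omega⟩
  rw [Finset.sum_range_add, Finset.sum_range_succ]
  have h1 := sum_range_lt_pow i u fun j hj => hu j (by omega)
  have h2 : ∑ x ∈ Finset.range d, u (i + 1 + x) * p ^ (i + 1 + x) =
      p ^ i * (p * ∑ x ∈ Finset.range d, u (i + 1 + x) * p ^ x) := by
    rw [Finset.mul_sum, Finset.mul_sum]
    refine Finset.sum_congr rfl fun x _ => ?_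
    rw [pow_add, pow_succ]; ring
  rw [h2, show ∀ a b c : ℕ, a + b * p ^ i + p ^ i * c = a + p ^ i * (b + c) by intros; ring,
    Nat.add_mul_div_left _ _ (pow_pos hp i), Nat.div_eq_of_lt h1, zero_add,
    Nat.add_mul_mod_self_left, Nat.mod_eq_of_lt (hu i hi)]

theorem sum_zmod_val {M : Type*} [AddCommMonoid M] {f : ℕ} [NeZero f] (g : ℕ → M) :
    ∑ i : ZMod f, g i.val = ∑ j ∈ Finset.range f, g j := by
  obtain ⟨n, rfl⟩ : ∃ n, f = n + 1 := ⟨f - 1, by have := NeZero.pos f; omega⟩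
  exact Fin.sum_univ_eq_sum_range g (n + 1)

section

variable {p f : ℕ} [NeZero f]

theorem sum_zmod_eq_range (u : ZMod f → ℕ) :
    ∑ i : ZMod f, u i * p ^ i.val = ∑ j ∈ Finset.range f, u (j : ZMod f) * p ^ j := by
  rw [← sum_zmod_val (f := f) fun j => u (j : ZMod f) * p ^ j]
  simp

theorem sum_lt_pow (u : ZMod f → ℕ) (hu : ∀ i, u i < p) : ∑ i : ZMod f, u i * p ^ i.val < p ^ f := by
  rw [sum_zmod_eq_range]
  exact sum_range_lt_pow _ _ fun j _ => hu j

theorem digit_sum (u : ZMod f → ℕ) (hu : ∀ i, u i < p) (i : ZMod f) :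
    (∑ i : ZMod f, u i * p ^ i.val) / p ^ i.val % p = u i := by
  rw [sum_zmod_eq_range, digit_sum_range f (fun j => u (j : ZMod f)) (fun j _ => hu j)
    (ZMod.val_lt i)]
  simp

end

/-! ### Digit functions, carrying and digit sums in the monoid of exponents. -/

namespace NTilde

variable {p f : ℕ}

theorem mk_eq_zero {n : ℕ} : (mk n : NTilde p f) = 0 ↔ n = 0 := by
  rw [← mk_zero, mk_eq_mk]
  exact ⟨fun h => h.1.2 rfl, by rintro rfl; exact ⟨Iff.rfl, rfl⟩⟩

theorem rep_mk {n : ℕ} (hn : n < p ^ f) : (mk n : NTilde p f).rep = n := by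
  refine le_antisymm (Nat.sInf_le rfl) ?_
  have h := mk_rep (mk n : NTilde p f)
  rw [mk_eq_mk] at h
  by_contra! hlt
  have h3 := (Nat.modEq_iff_dvd' hlt.le).1 h.2
  have := Nat.le_of_dvd (by omega) h3
  omega

theorem rep_zero : (0 : NTilde p f).rep = 0 :=
  Nat.le_zero.1 (Nat.sInf_le (s := {n : ℕ | (mk n : NTilde p f) = 0}) mk_zero)

theorem add_eq_zero {a b : NTilde p f} : a + b = 0 ↔ a = 0 ∧ b = 0 := by
  obtain ⟨m, rfl⟩ := mk_surjective a
  obtain ⟨n, rfl⟩ := mk_surjective b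
  rw [← mk_add, mk_eq_zero, mk_eq_zero, mk_eq_zero]
  omega

/-- The nonzero classes form the group `ℤ/(q - 1)`. Cancellation can fail only by confusing `0` with
the class of `q - 1`, which the hypotheses exclude. -/
theorem add_right_cancel_of_ne_zero {a b x : NTilde p f} (ha : a ≠ 0) (hb : b ≠ 0)
    (h : a + x = b + x) : a = b := by
  obtain ⟨m, rfl⟩ := mk_surjective a
  obtain ⟨n, rfl⟩ := mk_surjective b
  obtain ⟨k, rfl⟩ := mk_surjective x
  rw [Ne, mk_eq_zero] at ha hb
  rw [← mk_add, ← mk_add, mk_eq_mk] at h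
  exact mk_eq_mk.2 ⟨by omega, Nat.ModEq.add_right_cancel' k h.2⟩

theorem two_le [hp : Fact p.Prime] [NeZero f] : 2 ≤ p ^ f :=
  hp.out.two_le.trans (Nat.le_self_pow (NeZero.ne f) p)

/-- The class `∑ i, u_i p ^ i` attached to a function `u`, whose values may exceed `p - 1`. -/
def ofDigits [NeZero f] : (ZMod f → ℕ) →+ NTilde p f where
  toFun u := mk (∑ i, u i * p ^ i.val)
  map_zero' := by simp [mk_zero]
  map_add' u v := by simp [← mk_add, add_mul, Finset.sum_add_distrib]

variable [hp : Fact p.Prime] [NeZero f]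

theorem ofDigits_apply (u : ZMod f → ℕ) :
    (ofDigits u : NTilde p f) = mk (∑ i, u i * p ^ i.val) := rfl

theorem rep_ofDigits {u : ZMod f → ℕ} (hu : ∀ i, u i < p) :
    (ofDigits u : NTilde p f).rep = ∑ i, u i * p ^ i.val :=
  rep_mk (sum_lt_pow u hu)

theorem digit_ofDigits {u : ZMod f → ℕ} (hu : ∀ i, u i < p) :
    (ofDigits u : NTilde p f).digit = u := by
  ext i
  rw [digit, rep_ofDigits hu, digit_sum u hu]

theorem digit_lt (α : NTilde p f) (i : ZMod f) : α.digit i < p := Nat.mod_lt _ hp.out.pos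

theorem sum_digit (α : NTilde p f) : ∑ i, α.digit i * p ^ i.val = α.rep := by
  simp only [digit]
  rw [sum_zmod_val (f := f) fun j => α.rep / p ^ j % p * p ^ j, sum_range_digits,
    Nat.mod_eq_of_lt (rep_lt two_le α)]

theorem ofDigits_digit (α : NTilde p f) : ofDigits α.digit = α := by
  rw [ofDigits_apply, sum_digit, mk_rep]

theorem digit_injective {α β : NTilde p f} (h : α.digit = β.digit) : α = β := by
  rw [← ofDigits_digit α, h, ofDigits_digit]

theorem digit_zero : (0 : NTilde p f).digit = 0 := by
  ext i; simp [digit, rep_zero]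

theorem ofDigits_eq_zero {u : ZMod f → ℕ} : (ofDigits u : NTilde p f) = 0 ↔ u = 0 := by
  rw [ofDigits_apply, mk_eq_zero, Finset.sum_eq_zero_iff]
  simp only [Finset.mem_univ, true_imp_iff, mul_eq_zero, pow_eq_zero_iff', hp.out.ne_zero,
    false_and, or_false, funext_iff, Pi.zero_apply]

/-- The digit function with value `c` at `m` and `0` elsewhere. -/
abbrev single (m : ZMod f) (c : ℕ) : ZMod f → ℕ := Pi.single m c

theorem ofDigits_single (m : ZMod f) : ofDigits (single m 1) = (ppow m : NTilde p f) := by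
  rw [ofDigits_apply, ppow, Finset.sum_eq_single m] <;> simp +contextual

theorem ppow_ne_zero (m : ZMod f) : (ppow m : NTilde p f) ≠ 0 := by
  rw [ppow, Ne, mk_eq_zero]
  exact pow_ne_zero _ hp.out.ne_zero

theorem single_lt (m i : ZMod f) : single m 1 i < p := by
  have := hp.out.two_le
  rw [single, Pi.single_apply]; split_ifs <;> omega

theorem digit_ppow (m : ZMod f) : (ppow m : NTilde p f).digit = single m 1 := by
  rw [← ofDigits_single, digit_ofDigits (single_lt m)]

/-- In the last column this says `q ∼ 1`, which is why columns are indexed cyclically. -/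
theorem nsmul_ppow (m : ZMod f) : p • (ppow m : NTilde p f) = ppow (m + 1) := by
  rw [ppow, ppow, ← mk_nsmul, mk_eq_mk]
  have h0 := hp.out.ne_zero
  refine ⟨by simp [h0], ?_⟩
  rw [← pow_succ']
  rcases Nat.lt_or_ge (m.val + 1) f with h | h
  · have h1 : (1 : ZMod f).val = 1 := by
      rw [ZMod.val_one_eq_one_mod, Nat.mod_eq_of_lt (by omega)]
    rw [ZMod.val_add_of_lt (by rw [h1]; exact h), h1]
  · have hm := ZMod.val_lt m
    have hm' : m.val + 1 = f := by omega
    have : m + 1 = 0 := by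
      have h2 : ((m.val + 1 : ℕ) : ZMod f) = 0 := by rw [hm']; simp
      simpa using h2
    rw [this, hm', ZMod.val_zero, pow_zero]
    have h1 : 1 ≤ p ^ f := Nat.one_le_pow _ _ hp.out.pos
    exact ((Nat.modEq_iff_dvd' h1).2 dvd_rfl).symm

theorem prec_ppow {m : ZMod f} {α : NTilde p f} : Prec (ppow m) α ↔ 1 ≤ α.digit m := by
  rw [Prec, digit_ppow]
  refine ⟨fun h => by simpa using h m, fun h i => ?_⟩
  rw [single, Pi.single_apply]
  split_ifs with hi
  · rwa [hi]
  · omega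

theorem tsub_ppow {m : ZMod f} {v : ZMod f → ℕ} (hv : ∀ i, (v + single m 1) i < p) :
    tsub (ofDigits (v + single m 1) : NTilde p f) (ppow m) = ofDigits v := by
  rw [tsub, rep_ofDigits hv, ← ofDigits_single, rep_ofDigits (single_lt m), ofDigits_apply]
  simp [add_mul, Finset.sum_add_distrib]

theorem exists_eq_add_single {m : ZMod f} {u : ZMod f → ℕ} (h : 1 ≤ u m) :
    ∃ v, u = v + single m 1 := by
  refine ⟨u - single m 1, ?_⟩
  ext i
  rcases eq_or_ne i m with rfl | hi
  · simp; omega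
  · simp [hi]

/-- If `p^m ⪯ α`, then `α` and `α ∸ p^m` have the digits of `v + p^m` and of `v` for some `v`. -/
theorem exists_of_prec {m : ZMod f} {α : NTilde p f} (h : Prec (ppow m) α) :
    ∃ v : ZMod f → ℕ, (∀ i, (v + single m 1) i < p) ∧ α = ofDigits (v + single m 1) ∧
      tsub α (ppow m) = ofDigits v := by
  obtain ⟨v, hv⟩ := exists_eq_add_single (prec_ppow.1 h)
  have h1 : ∀ i, (v + single m 1) i < p := fun i => hv ▸ digit_lt α i
  have h2 : α = ofDigits (v + single m 1) := by rw [← hv, ofDigits_digit]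
  exact ⟨v, h1, h2, by rw [h2, tsub_ppow h1]⟩

theorem lt_of_add_lt {v w : ZMod f → ℕ} (h : ∀ i, (v + w) i < p) (i : ZMod f) : v i < p := by
  have := h i
  simp only [Pi.add_apply] at this
  omega

/-- The sum of the digits. -/
def digitSum (α : NTilde p f) : ℕ := ∑ i, α.digit i

theorem digitSum_ofDigits {u : ZMod f → ℕ} (hu : ∀ i, u i < p) :
    digitSum (ofDigits u : NTilde p f) = ∑ i, u i := by
  rw [digitSum, digit_ofDigits hu]

theorem ofDigits_carry (v : ZMod f → ℕ) (m : ZMod f) :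
    (ofDigits (v + single m p) : NTilde p f) = ofDigits (v + single (m + 1) 1) := by
  rw [map_add, map_add, ofDigits_single, ← nsmul_ppow, ← ofDigits_single, ← map_nsmul]
  congr 2
  ext i
  rcases eq_or_ne i m with rfl | hi <;> simp [*]

/-- Each carry trades `p` units of a column for one unit of the next, so the total of the digit
function drops by `p - 1 > 0`. Carrying therefore terminates, and it never increases the total. -/
theorem digitSum_ofDigits_le (u : ZMod f → ℕ) : digitSum (ofDigits u : NTilde p f) ≤ ∑ i, u i := by
  induction h : ∑ i, u i using Nat.strong_induction_on generalizing u with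
  | _ n ih =>
    by_cases hu : ∀ i, u i < p
    · rw [digitSum_ofDigits hu, h]
    · push Not at hu
      obtain ⟨m, hm⟩ := hu
      obtain ⟨v, rfl⟩ : ∃ v : ZMod f → ℕ, u = v + single m p := by
        refine ⟨u - single m p, ?_⟩
        ext i
        rcases eq_or_ne i m with rfl | hi
        · simp; omega
        · simp [hi]
      have h2 := hp.out.two_le
      have e1 : ∑ i, (v + single m p) i = ∑ i, v i + p := by
        simp [Finset.sum_add_distrib]
      have e2 : ∑ i, (v + single (m + 1) 1 : ZMod f → ℕ) i = ∑ i, v i + 1 := by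
        simp [Finset.sum_add_distrib]
      have := ih _ (by rw [← h, e1, e2]; omega) (v + single (m + 1) 1) rfl
      rw [ofDigits_carry]
      omega

/-- An overfull column forces at least one carry, which loses `p - 1`. This strictness is what makes
terms with carries vanish in the heads. -/
theorem digitSum_ofDigits_lt {u : ZMod f → ℕ} {m : ZMod f} (hm : p ≤ u m) :
    digitSum (ofDigits u : NTilde p f) < ∑ i, u i := by
  obtain ⟨v, rfl⟩ : ∃ v : ZMod f → ℕ, u = v + single m p := by
    refine ⟨u - single m p, ?_⟩
    ext i
    rcases eq_or_ne i m with rfl | hi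
    · simp; omega
    · simp [hi]
  have h2 := hp.out.two_le
  have e1 : ∑ i, (v + single m p) i = ∑ i, v i + p := by
    simp [Finset.sum_add_distrib]
  have e2 : ∑ i, (v + single (m + 1) 1 : ZMod f → ℕ) i = ∑ i, v i + 1 := by
    simp [Finset.sum_add_distrib]
  have := digitSum_ofDigits_le (p := p) (v + single (m + 1) 1)
  rw [ofDigits_carry]
  omega

theorem digitSum_add_le (α β : NTilde p f) : digitSum (α + β) ≤ digitSum α + digitSum β := by
  conv_lhs => rw [← ofDigits_digit α, ← ofDigits_digit β, ← map_add]
  refine (digitSum_ofDigits_le _).trans_eq ?_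
  simp [digitSum, Finset.sum_add_distrib]

theorem digitSum_ppow (m : ZMod f) : digitSum (ppow m : NTilde p f) = 1 := by
  simp [digitSum, digit_ppow]

/-- Addition without carries adds digits; otherwise it decreases the sum of the digits. -/
theorem digit_add_or_lt (α β : NTilde p f) :
    (α + β).digit = α.digit + β.digit ∨ digitSum (α + β) < digitSum α + digitSum β := by
  by_cases h : ∀ i, (α.digit + β.digit) i < p
  · left
    conv_lhs => rw [← ofDigits_digit α, ← ofDigits_digit β, ← map_add]
    rw [digit_ofDigits h]
  · right
    push Not at h
    obtain ⟨m, hm⟩ := h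
    conv_lhs => rw [← ofDigits_digit α, ← ofDigits_digit β, ← map_add]
    refine (digitSum_ofDigits_lt hm).trans_eq ?_
    simp [digitSum, Finset.sum_add_distrib]

theorem sub_ne_zero {a : NTilde p f} (ha : a ≠ 0) (b : NTilde p f) : sub a b ≠ 0 :=
  (sub_spec two_le ha b).1

theorem add_sub {a : NTilde p f} (ha : a ≠ 0) (b : NTilde p f) : b + sub a b = a :=
  (sub_spec two_le ha b).2

theorem eq_sub {a b c : NTilde p f} (hc : c ≠ 0) (h : b + c = a) : c = sub a b :=
  sub_unique two_le (by rintro rfl; exact hc (add_eq_zero.1 h).2) b c hc h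

end NTilde

end PrincipalSeries

end

noncomputable section

namespace PrincipalSeries

open NTilde

variable {p f : ℕ} {r : NTilde p f}

/-! ### Elements of `Θ` as exponent triples. -/

namespace Theta

/-- The exponent `a` of the monomial `c^a d^b D^γ` attached to an element of `Θ`. -/
def expA : Theta p f r → NTilde p f
  | .fin j₀ j₁ => sub (sub r (2 • j₁)) j₀
  | .infty _ => 0

/-- The exponent `b` of the monomial `c^a d^b D^γ` attached to an element of `Θ`. -/
def expB : Theta p f r → NTilde p f
  | .fin j₀ _ => j₀
  | .infty j₁ => sub r (2 • j₁)

/-- The exponent `γ` of the monomial `c^a d^b D^γ` attached to an element of `Θ`. -/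
def expD : Theta p f r → NTilde p f
  | .fin _ j₁ => j₁
  | .infty j₁ => j₁

open Classical in
/-- The element of `Θ` with exponents `a`, `b`, `γ`, where `a + b = r - 2γ`. -/
def ofExp (r a b γ : NTilde p f) : Theta p f r := if a = 0 then .infty γ else .fin b γ

theorem ofExp_zero (b γ : NTilde p f) : ofExp r 0 b γ = .infty γ := if_pos rfl

theorem ofExp_of_ne {a : NTilde p f} (ha : a ≠ 0) (b γ : NTilde p f) :
    ofExp r a b γ = .fin b γ := if_neg ha

variable [hp : Fact p.Prime] [NeZero f]

theorem expA_add_expB (hr : r ≠ 0) (x : Theta p f r) :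
    x.expA + x.expB = sub r (2 • x.expD) := by
  cases x with
  | fin j₀ j₁ =>
    rw [add_comm]
    exact add_sub (sub_ne_zero hr _) _
  | infty j₁ => exact zero_add _

variable {a b γ : NTilde p f}

theorem eq_sub_of_add (h : a + b = sub r (2 • γ)) (ha : a ≠ 0) :
    a = sub (sub r (2 • γ)) b :=
  eq_sub ha (by rw [← h, add_comm])

theorem expA_ofExp (h : a + b = sub r (2 • γ)) : (ofExp r a b γ).expA = a := by
  by_cases ha : a = 0
  · subst ha; rw [ofExp_zero]; rfl
  · rw [ofExp_of_ne ha]; exact (eq_sub_of_add h ha).symm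

theorem expB_ofExp (h : a + b = sub r (2 • γ)) : (ofExp r a b γ).expB = b := by
  by_cases ha : a = 0
  · subst ha; rw [ofExp_zero]; rw [zero_add] at h; exact h.symm
  · rw [ofExp_of_ne ha]; rfl

theorem expD_ofExp : (ofExp r a b γ).expD = γ := by
  by_cases ha : a = 0
  · subst ha; rw [ofExp_zero]; rfl
  · rw [ofExp_of_ne ha]; rfl

theorem ofExp_exp (hr : r ≠ 0) (x : Theta p f r) : ofExp r x.expA x.expB x.expD = x := by
  cases x with
  | fin j₀ j₁ => exact if_neg (sub_ne_zero (sub_ne_zero hr _) _)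
  | infty j₁ => exact if_pos rfl

/-! ### Upper bounds on the relation -/

/-- The sum `3 |γ| + |a| + |b|` of digit sums, which does not increase along `≤_r`. -/
def rank (x : Theta p f r) : ℕ := 3 * digitSum x.expD + digitSum x.expA + digitSum x.expB

theorem digitSum_tsub {m : ZMod f} {α : NTilde p f} (h : Prec (ppow m) α) :
    digitSum (tsub α (ppow m)) + 1 = digitSum α := by
  obtain ⟨v, h1, h2, h3⟩ := exists_of_prec h
  rw [h3, h2, digitSum_ofDigits h1, digitSum_ofDigits (lt_of_add_lt h1)]
  simp [Finset.sum_add_distrib]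

theorem tsub_add_ppow {m : ZMod f} {α : NTilde p f} (h : Prec (ppow m) α) :
    tsub α (ppow m) + ppow m = α := by
  obtain ⟨v, h1, h2, h3⟩ := exists_of_prec h
  rw [h3, h2, map_add, ofDigits_single]

theorem digit_tsub {m : ZMod f} {α : NTilde p f} (h : Prec (ppow m) α) :
    (tsub α (ppow m)).digit + single m 1 = α.digit := by
  obtain ⟨v, h1, h2, h3⟩ := exists_of_prec h
  rw [h3, h2, digit_ofDigits h1, digit_ofDigits (lt_of_add_lt h1)]

/-- The relation `≤_r` in terms of exponents: the rank decreases, or it stays the same, as do `γ`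
and the column sums `a_i + b_i`. -/
def Descends (y x : Theta p f r) : Prop :=
  y.rank < x.rank ∨ (y.rank = x.rank ∧ y.expD = x.expD ∧
    y.expA.digit + y.expB.digit = x.expA.digit + x.expB.digit)

theorem descends_swap {x y : Theta p f r} (h : y.expA = x.expB) (h' : y.expB = x.expA)
    (hD : y.expD = x.expD) : Descends y x := by
  refine .inr ⟨?_, hD, ?_⟩
  · rw [rank, rank, h, h', hD]; ring
  · rw [h, h', add_comm]

/-- A unit moves from column `m` of `b` to column `m` of `a`. Without a carry in `a` the column sums
are unchanged; with a carry the digit sum of `a` fails to make up for the unit lost in `b`. -/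
theorem descends_move {x y : Theta p f r} {m : ZMod f} (hb : Prec (ppow m) x.expB)
    (h : y.expA = x.expA + ppow m) (h' : y.expB = tsub x.expB (ppow m))
    (hD : y.expD = x.expD) : Descends y x := by
  have h1 := digitSum_tsub hb
  have h3 := digitSum_ppow (p := p) m
  rcases digit_add_or_lt x.expA (ppow m) with h2 | h2
  · refine .inr ⟨?_, hD, ?_⟩
    · have : digitSum (x.expA + ppow m) = digitSum x.expA + 1 := by
        rw [← h3]; simp only [digitSum, h2, Pi.add_apply, Finset.sum_add_distrib]
      rw [rank, rank, h, h', hD]; omega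
    · rw [h, h', h2, digit_ppow, ← digit_tsub hb]; abel
  · left
    rw [rank, rank, h, h', hD]; omega

/-- This is the reason for the weight `3` in the rank: removing `p^m` from `γ` adds `2p^m` to `a +
b`, so at most `2` to the digit sums, while the `γ` part loses `3`. -/
theorem descends_of_prec {x y : Theta p f r} {m : ZMod f} (hD : Prec (ppow m) x.expD)
    (hD' : y.expD = tsub x.expD (ppow m))
    (h : digitSum y.expA + digitSum y.expB ≤ digitSum x.expA + digitSum x.expB + 2) :
    Descends y x := by
  left
  have := digitSum_tsub hD
  rw [rank, rank, hD']; omega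

theorem add_tsub_eq (hr : r ≠ 0) {m : ZMod f} (h : Prec (ppow m) γ) :
    sub r (2 • tsub γ (ppow m)) = sub r (2 • γ) + 2 • ppow m := by
  refine (eq_sub ?_ ?_).symm
  · rw [Ne, add_eq_zero, not_and_or]; exact .inl (sub_ne_zero hr _)
  · conv_rhs => rw [← add_sub hr (2 • γ)]
    conv_rhs => enter [1]; rw [← tsub_add_ppow h]
    rw [smul_add]; abel

/-- On exponents, relations 1 and 6 move a unit from `b` to `a`, relations 4 and 7 exchange `a` and
`b`, and relations 2, 3 and 5 remove a unit from `γ`. -/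
theorem descends_of_genRel (hr : r ≠ 0) {x y : Theta p f r} (h : GenRel y x) :
    Descends y x := by
  have hp2 : ∀ m, digitSum (2 • ppow m : NTilde p f) ≤ 2 := fun m => by
    rw [two_smul]
    have := digitSum_add_le (ppow m : NTilde p f) (ppow m)
    rwa [digitSum_ppow] at this
  have hs := fun γ : NTilde p f => sub_ne_zero hr (2 • γ)
  cases h with
  | rel1 j₀ j₁ m h =>
    refine descends_move (m := m) h ?_ rfl rfl
    refine (eq_sub ?_ ?_).symm
    · rw [Ne, add_eq_zero, not_and_or]; exact .inr (ppow_ne_zero m)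
    · conv_rhs => rw [← add_sub (hs j₁) j₀]
      conv_rhs => enter [1]; rw [← tsub_add_ppow h]
      simp only [expA]; abel
  | rel2 j₀ j₁ m h =>
    refine descends_of_prec (m := m) h rfl ?_
    have : (fin j₀ (tsub j₁ (ppow m)) : Theta p f r).expA =
        (fin j₀ j₁ : Theta p f r).expA + 2 • ppow m := by
      refine (eq_sub ?_ ?_).symm
      · rw [Ne, add_eq_zero, not_and_or]; exact .inl (sub_ne_zero (hs _) _)
      · rw [add_tsub_eq hr h, ← add_assoc]
        conv_rhs => rw [← add_sub (hs j₁) j₀]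
        simp only [expA]
    rw [this]
    have := digitSum_add_le (fin j₀ j₁ : Theta p f r).expA (2 • ppow m)
    have := hp2 m
    simp only [expB]; omega
  | rel3 j₀ j₁ m h =>
    refine descends_of_prec (m := m) h rfl ?_
    have : (fin (j₀ + ppow m) (tsub j₁ (ppow m)) : Theta p f r).expA =
        (fin j₀ j₁ : Theta p f r).expA + ppow m := by
      refine (eq_sub ?_ ?_).symm
      · rw [Ne, add_eq_zero, not_and_or]; exact .inl (sub_ne_zero (hs _) _)
      · rw [add_tsub_eq hr h]
        conv_rhs => rw [← add_sub (hs j₁) j₀]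
        simp only [expA]; rw [two_smul]; abel
    rw [this]
    have := digitSum_add_le (fin j₀ j₁ : Theta p f r).expA (ppow m)
    have := digitSum_add_le j₀ (ppow m)
    have := digitSum_ppow (p := p) m
    simp only [expB]; omega
  | rel4 j₀ j₁ h =>
    refine descends_swap ?_ rfl rfl
    refine (eq_sub h ?_).symm
    rw [add_comm]; exact add_sub (hs _) _
  | rel5 j₁ m h =>
    refine descends_of_prec (m := m) h rfl ?_
    have : (fin (sub r (2 • j₁)) (tsub j₁ (ppow m)) : Theta p f r).expA = 2 • ppow m := by
      refine (eq_sub ?_ ?_).symm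
      · rw [two_smul, Ne, add_eq_zero, not_and_or]; exact .inl (ppow_ne_zero m)
      · rw [add_tsub_eq hr h]
    rw [this]
    have := hp2 m
    simp only [expB]; omega
  | rel6 j₁ m h =>
    refine descends_move (m := m) h ?_ rfl rfl
    refine (eq_sub ?_ ?_).symm
    · rw [Ne, add_eq_zero, not_and_or]; exact .inr (ppow_ne_zero m)
    · simp only [expA, zero_add, tsub_add_ppow h]
  | rel7 j₁ =>
    exact descends_swap (eq_sub (hs _) (zero_add _)).symm rfl rfl
  | rel7' j₁ =>
    exact descends_swap rfl (eq_sub (hs _) (zero_add _)) rfl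

theorem descends_of_le (hr : r ≠ 0) {x y : Theta p f r} : y ≤ x → Descends y x := by
  change Relation.ReflTransGen GenRel y x → _
  intro h
  induction h with
  | refl => exact .inr ⟨rfl, rfl, rfl⟩
  | tail _ h ih =>
    rcases ih, descends_of_genRel hr h with ⟨h1 | h1, h2 | h2⟩
    · exact .inl (h1.trans h2)
    · exact .inl (h1.trans_eq h2.1)
    · exact .inl (h1.1.trans_lt h2)
    · exact .inr ⟨h1.1.trans h2.1, h1.2.1.trans h2.2.1, h1.2.2.trans h2.2.2⟩

/-! ### Constructing relations -/

theorem le_of_genRel {x y : Theta p f r} (h : GenRel y x) : y ≤ x := Relation.ReflTransGen.single h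

/-- Relation 4 covers the case of nonzero exponents and the two parts of relation 7 cover a
vanishing one. Both exponents cannot vanish, as `r - 2γ` is nonzero by convention. -/
theorem ofExp_swap_le (hr : r ≠ 0) (h : a + b = sub r (2 • γ)) :
    ofExp r b a γ ≤ ofExp r a b γ := by
  have hs := sub_ne_zero hr (2 • γ)
  by_cases ha : a = 0
  · subst ha
    have hb : b ≠ 0 := by rintro rfl; exact hs (by rw [← h, add_zero])
    rw [ofExp_zero, ofExp_of_ne hb]
    exact le_of_genRel (.rel7 γ)
  · by_cases hb : b = 0
    · subst hb
      rw [ofExp_zero, ofExp_of_ne ha]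
      exact le_of_genRel (.rel7' γ)
    · rw [ofExp_of_ne ha, ofExp_of_ne hb]
      conv_lhs => rw [eq_sub_of_add h ha]
      exact le_of_genRel (.rel4 b γ hb)

theorem prec_of_single {m : ZMod f} {v : ZMod f → ℕ} (hv : ∀ i, (v + single m 1) i < p) :
    Prec (ppow m) (ofDigits (v + single m 1) : NTilde p f) := by
  rw [prec_ppow, digit_ofDigits hv]; simp

theorem add_ppow_ne_zero (a : NTilde p f) (m : ZMod f) : a + ppow m ≠ 0 := by
  rw [Ne, add_eq_zero, not_and_or]; exact .inr (ppow_ne_zero m)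

/-- In terms of exponents, relation 6 is relation 1 at `a = 0`. -/
theorem ofExp_move_le {v : ZMod f → ℕ} {m : ZMod f} (hv : ∀ i, (v + single m 1) i < p)
    (h : a + ofDigits (v + single m 1) = sub r (2 • γ)) :
    ofExp r (a + ppow m) (ofDigits v) γ ≤ ofExp r a (ofDigits (v + single m 1)) γ := by
  have hP := prec_of_single hv
  rw [ofExp_of_ne (add_ppow_ne_zero a m), ← tsub_ppow hv]
  by_cases ha : a = 0
  · subst ha
    rw [zero_add] at h
    rw [ofExp_zero]
    rw [h] at hP ⊢
    exact le_of_genRel (.rel6 γ m hP)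
  · rw [ofExp_of_ne ha]
    exact le_of_genRel (.rel1 _ γ m hP)

/-- In terms of exponents, relation 5 is relation 2 at `a = 0`. -/
theorem ofExp_sq_le {v : ZMod f → ℕ} {m : ZMod f} (hv : ∀ i, (v + single m 1) i < p)
    (h : a + b = sub r (2 • ofDigits (v + single m 1))) :
    ofExp r (a + 2 • ppow m) b (ofDigits v) ≤ ofExp r a b (ofDigits (v + single m 1)) := by
  have hP := prec_of_single hv
  have h2 : a + 2 • ppow m ≠ 0 := by
    rw [two_smul, ← add_assoc]; exact add_ppow_ne_zero _ _
  rw [ofExp_of_ne h2, ← tsub_ppow hv]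
  by_cases ha : a = 0
  · subst ha
    rw [zero_add] at h
    rw [ofExp_zero, h]
    exact le_of_genRel (.rel5 _ m hP)
  · rw [ofExp_of_ne ha]
    exact le_of_genRel (.rel2 _ _ m hP)

theorem sub_two_nsmul (hr : r ≠ 0) {v : ZMod f → ℕ} {m : ZMod f}
    (hv : ∀ i, (v + single m 1) i < p) :
    sub r (2 • ofDigits v) = sub r (2 • ofDigits (v + single m 1)) + 2 • ppow m := by
  rw [← add_tsub_eq hr (prec_of_single hv), tsub_ppow hv]

theorem ofExp_cross_le (hr : r ≠ 0) {v : ZMod f → ℕ} {m : ZMod f}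
    (hv : ∀ i, (v + single m 1) i < p) (h : a + b = sub r (2 • ofDigits (v + single m 1))) :
    ofExp r (a + ppow m) (b + ppow m) (ofDigits v) ≤
      ofExp r a b (ofDigits (v + single m 1)) := by
  have hP := prec_of_single hv
  have key : ∀ a b : NTilde p f, a ≠ 0 → ofExp r (a + ppow m) (b + ppow m) (ofDigits v) ≤
      ofExp r a b (ofDigits (v + single m 1)) := by
    intro a b ha
    rw [ofExp_of_ne (add_ppow_ne_zero a m), ofExp_of_ne ha, ← tsub_ppow hv]
    exact le_of_genRel (.rel3 _ _ m hP)
  -- Relation 3 has no counterpart at `∞`. When `a = 0`, exchange the exponents, apply the relation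
  -- with `b ≠ 0` in first place, and exchange back.
  by_cases ha : a = 0
  · have hb : b ≠ 0 := by
      rintro rfl
      exact sub_ne_zero hr _ (by rw [← h, ha, add_zero])
    refine (ofExp_swap_le hr ?_).trans ((key b a hb).trans (ofExp_swap_le hr h))
    rw [sub_two_nsmul hr hv, ← h, two_smul]; abel
  · exact key a b ha

theorem induction_single {P : (ZMod f → ℕ) → Prop} (h0 : P 0)
    (h1 : ∀ l m, P l → P (l + single m 1)) (l : ZMod f → ℕ) : P l := by
  induction h : ∑ i, l i generalizing l with
  | zero =>
    have : l = 0 := by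
      ext i
      exact (Finset.sum_eq_zero_iff.1 h) i (Finset.mem_univ i)
    rwa [this]
  | succ n ih =>
    obtain ⟨m, -, hm⟩ := Finset.exists_ne_zero_of_sum_ne_zero (h.trans_ne n.succ_ne_zero)
    obtain ⟨v, rfl⟩ := exists_eq_add_single (Nat.one_le_iff_ne_zero.2 hm)
    refine h1 _ _ (ih v ?_)
    simp [Finset.sum_add_distrib] at h
    exact h

/-- This handles the term of index `l` in the expansion of `(d + tc)^b`, one unit at a time. -/
theorem ofExp_add_le (l : ZMod f → ℕ) {v : ZMod f → ℕ} (hv : ∀ i, (v + l) i < p)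
    (h : a + ofDigits (v + l) = sub r (2 • γ)) :
    ofExp r (a + ofDigits l) (ofDigits v) γ ≤ ofExp r a (ofDigits (v + l)) γ := by
  induction l using induction_single generalizing a with
  | h0 => simp
  | h1 l m ih =>
    have h2 : a + ppow m + ofDigits (v + l) = sub r (2 • γ) := by
      rw [← h, ← add_assoc, map_add _ (v + l), ofDigits_single]; abel
    have := ih (lt_of_add_lt (by rwa [← add_assoc] at hv)) h2
    rw [← add_assoc] at h hv ⊢
    refine le_trans ?_ (this.trans (ofExp_move_le hv h))
    rw [map_add, ofDigits_single, add_right_comm, ← add_assoc]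

/-- The same for the expansion of `(W + tc²)^γ`. -/
theorem ofExp_sq_add_le (hr : r ≠ 0) (l : ZMod f → ℕ) {v : ZMod f → ℕ} (hv : ∀ i, (v + l) i < p)
    (h : a + b = sub r (2 • ofDigits (v + l))) :
    ofExp r (a + 2 • ofDigits l) b (ofDigits v) ≤ ofExp r a b (ofDigits (v + l)) := by
  induction l using induction_single generalizing a with
  | h0 => simp
  | h1 l m ih =>
    rw [← add_assoc] at h hv ⊢
    have h2 : a + 2 • ppow m + b = sub r (2 • ofDigits (v + l)) := by
      rw [sub_two_nsmul hr hv, ← h]; abel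
    refine le_trans ?_ ((ih (lt_of_add_lt hv) h2).trans (ofExp_sq_le hv h))
    rw [map_add, ofDigits_single, smul_add, add_right_comm, ← add_assoc]

/-- The same for the expansion of a power of `sW + tcd`. -/
theorem ofExp_cross_add_le (hr : r ≠ 0) (l : ZMod f → ℕ) {v : ZMod f → ℕ}
    (hv : ∀ i, (v + l) i < p) (h : a + b = sub r (2 • ofDigits (v + l))) :
    ofExp r (a + ofDigits l) (b + ofDigits l) (ofDigits v) ≤
      ofExp r a b (ofDigits (v + l)) := by
  induction l using induction_single generalizing a b with
  | h0 => simp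
  | h1 l m ih =>
    rw [← add_assoc] at h hv ⊢
    have h2 : a + ppow m + (b + ppow m) = sub r (2 • ofDigits (v + l)) := by
      rw [sub_two_nsmul hr hv, ← h, two_smul]; abel
    refine le_trans ?_ ((ih (lt_of_add_lt hv) h2).trans (ofExp_cross_le hr hv h))
    rw [map_add, ofDigits_single, add_right_comm, ← add_assoc, add_right_comm b, ← add_assoc]

/-- Two elements with the same `γ` and the same column sums `a_i + b_i` are comparable. -/
theorem ofExp_le_ofExp (hr : r ≠ 0) {u v u' v' : ZMod f → ℕ} (hu : ∀ i, u i < p)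
    (hu' : ∀ i, u' i < p) (hv' : ∀ i, v' i < p) (h : u + v = u' + v')
    (hs : ofDigits u + ofDigits v = sub r (2 • γ)) :
    ofExp r (ofDigits u) (ofDigits v) γ ≤ ofExp r (ofDigits u') (ofDigits v') γ := by
  have hs' : ofDigits u' + ofDigits v' = sub r (2 • γ) := by rw [← hs, ← map_add, ← h, map_add]
  have hh : ∀ i, u i + v i = u' i + v' i := fun i => congrFun h i
  -- pass through the element whose first exponent is the digitwise maximum
  set w : ZMod f → ℕ := fun i => max (u i) (u' i) with hw
  set z : ZMod f → ℕ := fun i => min (v i) (v' i) with hz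
  have hwz : w + z = u + v := by
    ext i
    have := hh i
    simp only [hw, hz, Pi.add_apply]; omega
  have e1 : v = z + (w - u) := by
    ext i
    have := hh i
    simp only [hw, hz, Pi.add_apply, Pi.sub_apply]; omega
  have e1' : w = u + (w - u) := by
    ext i
    simp only [hw, Pi.add_apply, Pi.sub_apply]; omega
  have e2 : v' = z + (w - u') := by
    ext i
    have := hh i
    simp only [hw, hz, Pi.add_apply, Pi.sub_apply]; omega
  have e2' : w = u' + (w - u') := by
    ext i
    simp only [hw, Pi.add_apply, Pi.sub_apply]; omega
  have hwlt : ∀ i, w i < p := fun i => max_lt (hu i) (hu' i)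
  have h1 : ofExp r (ofDigits w) (ofDigits z) γ ≤ ofExp r (ofDigits u') (ofDigits v') γ := by
    have := ofExp_add_le (a := ofDigits u') (γ := γ) (w - u') (v := z) (by rwa [← e2])
      (by rwa [← e2])
    rwa [← map_add, ← e2', ← e2] at this
  refine le_trans ?_ h1
  have hwz' : ofDigits w + ofDigits z = sub r (2 • γ) := by rw [← hs, ← map_add, hwz, map_add]
  -- Relations only move units from the second exponent to the first, so the way from the maximum
  -- back to `u` is made with the two exponents exchanged.
  have h2 : ofExp r (ofDigits v) (ofDigits u) γ ≤ ofExp r (ofDigits z) (ofDigits w) γ := by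
    have := ofExp_add_le (a := ofDigits z) (γ := γ) (w - u) (v := u) (by rwa [← e1'])
      (by rwa [← e1', add_comm])
    rwa [← map_add, ← e1, ← e1'] at this
  exact (ofExp_swap_le hr (by rwa [add_comm])).trans (h2.trans (ofExp_swap_le hr hwz'))

theorem le_of_digit_eq (hr : r ≠ 0) {x y : Theta p f r} (hD : y.expD = x.expD)
    (h : y.expA.digit + y.expB.digit = x.expA.digit + x.expB.digit) : y ≤ x := by
  have := ofExp_le_ofExp (γ := x.expD) hr (digit_lt y.expA) (digit_lt x.expA)
    (digit_lt x.expB) h (by rw [ofDigits_digit, ofDigits_digit, expA_add_expB hr, hD])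
  rw [ofDigits_digit, ofDigits_digit, ofDigits_digit, ofDigits_digit, ofExp_exp hr] at this
  rwa [← hD, ofExp_exp hr] at this

theorem typeOf_le {x y : Theta p f r} : typeOf y ≤ typeOf x ↔ y ≤ x := Iff.rfl

/-- If each element lies below the other, the rank cannot drop strictly, and `Descends` then
preserves `γ` and the column sums. The converse is `le_of_digit_eq`, used in both directions. -/
theorem typeOf_eq_iff (hr : r ≠ 0) {x y : Theta p f r} : typeOf y = typeOf x ↔
    y.expD = x.expD ∧ y.expA.digit + y.expB.digit = x.expA.digit + x.expB.digit := by
  constructor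
  · intro h
    have h1 : y ≤ x := typeOf_le.1 h.le
    have h2 : x ≤ y := typeOf_le.1 h.ge
    have h3 := descends_of_le hr h1
    have h4 := descends_of_le hr h2
    rcases h3 with h3 | h3
    · rcases h4 with h4 | h4
      · omega
      · have := h4.1; omega
    · exact h3.2
  · intro h
    exact le_antisymm (typeOf_le.2 (le_of_digit_eq hr h.1 h.2))
      (typeOf_le.2 (le_of_digit_eq hr h.1.symm h.2.symm))

theorem typeOf_lt_of_le (hr : r ≠ 0) {x y : Theta p f r} (h : y ≤ x) (h' : y.rank < x.rank) :
    typeOf y < typeOf x := by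
  refine lt_of_le_of_ne (typeOf_le.2 h) fun he => ?_
  rcases descends_of_le hr (typeOf_le.1 he.ge) with h1 | h1 <;> omega

end Theta

/-! ### Column sums and carries -/

section Carry

variable [hp : Fact p.Prime] [NeZero f]

/-- Multiplication by `p` rotates the columns, so the incoming carries `c (i - 1)` and the outgoing
ones `p * c i` represent the same class. -/
theorem ofDigits_nsmul_shift (c : ZMod f → ℕ) :
    (ofDigits (p • c) : NTilde p f) = ofDigits fun i => c (i - 1) := by
  induction c using Theta.induction_single with
  | h0 => simp only [smul_zero, Pi.zero_apply]; rfl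
  | h1 l m ih =>
    have : (fun i => (l + single m 1) (i - 1)) = (fun i => l (i - 1)) + single (m + 1) 1 := by
      ext i
      simp only [Pi.add_apply, single, Pi.single_apply, sub_eq_iff_eq_add]
    rw [this, smul_add, map_add, map_add, ih, map_nsmul _ _ (single m 1), ofDigits_single,
      ofDigits_single, nsmul_ppow]

open Classical in
/-- The column sums `a_i + b_i` in terms of the digits of `a + b` and of the carries. -/
theorem digit_add_digit {a b : NTilde p f} (h0 : a + b ≠ 0) (i : ZMod f) :
    a.digit i + b.digit i + (if i - 1 ∈ carrySet a b then 1 else 0) =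
      (a + b).digit i + (if i ∈ carrySet a b then p else 0) := by
  have hI := isCarrySet_carrySet a b
  set I := carrySet a b
  set c : ZMod f → ℕ := fun i => if i ∈ I then 1 else 0 with hc
  -- The column totals after all carrying. They are genuine digits, and `t` and `a + b` agree after
  -- adding the class of `p • c`; cancelling that class requires both to be nonzero.
  set t : ZMod f → ℕ := fun i => a.digit i + b.digit i + c (i - 1) - p * c i with ht
  have key : ∀ i, a.digit i + b.digit i + c (i - 1) = t i + p * c i ∧ t i < p := by
    intro i
    have h1 := hI.out_out i
    have h2 := hI.in_out i
    have h3 := hI.out_in i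
    have h4 := hI.in_in i
    have h5 := digit_lt a i
    have h6 := digit_lt b i
    simp only [ht, hc]
    by_cases hi : i ∈ I <;> by_cases hi' : i - 1 ∈ I <;>
      simp only [hi, hi', not_true_eq_false, not_false_eq_true, forall_const, IsEmpty.forall_iff,
        if_true, if_false] at h1 h2 h3 h4 ⊢ <;> omega
  have e : ofDigits t + ofDigits (p • c) = a + b + ofDigits (p • c) := by
    have h2 : a + b + ofDigits (fun i => c (i - 1)) = ofDigits t + ofDigits (p • c) := by
      conv_lhs => rw [← ofDigits_digit a, ← ofDigits_digit b, ← map_add, ← map_add]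
      rw [← map_add]
      congr 1
      ext i
      simpa using (key i).1
    rw [← h2, ofDigits_nsmul_shift]
  -- If `t = 0` and every column carries, all column sums are `p - 1`, and the convention for that
  -- case makes the carry set empty. If some column does not carry, it has zero digits and no
  -- incoming carry; going round the cycle, all digits vanish and `a + b = 0`.
  have ht0 : t ≠ 0 := by
    intro h
    have hz : ∀ i, t i = 0 := fun i => congrFun h i
    by_cases hall : ∀ i, i ∈ I
    · have : I = ∅ := by
        refine hI.empty fun i => ?_
        have := (key i).1
        rw [hz i] at this
        simp only [hc, hall, if_true] at this
        omega
      simp [this] at hall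
    · have hout : ∀ i, i ∉ I → i - 1 ∉ I ∧ a.digit i = 0 ∧ b.digit i = 0 := by
        intro i hi
        have := (key i).1
        rw [hz i] at this
        simp only [hc, hi, if_false, mul_zero] at this
        refine ⟨fun h' => ?_, by omega, by omega⟩
        simp [h'] at this
      obtain ⟨j, hj⟩ := not_forall.1 hall
      have hn : ∀ n : ℕ, j - n ∉ I := by
        intro n
        induction n with
        | zero => simpa using hj
        | succ n ih =>
          have := (hout _ ih).1
          rwa [sub_sub, ← Nat.cast_succ] at this
      have hall' : ∀ i, i ∉ I := fun i => by simpa using hn (j - i).val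
      refine h0 ?_
      rw [add_eq_zero]
      constructor
      · refine digit_injective ?_
        rw [digit_zero]; ext i; exact (hout i (hall' i)).2.1
      · refine digit_injective ?_
        rw [digit_zero]; ext i; exact (hout i (hall' i)).2.2
  have e2 := add_right_cancel_of_ne_zero (by rwa [Ne, ofDigits_eq_zero]) h0 e
  rw [← e2, digit_ofDigits fun i => (key i).2]
  have := (key i).1
  simp only [hc] at this ⊢
  rw [this]
  split_ifs <;> simp

end Carry

end PrincipalSeries

end

noncomputable section

namespace PrincipalSeries

open NTilde

/-! ### Generators of `GL₂` of a local ring -/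

section Generators

variable {A : Type*} [CommRing A]

/-- The upper unipotent matrix `(1 x; 0 1)`. -/
def unipMat (x : A) : Matrix.GeneralLinearGroup (Fin 2) A where
  val := !![1, x; 0, 1]
  inv := !![1, -x; 0, 1]
  val_inv := by ext i j; fin_cases i <;> fin_cases j <;> simp
  inv_val := by ext i j; fin_cases i <;> fin_cases j <;> simp

/-- The diagonal matrix with entries `a`, `d`. -/
def diagMat (a d : Aˣ) : Matrix.GeneralLinearGroup (Fin 2) A where
  val := !![(a : A), 0; 0, (d : A)]
  inv := !![((a⁻¹ : Aˣ) : A), 0; 0, ((d⁻¹ : Aˣ) : A)]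
  val_inv := by ext i j; fin_cases i <;> fin_cases j <;> simp
  inv_val := by ext i j; fin_cases i <;> fin_cases j <;> simp

/-- The matrix `(0 1; 1 0)`. -/
def swapMat : Matrix.GeneralLinearGroup (Fin 2) A where
  val := !![0, 1; 1, 0]
  inv := !![0, 1; 1, 0]
  val_inv := by ext i j; fin_cases i <;> fin_cases j <;> simp
  inv_val := by ext i j; fin_cases i <;> fin_cases j <;> simp

theorem coe_unipMat (x : A) :
    (unipMat x : Matrix (Fin 2) (Fin 2) A) = !![1, x; 0, 1] := rfl

theorem coe_diagMat (a d : Aˣ) :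
    (diagMat a d : Matrix (Fin 2) (Fin 2) A) = !![(a : A), 0; 0, (d : A)] := rfl

theorem coe_swapMat :
    ((swapMat : Matrix.GeneralLinearGroup (Fin 2) A) : Matrix (Fin 2) (Fin 2) A) =
      !![0, 1; 1, 0] := rfl

theorem unipMat_add (x y : A) : unipMat (x + y) = unipMat x * unipMat y := by
  refine Units.ext ?_
  rw [Units.val_mul, coe_unipMat, coe_unipMat, coe_unipMat]
  ext i j; fin_cases i <;> fin_cases j <;> simp [add_comm]

theorem isUnit_det_fin_two (g : Matrix.GeneralLinearGroup (Fin 2) A) :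
    IsUnit ((g : Matrix (Fin 2) (Fin 2) A) 0 0 * (g : Matrix (Fin 2) (Fin 2) A) 1 1 -
      (g : Matrix (Fin 2) (Fin 2) A) 0 1 * (g : Matrix (Fin 2) (Fin 2) A) 1 0) := by
  rw [← Matrix.det_fin_two]
  exact (Matrix.isUnit_iff_isUnit_det _).1 g.isUnit

/-- A matrix with invertible lower right entry factors as upper unipotent, diagonal, lower
unipotent, and the last factor is a conjugate of an upper unipotent by the swap. Otherwise, as the
determinant is a unit in a local ring, the lower left entry is invertible, and multiplying by the
swap brings it to the lower right. -/
theorem gl_two_induction [IsLocalRing A] {P : Matrix.GeneralLinearGroup (Fin 2) A → Prop}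
    (hmul : ∀ g h, P g → P h → P (g * h)) (hunip : ∀ x, P (unipMat x))
    (hdiag : ∀ a d, P (diagMat a d)) (hswap : P swapMat)
    (g : Matrix.GeneralLinearGroup (Fin 2) A) : P g := by
  have key : ∀ g : Matrix.GeneralLinearGroup (Fin 2) A,
      IsUnit ((g : Matrix (Fin 2) (Fin 2) A) 1 1) → P g := by
    intro g hd
    obtain ⟨d, hd⟩ := hd
    obtain ⟨D, hD⟩ := isUnit_det_fin_two g
    set a := (g : Matrix (Fin 2) (Fin 2) A) 0 0 with ha
    set b := (g : Matrix (Fin 2) (Fin 2) A) 0 1 with hb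
    set c := (g : Matrix (Fin 2) (Fin 2) A) 1 0 with hc
    have e : g = unipMat (b * ((d⁻¹ : Aˣ) : A)) * diagMat (D * d⁻¹) d *
        (swapMat * unipMat (c * ((d⁻¹ : Aˣ) : A)) * swapMat) := by
      refine Units.ext ?_
      simp only [Units.val_mul, coe_unipMat, coe_diagMat, coe_swapMat]
      have h1 : (d : A) * ((d⁻¹ : Aˣ) : A) = 1 := d.mul_inv
      ext i j
      fin_cases i <;> fin_cases j <;> simp [← ha, ← hb, ← hc, ← hd, mul_assoc]
      · rw [hD, ← hd]
        linear_combination (-a) * h1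
      · linear_combination (-c) * h1
    rw [e]
    exact hmul _ _ (hmul _ _ (hunip _) (hdiag _ _)) (hmul _ _ (hmul _ _ hswap (hunip _)) hswap)
  by_cases hd : IsUnit ((g : Matrix (Fin 2) (Fin 2) A) 1 1)
  · exact key g hd
  · have h1 := isUnit_det_fin_two g
    rw [sub_eq_add_neg] at h1
    have h2 := (isUnit_or_isUnit_of_isUnit_add h1).resolve_left
      fun h => hd (isUnit_of_mul_isUnit_right h)
    have h3 := isUnit_of_mul_isUnit_right (IsUnit.neg_iff _ |>.1 h2)
    have e : g = g * swapMat * swapMat := by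
      rw [mul_assoc, show (swapMat * swapMat : Matrix.GeneralLinearGroup (Fin 2) A) = 1 from ?_,
        mul_one]
      refine Units.ext ?_
      rw [Units.val_mul, coe_swapMat]
      ext i j; fin_cases i <;> fin_cases j <;> simp
    rw [e]
    refine hmul _ _ (key _ ?_) hswap
    rw [Units.val_mul, coe_swapMat]
    simpa [Matrix.mul_apply, Fin.sum_univ_two] using h3

end Generators

/-! ### Powers with exponents in `Ñ` -/

section Pow

variable {p f : ℕ} {k : Type*} [Field k]

/-- The power `x ^ α` for an exponent `α ∈ Ñ`. -/
def pw (α : NTilde p f) (x : k) : k := x ^ α.rep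

theorem pw_zero (x : k) : pw (0 : NTilde p f) x = 1 := by rw [pw, rep_zero, pow_zero]

theorem pw_mul (α : NTilde p f) (x y : k) : pw α (x * y) = pw α x * pw α y := mul_pow _ _ _

theorem pw_one (α : NTilde p f) : pw α (1 : k) = 1 := one_pow _

theorem pw_ne_zero (α : NTilde p f) {x : k} (hx : x ≠ 0) : pw α x ≠ 0 := pow_ne_zero _ hx

theorem pw_of_zero {α : NTilde p f} (hα : α ≠ 0) : pw α (0 : k) = 0 := by
  refine zero_pow fun h => hα ?_
  rw [← mk_rep α, h, mk_zero]

variable [Finite k] (hq : Nat.card k = p ^ f)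

include hq

/-- Nonzero `x` satisfy `x ^ (q - 1) = 1`. At `x = 0` only the exponent `0` gives `1`, which is why
`∼` keeps `0` apart from `q - 1`. -/
theorem pow_eq_pow_of_mk_eq {m n : ℕ} (h : (mk m : NTilde p f) = mk n) (x : k) :
    x ^ m = x ^ n := by
  rw [mk_eq_mk] at h
  rcases eq_or_ne x 0 with rfl | hx
  · by_cases hm : m = 0
    · rw [hm, h.1.1 hm]
    · rw [zero_pow hm, zero_pow (mt h.1.2 hm)]
  · have := Fintype.ofFinite k
    have h1 : x ^ (p ^ f - 1) = 1 := by
      rw [← hq, Nat.card_eq_fintype_card]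
      exact FiniteField.pow_card_sub_one_eq_one x hx
    exact pow_eq_pow_of_modEq h.2 h1

theorem pw_mk (n : ℕ) (x : k) : pw (mk n : NTilde p f) x = x ^ n :=
  pow_eq_pow_of_mk_eq hq (mk_rep _) x

theorem pw_add (α β : NTilde p f) (x : k) : pw (α + β) x = pw α x * pw β x := by
  conv_lhs => rw [← mk_rep α, ← mk_rep β, ← mk_add, pw_mk hq, pow_add]
  rfl

theorem pw_two_nsmul (α : NTilde p f) (x : k) : pw (2 • α) x = pw α (x ^ 2) := by
  rw [two_smul, pw_add hq, pow_two, pw_mul]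

theorem pw_ofDigits [NeZero f] (u : ZMod f → ℕ) (x : k) :
    pw (ofDigits u : NTilde p f) x = ∏ i, (x ^ p ^ i.val) ^ u i := by
  change pw (mk _) x = _
  rw [pw_mk hq, ← Finset.prod_pow_eq_pow_sum]
  exact Finset.prod_congr rfl fun i _ => by rw [← pow_mul, mul_comm]

/-- The binomial theorem for exponents in `Ñ`. -/
theorem pw_ofDigits_add [NeZero f] [Fact p.Prime] [CharP k p] (u : ZMod f → ℕ) (x y : k) :
    pw (ofDigits u : NTilde p f) (x + y) =
      ∑ l ∈ Fintype.piFinset fun i => Finset.range (u i + 1),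
        (∏ i, ((u i).choose (l i) : k)) * pw (ofDigits (u - l) : NTilde p f) x *
          pw (ofDigits l : NTilde p f) y := by
  simp only [pw_ofDigits hq]
  have h : ∀ i : ZMod f, ((x + y) ^ p ^ i.val) ^ u i =
      ∑ l ∈ Finset.range (u i + 1), ((u i).choose l : k) * (x ^ p ^ i.val) ^ (u i - l) *
        (y ^ p ^ i.val) ^ l := by
    intro i
    rw [add_pow_char_pow, add_comm, add_pow]
    exact Finset.sum_congr rfl fun l _ => by ring
  simp only [h]
  rw [Finset.prod_univ_sum]
  simp only [Finset.prod_mul_distrib, Pi.sub_apply]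

end Pow

/-! ### Coordinates on `𝒪₂` -/

section Coord

variable {R : Type*} [CommRing R] [IsLocalRing R]

/-- The assertion that `𝒪₂` is the ring of dual numbers over `k`, with the Teichmüller lift as
structure map and the class of `ϖ` as `ε`. -/
structure IsDualNumbers (ϖ : R) : Prop where
  teich_zero : teich R 0 = 0
  teich_one : teich R 1 = 1
  teich_add : ∀ x y, teich R (x + y) = teich R x + teich R y
  teich_mul : ∀ x y, teich R (x * y) = teich R x * teich R y
  red_teich : ∀ x, red R (teich R x) = x
  red_eps : red R (Ideal.Quotient.mk _ ϖ) = 0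
  eps_mul_eps : (Ideal.Quotient.mk _ ϖ : R₂ R) * Ideal.Quotient.mk _ ϖ = 0
  exists_coord : ∀ l : R₂ R, ∃ b, l = teich R (red R l) + teich R b * Ideal.Quotient.mk _ ϖ
  eq_zero : ∀ b, teich R b * Ideal.Quotient.mk _ ϖ = 0 → b = 0

/-- The hypothesis `hp` makes `𝒪₂` a ring of characteristic `p`, so the `q`-th power map is additive
and `[x] + [y]` is itself fixed by it; uniqueness of the Teichmüller lift then gives additivity. The
hypothesis `h2` makes the `ϖ`-coordinate well defined. -/
theorem isDualNumbers {p f : ℕ} [Fact p.Prime] [Finite (ResidueField R)]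
    (hq : Nat.card (ResidueField R) = p ^ f) (hp : (p : R) ∈ maximalIdeal R ^ 2) {ϖ : R}
    (h1 : maximalIdeal R = Ideal.span {ϖ}) (h2 : ∀ x, x * ϖ ∈ maximalIdeal R ^ 2 →
      x ∈ maximalIdeal R) : IsDualNumbers ϖ := by
  have hp' : ((p : ℕ) : R₂ R) = 0 := by
    rw [← map_natCast (Ideal.Quotient.mk (maximalIdeal R ^ 2))]
    exact Ideal.Quotient.eq_zero_iff_mem.2 hp
  have hmϖ : ϖ ∈ maximalIdeal R := by rw [h1]; exact Ideal.mem_span_singleton_self ϖ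
  have hne : Nontrivial (R₂ R) := (red R).domain_nontrivial
  have : CharP (R₂ R) p := (CharP.charP_iff_prime_eq_zero Fact.out).2 hp'
  have hs := teich_spec R
  have hε : red R (Ideal.Quotient.mk _ ϖ) = 0 := (residue_eq_zero_iff _).2 hmϖ
  have hεε : (Ideal.Quotient.mk _ ϖ : R₂ R) * Ideal.Quotient.mk _ ϖ = 0 := by
    rw [← map_mul, Ideal.Quotient.eq_zero_iff_mem, pow_two]
    exact Ideal.mul_mem_mul hmϖ hmϖ
  refine ⟨(teich_unique R 0 0 (map_zero _) ?_).symm, (teich_unique R 1 1 (map_one _)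
    (one_pow _)).symm, fun x y => (teich_unique R _ _ ?_ ?_).symm,
    fun x y => (teich_unique R _ _ ?_ ?_).symm, fun x => (hs x).1, hε, hεε, fun l => ?_,
    fun b hb => ?_⟩
  · exact zero_pow (Nat.card_pos.ne')
  · rw [map_add, (hs x).1, (hs y).1]
  · conv_lhs => rw [hq, add_pow_char_pow, ← hq, (hs x).2, (hs y).2]
  · rw [map_mul, (hs x).1, (hs y).1]
  · rw [mul_pow, (hs x).2, (hs y).2]
  · have h3 : ∀ l, red R l = 0 → ∃ m, l = m * Ideal.Quotient.mk _ ϖ := by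
      intro l hl
      obtain ⟨l, rfl⟩ := Ideal.Quotient.mk_surjective l
      have hl : l ∈ maximalIdeal R := (residue_eq_zero_iff _).1 hl
      rw [h1] at hl
      obtain ⟨m, rfl⟩ := Ideal.mem_span_singleton'.1 hl
      exact ⟨Ideal.Quotient.mk _ m, map_mul _ _ _⟩
    obtain ⟨m, hm⟩ := h3 (l - teich R (red R l)) (by rw [map_sub, (hs _).1, sub_self])
    -- The second-order remainder `n` disappears because `ϖ² = 0` in `𝒪₂`.
    obtain ⟨n, hn⟩ := h3 (m - teich R (red R m)) (by rw [map_sub, (hs _).1, sub_self])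
    refine ⟨red R m, ?_⟩
    rw [eq_add_of_sub_eq hm, eq_add_of_sub_eq hn]
    simp only [add_mul, mul_assoc, map_add, map_mul, hε, hεε, (hs _).1]
    simp [add_comm]
  · rw [← (hs b).1]
    obtain ⟨x, hx⟩ := Ideal.Quotient.mk_surjective (teich R b)
    rw [← hx] at hb ⊢
    rw [← map_mul, Ideal.Quotient.eq_zero_iff_mem] at hb
    exact (residue_eq_zero_iff _).2 (h2 x hb)

namespace IsDualNumbers

variable {ϖ : R} (h : IsDualNumbers ϖ)

/-- The coordinate `λ₁` of `λ = [λ₀] + [λ₁] ϖ`. -/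
def snd (l : R₂ R) : ResidueField R := (h.exists_coord l).choose

theorem eq_teich_add (l : R₂ R) :
    l = teich R (red R l) + teich R (h.snd l) * Ideal.Quotient.mk _ ϖ :=
  (h.exists_coord l).choose_spec

include h in
theorem teich_neg (x : ResidueField R) : teich R (-x) = -teich R x := by
  rw [eq_neg_iff_add_eq_zero, ← h.teich_add, neg_add_cancel, h.teich_zero]

theorem snd_unique {l : R₂ R} {a b : ResidueField R}
    (hl : l = teich R a + teich R b * Ideal.Quotient.mk _ ϖ) : red R l = a ∧ h.snd l = b := by
  have ha : red R l = a := by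
    rw [hl, map_add, map_mul, h.red_teich, h.red_eps, mul_zero, add_zero]
  refine ⟨ha, ?_⟩
  have h1 := h.eq_teich_add l
  rw [ha] at h1
  have h2 : teich R (h.snd l) * Ideal.Quotient.mk _ ϖ = teich R b * Ideal.Quotient.mk _ ϖ :=
    add_left_cancel (h1.symm.trans hl)
  rw [← sub_eq_zero, ← sub_mul, sub_eq_add_neg, ← h.teich_neg, ← h.teich_add] at h2
  have := h.eq_zero _ h2
  rwa [← sub_eq_add_neg, sub_eq_zero] at this

theorem snd_add (l m : R₂ R) : h.snd (l + m) = h.snd l + h.snd m := by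
  refine (h.snd_unique (a := red R l + red R m) ?_).2
  conv_lhs => rw [h.eq_teich_add l, h.eq_teich_add m]
  rw [h.teich_add, h.teich_add]
  ring

/-- The Leibniz rule for dual numbers: the term in `ϖ²` drops out. -/
theorem snd_mul (l m : R₂ R) : h.snd (l * m) = red R l * h.snd m + h.snd l * red R m := by
  refine (h.snd_unique (a := red R l * red R m) ?_).2
  conv_lhs => rw [h.eq_teich_add l, h.eq_teich_add m]
  rw [h.teich_add, h.teich_mul, h.teich_mul, h.teich_mul]
  linear_combination teich R (h.snd l) * teich R (h.snd m) * h.eps_mul_eps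

theorem snd_teich (a : ResidueField R) : h.snd (teich R a) = 0 :=
  (h.snd_unique (a := a) (by rw [h.teich_zero, zero_mul, add_zero])).2

theorem snd_teich_mul (b : ResidueField R) :
    h.snd (teich R b * Ideal.Quotient.mk _ ϖ) = b :=
  (h.snd_unique (a := 0) (by rw [h.teich_zero, zero_add])).2

theorem snd_zero : h.snd 0 = 0 := by rw [← h.teich_zero, h.snd_teich]

include h in
theorem isUnit_of_red_ne_zero {l : R₂ R} (hl : red R l ≠ 0) : IsUnit l := by
  refine IsUnit.of_mul_eq_one
    -- The inverse of `a + bε` is `a⁻¹ - a⁻² b ε`.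
    (teich R (red R l)⁻¹ - teich R ((red R l)⁻¹ ^ 2 * h.snd l) * Ideal.Quotient.mk _ ϖ) ?_
  have e1 : teich R (red R l) * teich R (red R l)⁻¹ = 1 := by
    rw [← h.teich_mul, mul_inv_cancel₀ hl, h.teich_one]
  have e2 : teich R ((red R l)⁻¹ ^ 2 * h.snd l) =
      teich R (red R l)⁻¹ * teich R (red R l)⁻¹ * teich R (h.snd l) := by
    rw [pow_two, h.teich_mul, h.teich_mul]
  conv_lhs => enter [1]; rw [h.eq_teich_add l]
  rw [e2]
  generalize teich R (red R l) = a at *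
  generalize teich R (red R l)⁻¹ = b at *
  generalize teich R (h.snd l) = c at *
  linear_combination (1 - b * c * Ideal.Quotient.mk _ ϖ) * e1 - b ^ 2 * c ^ 2 * h.eps_mul_eps

end IsDualNumbers

end Coord

end PrincipalSeries

end

noncomputable section

namespace PrincipalSeries

open NTilde Theta

/-! ### The basis vectors as functions -/

section Functions

variable {R : Type*} [CommRing R] [IsLocalRing R] {E : Type*} [Field E]
  [Algebra (ResidueField R) E] {p f : ℕ} {r : NTilde p f}

/-- The elements of the principal series as functions. -/
def toFun : V R E r →ₗ[E] (G₂ R → E) :=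
  Submodule.subtype (Representation.coindV (borel R).subtype (chiRep R E r))

theorem toFun_injective : Function.Injective (toFun : V R E r → G₂ R → E) :=
  Subtype.coe_injective

theorem toFun_principalSeries (g : G₂ R) (v : V R E r) (y : G₂ R) :
    toFun (principalSeries R E r g v) y = toFun v (y * g) := rfl

open Classical in
theorem toFun_pureTensor (g : G₂ R) (v : E) (y : G₂ R) :
    toFun (pureTensor R E r g v) y = if y * g ∈ borel R then
      algebraMap (ResidueField R) E
        (pw r (red R ((↑(y * g) : Matrix (Fin 2) (Fin 2) (R₂ R)) 1 1))) * v else 0 := by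
  change (if h : y * g ∈ borel R then chi R E r ⟨y * g, h⟩ * v else 0) = _
  split_ifs with h
  · rw [pw, map_pow]; rfl
  · rfl

/-- The residue of the lower left entry. -/
def rowC (y : G₂ R) : ResidueField R := red R ((y : Matrix (Fin 2) (Fin 2) (R₂ R)) 1 0)

/-- The residue of the lower right entry. -/
def rowD (y : G₂ R) : ResidueField R := red R ((y : Matrix (Fin 2) (Fin 2) (R₂ R)) 1 1)

variable {ϖ : R} (h : IsDualNumbers ϖ)

/-- The Wronskian `c₀ d₁ - c₁ d₀` of the bottom row `(c, d)`. -/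
def rowW (y : G₂ R) : ResidueField R :=
  rowC y * h.snd ((y : Matrix (Fin 2) (Fin 2) (R₂ R)) 1 1) -
    h.snd ((y : Matrix (Fin 2) (Fin 2) (R₂ R)) 1 0) * rowD y

theorem rowD_ne_zero {y : G₂ R} (hy : rowC y = 0) : rowD y ≠ 0 := by
  intro hd
  have := (isUnit_det_fin_two y).map (red R)
  rw [rowC] at hy
  rw [rowD] at hd
  rw [map_sub, map_mul, map_mul, hy, hd] at this
  simp at this

/-- The function `c₀^a d₀^b (c₀ d₁ - c₁ d₀)^γ` of the bottom row. -/
def mon (E : Type*) [Field E] [Algebra (ResidueField R) E] (a b γ : NTilde p f) (y : G₂ R) : E :=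
  algebraMap (ResidueField R) E (pw a (rowC y) * pw b (rowD y) * pw γ (rowW h y))

variable [Finite (ResidueField R)] [hp : Fact p.Prime] [NeZero f]
  (hq : Nat.card (ResidueField R) = p ^ f)

include h hq in
-- At a matrix with bottom row `(c, d)`, the summand of index `λ` is nonzero only if `cλ + d = 0`.
-- If `c₀ = 0` there is no such `λ`, and the monomial vanishes as its exponent `a` is nonzero.
-- Otherwise `λ = -d/c` has coordinates `-d₀/c₀` and `-W/c₀²`, and `χ_r` contributes `c₀^r`; the
-- exponents of `c₀` combine to `r - 2j₁ - j₀`.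
theorem toFun_fVec (hr : r ≠ 0) (j₀ j₁ : NTilde p f) (y : G₂ R) :
    toFun (fVec R E r ϖ j₀ j₁) y = algebraMap (ResidueField R) E (pw j₀ (-1) * pw j₁ (-1)) *
      mon h E (fin j₀ j₁ : Theta p f r).expA j₀ j₁ y := by
  classical
  have ha : (fin j₀ j₁ : Theta p f r).expA ≠ 0 := sub_ne_zero (sub_ne_zero hr _) _
  have hsum := expA_add_expB hr (fin j₀ j₁ : Theta p f r)
  have hsum2 := add_sub hr (2 • j₁)
  rw [expD] at hsum
  rw [← hsum] at hsum2
  change 2 • j₁ + (_ + j₀) = r at hsum2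
  generalize (fin j₀ j₁ : Theta p f r).expA = a at *
  have hmem : ∀ l, y * flipMat R l ∈ borel R ↔
      (y : Matrix (Fin 2) (Fin 2) (R₂ R)) 1 0 * l + (y : Matrix (Fin 2) (Fin 2) (R₂ R)) 1 1 = 0 := by
    intro l
    rw [mem_borel, Units.val_mul]
    simp [flipMat, Matrix.mul_apply, Fin.sum_univ_two]
  have hval : ∀ l, (↑(y * flipMat R l) : Matrix (Fin 2) (Fin 2) (R₂ R)) 1 1 =
      (y : Matrix (Fin 2) (Fin 2) (R₂ R)) 1 0 := by
    intro l
    rw [Units.val_mul]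
    simp [flipMat, Matrix.mul_apply, Fin.sum_univ_two]
  have hC : red R ((y : Matrix (Fin 2) (Fin 2) (R₂ R)) 1 0) = rowC y := rfl
  have hD : red R ((y : Matrix (Fin 2) (Fin 2) (R₂ R)) 1 1) = rowD y := rfl
  simp only [fVec, map_sum, Finset.sum_apply, toFun_pureTensor, hmem, hval, hC]
  by_cases hc : rowC y = 0
  · rw [mon, hc, pw_of_zero ha, zero_mul, zero_mul, map_zero, mul_zero]
    refine Finset.sum_eq_zero fun x _ => Finset.sum_eq_zero fun z _ => if_neg fun h0 => ?_
    have := congrArg (red R) h0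
    rw [map_add, map_mul, map_zero] at this
    change rowC y * _ + rowD y = 0 at this
    rw [hc, zero_mul, zero_add] at this
    exact rowD_ne_zero hc this
  · have hu := h.isUnit_of_red_ne_zero hc
    set x₀ : ResidueField R := -(rowD y) / rowC y with hx₀
    set z₀ : ResidueField R := -(rowW h y) / rowC y ^ 2 with hz₀
    have hiff : ∀ x z : ResidueField R, (y : Matrix (Fin 2) (Fin 2) (R₂ R)) 1 0 *
        (teich R x + teich R z * Ideal.Quotient.mk _ ϖ) +
          (y : Matrix (Fin 2) (Fin 2) (R₂ R)) 1 1 = 0 ↔ x = x₀ ∧ z = z₀ := by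
      intro x z
      have e1 : red R (teich R x + teich R z * Ideal.Quotient.mk _ ϖ) = x := (h.snd_unique rfl).1
      have e2 : h.snd (teich R x + teich R z * Ideal.Quotient.mk _ ϖ) = z := (h.snd_unique rfl).2
      generalize teich R x + teich R z * Ideal.Quotient.mk _ ϖ = l at e1 e2 ⊢
      have hw : rowW h y = rowC y * h.snd ((y : Matrix (Fin 2) (Fin 2) (R₂ R)) 1 1) -
        h.snd ((y : Matrix (Fin 2) (Fin 2) (R₂ R)) 1 0) * rowD y := rfl
      generalize (y : Matrix (Fin 2) (Fin 2) (R₂ R)) 1 0 = c at *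
      generalize (y : Matrix (Fin 2) (Fin 2) (R₂ R)) 1 1 = d at *
      have hred : red R (c * l + d) = rowC y * x + rowD y := by
        rw [map_add, map_mul, e1, hC, hD]
      have hsnd : h.snd (c * l + d) = rowC y * z + h.snd c * x + h.snd d := by
        rw [h.snd_add, h.snd_mul, e1, e2, hC]
      have h0 : c * l + d = 0 ↔ rowC y * x + rowD y = 0 ∧
          rowC y * z + h.snd c * x + h.snd d = 0 := by
        rw [← hred, ← hsnd]
        refine ⟨fun h1 => by rw [h1, map_zero, h.snd_zero]; exact ⟨rfl, rfl⟩, fun h1 => ?_⟩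
        rw [h.eq_teich_add (c * l + d), h1.1, h1.2, h.teich_zero, zero_mul, add_zero]
      rw [h0, hx₀, hz₀, eq_div_iff hc, eq_div_iff (pow_ne_zero 2 hc), hw]
      constructor
      · rintro ⟨h1, h2⟩
        exact ⟨by linear_combination h1, by linear_combination rowC y * h2 - h.snd c * h1⟩
      · rintro ⟨h1, h2⟩
        have h3 : rowC y * x + rowD y = 0 := by linear_combination h1
        refine ⟨h3, mul_left_cancel₀ hc ?_⟩
        linear_combination h2 + h.snd c * h3
    simp only [hiff]
    rw [Finset.sum_eq_single x₀, Finset.sum_eq_single z₀]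
    · rw [if_pos ⟨rfl, rfl⟩, mon, ← map_mul, ← map_mul]
      congr 1
      change pw r (rowC y) * (pw j₀ x₀ * pw j₁ z₀) = _
      rw [← hsum2, pw_add hq, pw_add hq, pw_two_nsmul hq]
      have e1 : pw j₀ (rowC y) * pw j₀ x₀ = pw j₀ (-1) * pw j₀ (rowD y) := by
        rw [← pw_mul, ← pw_mul, hx₀]; congr 1; field_simp
      have e2 : pw j₁ (rowC y ^ 2) * pw j₁ z₀ = pw j₁ (-1) * pw j₁ (rowW h y) := by
        rw [← pw_mul, ← pw_mul, hz₀]; congr 1; field_simp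
      linear_combination (pw a (rowC y) * pw j₁ (rowC y ^ 2) * pw j₁ z₀) * e1 +
        pw a (rowC y) * pw j₀ (-1) * pw j₀ (rowD y) * e2
    · intro z _ hz
      exact if_neg fun h1 => hz h1.2
    · simp
    · intro x _ hx
      exact Finset.sum_eq_zero fun z _ => if_neg fun h1 => hx h1.1
    · simp

theorem row_mul_swap (y : G₂ R) :
    rowC (y * (swapMat : G₂ R)) = rowD y ∧ rowD (y * (swapMat : G₂ R)) = rowC y ∧
      rowW h (y * (swapMat : G₂ R)) = -rowW h y := by
  have e0 : (↑(y * (swapMat : G₂ R)) : Matrix (Fin 2) (Fin 2) (R₂ R)) 1 0 =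
      (y : Matrix (Fin 2) (Fin 2) (R₂ R)) 1 1 := by
    rw [Units.val_mul, coe_swapMat]; simp [Matrix.mul_apply, Fin.sum_univ_two]
  have e1 : (↑(y * (swapMat : G₂ R)) : Matrix (Fin 2) (Fin 2) (R₂ R)) 1 1 =
      (y : Matrix (Fin 2) (Fin 2) (R₂ R)) 1 0 := by
    rw [Units.val_mul, coe_swapMat]; simp [Matrix.mul_apply, Fin.sum_univ_two]
  rw [rowW, rowW, rowC, rowD, rowC, rowD, e0, e1]
  refine ⟨rfl, rfl, by ring⟩

theorem row_mul_unip (y : G₂ R) (x : R₂ R) :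
    rowC (y * unipMat x) = rowC y ∧ rowD (y * unipMat x) = rowD y + red R x * rowC y ∧
      rowW h (y * unipMat x) = rowW h y + h.snd x * rowC y ^ 2 := by
  have e0 : (↑(y * unipMat x) : Matrix (Fin 2) (Fin 2) (R₂ R)) 1 0 =
      (y : Matrix (Fin 2) (Fin 2) (R₂ R)) 1 0 := by
    rw [Units.val_mul, coe_unipMat]; simp [Matrix.mul_apply, Fin.sum_univ_two]
  have e1 : (↑(y * unipMat x) : Matrix (Fin 2) (Fin 2) (R₂ R)) 1 1 =
      (y : Matrix (Fin 2) (Fin 2) (R₂ R)) 1 0 * x + (y : Matrix (Fin 2) (Fin 2) (R₂ R)) 1 1 := by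
    rw [Units.val_mul, coe_unipMat]; simp [Matrix.mul_apply, Fin.sum_univ_two]
  rw [rowW, rowW, rowC, rowD, rowC, rowD, e0, e1, h.snd_add, h.snd_mul, map_add, map_mul]
  refine ⟨rfl, by ring, by ring⟩

theorem row_mul_diag (y : G₂ R) (s t : (R₂ R)ˣ) :
    rowC (y * diagMat s t) = rowC y * red R s ∧ rowD (y * diagMat s t) = rowD y * red R t ∧
      rowW h (y * diagMat s t) = rowW h y * (red R s * red R t) +
        (red R s * h.snd t - h.snd s * red R t) * (rowC y * rowD y) := by
  have e0 : (↑(y * diagMat s t) : Matrix (Fin 2) (Fin 2) (R₂ R)) 1 0 =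
      (y : Matrix (Fin 2) (Fin 2) (R₂ R)) 1 0 * s := by
    rw [Units.val_mul, coe_diagMat]; simp [Matrix.mul_apply, Fin.sum_univ_two]
  have e1 : (↑(y * diagMat s t) : Matrix (Fin 2) (Fin 2) (R₂ R)) 1 1 =
      (y : Matrix (Fin 2) (Fin 2) (R₂ R)) 1 1 * t := by
    rw [Units.val_mul, coe_diagMat]; simp [Matrix.mul_apply, Fin.sum_univ_two]
  rw [rowW, rowW, rowC, rowD, rowC, rowD, e0, e1, h.snd_mul, h.snd_mul, map_mul, map_mul]
  refine ⟨rfl, rfl, by ring⟩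

theorem flipMat_zero : flipMat R 0 = swapMat := by
  refine Units.ext ?_
  rw [coe_swapMat]; rfl

/-- The sign relating `f_x` to the monomial function with the same exponents. -/
def sgn : Theta p f r → ResidueField R
  | .fin j₀ j₁ => pw j₀ (-1) * pw j₁ (-1)
  | .infty _ => 1

theorem sgn_mul_self (x : Theta p f r) : (sgn x : ResidueField R) * sgn x = 1 := by
  cases x with
  | fin j₀ j₁ =>
    rw [sgn, mul_mul_mul_comm, ← pw_mul, ← pw_mul, neg_mul_neg, one_mul, pw_one, pw_one, one_mul]
  | infty j₁ => exact one_mul 1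

include h hq in
theorem toFun_basisVec (hr : r ≠ 0) (x : Theta p f r) (y : G₂ R) :
    toFun (basisVec R E r ϖ x) y = algebraMap (ResidueField R) E (sgn x) *
      mon h E x.expA x.expB x.expD y := by
  cases x with
  | fin j₀ j₁ => exact toFun_fVec h hq hr j₀ j₁ y
  -- Right multiplication by the swap exchanges `c` and `d` and negates `W`. The resulting sign
  -- `(-1)^{j₁}` cancels the one of `f_{(0, j₁)}`.
  | infty j₁ =>
    rw [basisVec, toFun_principalSeries, toFun_fVec h hq hr, flipMat_zero, mon, mon]
    obtain ⟨h1, h2, h3⟩ := row_mul_swap h y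
    have h4 : (fin 0 j₁ : Theta p f r).expA = sub r (2 • j₁) :=
      (eq_sub (sub_ne_zero hr _) (zero_add _)).symm
    rw [h1, h2, h3, h4, ← map_mul, ← map_mul, sgn, expA, expB, expD, pw_zero, pw_zero,
      neg_eq_neg_one_mul (rowW h y), pw_mul]
    congr 1
    have : pw j₁ (-1 : ResidueField R) * pw j₁ (-1) = 1 := by
      rw [← pw_mul, neg_mul_neg, one_mul, pw_one]
    linear_combination pw (sub r (2 • j₁)) (rowD y) * pw j₁ (rowW h y) * this

variable (R E ϖ) in
/-- The basis vector attached to `x`, normalized so that it is a monomial function. -/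
def monVec (x : Theta p f r) : V R E r :=
  algebraMap (ResidueField R) E (sgn x) • basisVec R E r ϖ x

include h hq in
theorem toFun_monVec (hr : r ≠ 0) (x : Theta p f r) (y : G₂ R) :
    toFun (monVec R E ϖ x) y = mon h E x.expA x.expB x.expD y := by
  rw [monVec, map_smul, Pi.smul_apply, toFun_basisVec h hq hr, smul_eq_mul, ← mul_assoc, ← map_mul,
    sgn_mul_self, map_one, one_mul]

theorem basisVec_eq (x : Theta p f r) :
    basisVec R E r ϖ x = algebraMap (ResidueField R) E (sgn x) • monVec R E ϖ x := by
  rw [monVec, smul_smul, ← map_mul, sgn_mul_self, map_one, one_smul]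

/-! ### The group action on monomials -/

include h hq in
theorem toFun_monVec_ofExp (hr : r ≠ 0) {a b γ : NTilde p f} (hs : a + b = sub r (2 • γ))
    (y : G₂ R) : toFun (monVec R E ϖ (ofExp r a b γ)) y = mon h E a b γ y := by
  rw [toFun_monVec h hq hr, expA_ofExp hs, expB_ofExp hs, expD_ofExp]

include h hq in
theorem act_swap (hr : r ≠ 0) {a b γ : NTilde p f} (hs : a + b = sub r (2 • γ)) :
    principalSeries R E r swapMat (monVec R E ϖ (ofExp r a b γ)) =
      algebraMap (ResidueField R) E (pw γ (-1)) • monVec R E ϖ (ofExp r b a γ) := by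
  refine toFun_injective (funext fun y => ?_)
  obtain ⟨h1, h2, h3⟩ := row_mul_swap h y
  rw [toFun_principalSeries, map_smul, Pi.smul_apply, toFun_monVec_ofExp h hq hr hs,
    toFun_monVec_ofExp h hq hr (by rwa [add_comm]), mon, mon, h1, h2, h3,
    neg_eq_neg_one_mul (rowW h y), pw_mul, smul_eq_mul, ← map_mul]
  congr 1; ring

/-- The indices of the binomial expansion of a power with exponent `∑ u_i p^i`. -/
abbrev box (u : ZMod f → ℕ) : Finset (ZMod f → ℕ) :=
  Fintype.piFinset fun i => Finset.range (u i + 1)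

theorem mem_box {u l : ZMod f → ℕ} : l ∈ box u ↔ l ≤ u := by
  simp [box, Fintype.mem_piFinset, Pi.le_def]

theorem sub_add_of_mem_box {u l : ZMod f → ℕ} (hl : l ∈ box u) : u - l + l = u := by
  ext i
  have : l i ≤ u i := mem_box.1 hl i
  simp only [Pi.add_apply, Pi.sub_apply]; omega

theorem add_ofDigits_sub {a s : NTilde p f} {u l : ZMod f → ℕ} (hl : l ∈ box u)
    (hs : a + ofDigits u = s) : a + ofDigits l + ofDigits (u - l) = s := by
  rw [← hs]
  conv_rhs => rw [← sub_add_of_mem_box hl, map_add]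
  abel

variable [CharP (ResidueField R) p]

include h hq in
-- Right translation sends `d₀` to `d₀ + t c₀` and fixes `c₀` and `W`, so only the power of `d₀` is
-- expanded.
theorem act_unip (hr : r ≠ 0) {a γ : NTilde p f} {u : ZMod f → ℕ}
    (hs : a + ofDigits u = sub r (2 • γ)) (t : ResidueField R) :
    principalSeries R E r (unipMat (teich R t)) (monVec R E ϖ (ofExp r a (ofDigits u) γ)) =
      ∑ l ∈ box u, algebraMap (ResidueField R) E ((∏ i, ((u i).choose (l i) : ResidueField R)) *
        pw (ofDigits l : NTilde p f) t) •
          monVec R E ϖ (ofExp r (a + ofDigits l) (ofDigits (u - l)) γ) := by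
  refine toFun_injective (funext fun y => ?_)
  obtain ⟨h1, h2, h3⟩ := row_mul_unip h y (teich R t)
  rw [toFun_principalSeries, map_sum, Finset.sum_apply, toFun_monVec_ofExp h hq hr hs, mon, h1, h2,
    h3, h.snd_teich, h.red_teich, zero_mul, add_zero, pw_ofDigits_add hq, Finset.mul_sum,
    Finset.sum_mul, map_sum]
  refine Finset.sum_congr rfl fun l hl => ?_
  rw [map_smul, Pi.smul_apply, toFun_monVec_ofExp h hq hr (add_ofDigits_sub hl hs), mon,
    smul_eq_mul, ← map_mul (algebraMap (ResidueField R) E), pw_mul, pw_add hq]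
  congr 1; ring

theorem sub_two_nsmul_of_mem_box (hr : r ≠ 0) {s : NTilde p f} {u l : ZMod f → ℕ} (hl : l ∈ box u)
    (hs : s = sub r (2 • ofDigits u)) : s + 2 • ofDigits l = sub r (2 • ofDigits (u - l)) := by
  refine eq_sub ?_ ?_
  · rw [Ne, add_eq_zero, not_and_or, hs]; exact .inl (sub_ne_zero hr _)
  · conv_rhs => rw [← add_sub hr (2 • ofDigits u), ← hs, ← sub_add_of_mem_box hl, map_add, smul_add]
    abel

include h hq in
-- The residues `c₀` and `d₀` are fixed and `W` becomes `W + t c₀²`, so only the power of `W` is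
-- expanded.
theorem act_unip_eps (hr : r ≠ 0) {a b : NTilde p f} {u : ZMod f → ℕ}
    (hs : a + b = sub r (2 • ofDigits u)) (t : ResidueField R) :
    principalSeries R E r (unipMat (teich R t * Ideal.Quotient.mk _ ϖ))
      (monVec R E ϖ (ofExp r a b (ofDigits u))) =
      ∑ l ∈ box u, algebraMap (ResidueField R) E ((∏ i, ((u i).choose (l i) : ResidueField R)) *
        pw (ofDigits l : NTilde p f) t) •
          monVec R E ϖ (ofExp r (a + 2 • ofDigits l) b (ofDigits (u - l))) := by
  refine toFun_injective (funext fun y => ?_)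
  obtain ⟨h1, h2, h3⟩ := row_mul_unip h y (teich R t * Ideal.Quotient.mk _ ϖ)
  rw [toFun_principalSeries, map_sum, Finset.sum_apply, toFun_monVec_ofExp h hq hr hs, mon, h1, h2,
    h3, h.snd_teich_mul, map_mul (red R), h.red_eps, mul_zero, zero_mul, add_zero, pw_ofDigits_add hq,
    Finset.mul_sum, map_sum]
  refine Finset.sum_congr rfl fun l hl => ?_
  rw [map_smul, Pi.smul_apply, toFun_monVec_ofExp h hq hr ?_, mon,
    smul_eq_mul, ← map_mul (algebraMap (ResidueField R) E), pw_mul, pw_add hq, pw_two_nsmul hq]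
  · congr 1; ring
  · rw [← sub_two_nsmul_of_mem_box hr hl hs]; abel

include h hq in
-- The Wronskian becomes `s₀ t₀ W + (s₀ t₁ - s₁ t₀) c₀ d₀`; its second term is the source of
-- relation 3.
theorem act_diag (hr : r ≠ 0) {a b : NTilde p f} {u : ZMod f → ℕ}
    (hs : a + b = sub r (2 • ofDigits u)) (s t : (R₂ R)ˣ) :
    principalSeries R E r (diagMat s t) (monVec R E ϖ (ofExp r a b (ofDigits u))) =
      ∑ l ∈ box u, algebraMap (ResidueField R) E ((∏ i, ((u i).choose (l i) : ResidueField R)) *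
        (pw a (red R s) * pw b (red R t) * pw (ofDigits (u - l) : NTilde p f) (red R s * red R t) *
        pw (ofDigits l : NTilde p f) (red R s * h.snd t - h.snd s * red R t))) •
          monVec R E ϖ (ofExp r (a + ofDigits l) (b + ofDigits l) (ofDigits (u - l))) := by
  refine toFun_injective (funext fun y => ?_)
  obtain ⟨h1, h2, h3⟩ := row_mul_diag h y s t
  rw [toFun_principalSeries, map_sum, Finset.sum_apply, toFun_monVec_ofExp h hq hr hs, mon, h1, h2,
    h3, pw_ofDigits_add hq, Finset.mul_sum, map_sum]
  refine Finset.sum_congr rfl fun l hl => ?_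
  rw [map_smul, Pi.smul_apply, toFun_monVec_ofExp h hq hr ?_, mon,
    smul_eq_mul, ← map_mul (algebraMap (ResidueField R) E), pw_mul, pw_mul, pw_mul, pw_mul, pw_add hq, pw_add hq, pw_mul]
  · rw [pw_mul (ofDigits l) (rowC y)]
    congr 1; ring
  · rw [← sub_two_nsmul_of_mem_box hr hl hs, two_smul]; abel

/-! ### Stability -/

theorem VSub_eq_span (θ : Types p f r) :
    VSub R E r ϖ θ = Submodule.span E {v | ∃ x : Theta p f r, typeOf x ≤ θ ∧ v = monVec R E ϖ x} := by
  refine le_antisymm (Submodule.span_le.2 ?_) (Submodule.span_le.2 ?_)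
  · rintro _ ⟨x, hx, rfl⟩
    rw [basisVec_eq]
    exact Submodule.smul_mem _ _ (Submodule.subset_span ⟨x, hx, rfl⟩)
  · rintro _ ⟨x, hx, rfl⟩
    exact Submodule.smul_mem _ _ (Submodule.subset_span ⟨x, hx, rfl⟩)

theorem monVec_mem_VSub {θ : Types p f r} {x : Theta p f r} (hx : typeOf x ≤ θ) :
    monVec R E ϖ x ∈ VSub R E r ϖ θ := by
  rw [VSub_eq_span]
  exact Submodule.subset_span ⟨x, hx, rfl⟩

include h in
/-- A subspace of the principal series which is stable under generators of `GL₂(𝒪₂)` is stable. -/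
theorem act_mem_induction {W : Submodule E (V R E r)}
    (hunip : ∀ t, ∀ v ∈ W, principalSeries R E r (unipMat (teich R t)) v ∈ W)
    (heps : ∀ t, ∀ v ∈ W,
      principalSeries R E r (unipMat (teich R t * Ideal.Quotient.mk _ ϖ)) v ∈ W)
    (hdiag : ∀ s t, ∀ v ∈ W, principalSeries R E r (diagMat s t) v ∈ W)
    (hswap : ∀ v ∈ W, principalSeries R E r swapMat v ∈ W) (g : G₂ R) :
    ∀ v ∈ W, principalSeries R E r g v ∈ W := by
  have hnt : Nontrivial (R₂ R) := (red R).domain_nontrivial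
  have : IsLocalRing (R₂ R) := IsLocalRing.of_surjective' (Ideal.Quotient.mk _)
    Ideal.Quotient.mk_surjective
  refine gl_two_induction (P := fun g => ∀ v ∈ W, principalSeries R E r g v ∈ W)
    ?_ ?_ hdiag hswap g
  · intro g g' hg hg' v hv
    rw [map_mul, Module.End.mul_apply]
    exact hg _ (hg' v hv)
  · intro x v hv
    rw [h.eq_teich_add x, unipMat_add, map_mul, Module.End.mul_apply]
    exact hunip _ _ (heps _ _ hv)

include h hq in
-- It suffices to apply generators to the monomials spanning `V_θ`. Every term of the resulting
-- expansions lies below the original monomial, by `ofExp_add_le`, `ofExp_sq_add_le`,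
-- `ofExp_cross_add_le` and `ofExp_swap_le`.
theorem allStable (hr : r ≠ 0) : AllStable R E r ϖ := by
  intro θ
  have key : ∀ g : G₂ R, (∀ x : Theta p f r, typeOf x ≤ θ →
      principalSeries R E r g (monVec R E ϖ x) ∈ VSub R E r ϖ θ) →
      ∀ v ∈ VSub R E r ϖ θ, principalSeries R E r g v ∈ VSub R E r ϖ θ := by
    intro g hg
    have : VSub R E r ϖ θ ≤ (VSub R E r ϖ θ).comap (principalSeries R E r g) := by
      conv_lhs => rw [VSub_eq_span]
      refine Submodule.span_le.2 ?_
      rintro _ ⟨x, hx, rfl⟩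
      exact hg x hx
    exact this
  have hmem : ∀ {x y : Theta p f r} (c : E), typeOf x ≤ θ → y ≤ x →
      c • monVec R E ϖ y ∈ VSub R E r ϖ θ := fun c hx hy =>
    Submodule.smul_mem _ _ (monVec_mem_VSub ((typeOf_le.2 hy).trans hx))
  refine act_mem_induction h (fun t => key _ fun x hx => ?_) (fun t => key _ fun x hx => ?_)
    (fun s t => key _ fun x hx => ?_) (key _ fun x hx => ?_)
  all_goals
    have hs := expA_add_expB hr x
    have hx' := ofExp_exp hr x
    have hbl := digit_lt x.expB
    have hdl := digit_lt x.expD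
    rw [← ofDigits_digit x.expB, ← ofDigits_digit x.expD] at hs hx'
    generalize x.expA = a at *
    generalize x.expB.digit = b at *
    generalize x.expD.digit = d at *
    subst hx'
  · rw [act_unip h hq hr hs]
    refine Submodule.sum_mem _ fun l hl => hmem _ hx ?_
    have e := sub_add_of_mem_box hl
    have := ofExp_add_le (a := a) (r := r) (γ := ofDigits d) l (v := b - l) (by rwa [e])
      (by rwa [e])
    rwa [e] at this
  · rw [act_unip_eps h hq hr hs]
    refine Submodule.sum_mem _ fun l hl => hmem _ hx ?_
    have e := sub_add_of_mem_box hl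
    have := ofExp_sq_add_le (a := a) (b := ofDigits b) hr l (v := d - l) (by rwa [e])
      (by rwa [e])
    rwa [e] at this
  · rw [act_diag h hq hr hs]
    refine Submodule.sum_mem _ fun l hl => hmem _ hx ?_
    have e := sub_add_of_mem_box hl
    have := ofExp_cross_add_le (a := a) (b := ofDigits b) hr l (v := d - l) (by rwa [e])
      (by rwa [e])
    rwa [e] at this
  · rw [act_swap h hq hr hs]
    exact hmem _ hx (ofExp_swap_le hr hs)

end Functions

end PrincipalSeries

end

noncomputable section

namespace PrincipalSeries

open NTilde Theta

/-! ### Linear independence of power functions -/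

section Dedekind

variable {p f : ℕ} {k : Type*} [Field k] {E : Type*} [Field E] [Algebra k E]

variable (k E) in
/-- The power function with exponent `α`, as a monoid homomorphism. -/
def pwHom (α : NTilde p f) : k →* E where
  toFun x := algebraMap k E (pw α x)
  map_one' := by rw [pw_one, map_one]
  map_mul' x y := by rw [pw_mul, map_mul]

theorem pwHom_apply (α : NTilde p f) (x : k) : pwHom k E α x = algebraMap k E (pw α x) := rfl

variable [Finite k] [Fact p.Prime] [NeZero f] (hq : Nat.card k = p ^ f)

include hq

/-- The value at `0` detects the exponent `0`, and the value at a generator of `kˣ` detects the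
exponent modulo `q - 1`. -/
theorem pw_injective {α β : NTilde p f} (h : ∀ x : k, pw α x = pw β x) : α = β := by
  have := Fintype.ofFinite k
  rw [← mk_rep α, ← mk_rep β, mk_eq_mk]
  constructor
  · have h0 := h 0
    rw [pw, pw] at h0
    constructor
    · intro ha
      rw [ha, pow_zero] at h0
      by_contra hb
      rw [zero_pow hb] at h0
      exact one_ne_zero h0
    · intro hb
      rw [hb, pow_zero] at h0
      by_contra ha
      rw [zero_pow ha] at h0
      exact zero_ne_one h0
  · obtain ⟨g, hg⟩ := IsCyclic.exists_ofOrder_eq_natCard (α := kˣ)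
    have h1 : orderOf g = p ^ f - 1 := by
      rw [hg, Nat.card_units, hq]
    rw [← h1, ← pow_eq_pow_iff_modEq]
    refine Units.ext ?_
    rw [Units.val_pow_eq_pow_val, Units.val_pow_eq_pow_val]
    exact h g

/-- Dedekind's theorem is applied to homomorphisms of the whole multiplicative monoid `k`, not only
of `kˣ`; this keeps the exponents `0` and `q - 1` apart. -/
theorem linearIndependent_pwHom :
    LinearIndependent E fun α : NTilde p f => (pwHom k E α : k → E) :=
  (linearIndependent_monoidHom k E).comp (pwHom k E) fun _ _ h =>
    pw_injective hq fun x => (algebraMap k E).injective (DFunLike.congr_fun h x)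

theorem linearIndependent_pwHom_prod :
    LinearIndependent E fun α : NTilde p f × NTilde p f =>
      ((pwHom k E α.1).coprod (pwHom k E α.2) : k × k → E) := by
  refine (linearIndependent_monoidHom (k × k) E).comp
    (fun α : NTilde p f × NTilde p f => (pwHom k E α.1).coprod (pwHom k E α.2)) fun α β h => ?_
  refine Prod.ext (pw_injective hq fun x => (algebraMap k E).injective ?_)
    (pw_injective hq fun x => (algebraMap k E).injective ?_)
  · have := DFunLike.congr_fun h (x, 1)
    simp only [MonoidHom.coprod_apply, map_one, mul_one] at this
    exact this
  · have := DFunLike.congr_fun h (1, x)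
    simp only [MonoidHom.coprod_apply, map_one, one_mul] at this
    exact this

/-- Coefficients of distinct power functions can be extracted within a subspace. -/
theorem mem_of_sum_pw_smul_mem {W : Type*} [AddCommGroup W] [Module E W] (S : Submodule E W)
    {ι : Type*} (s : Finset ι) (α : ι → NTilde p f) (hα : Set.InjOn α s) (w : ι → W)
    (hw : ∀ t : k, ∑ l ∈ s, algebraMap k E (pw (α l) t) • w l ∈ S) {l : ι} (hl : l ∈ s) :
    w l ∈ S := by
  rw [← Submodule.Quotient.mk_eq_zero]
  -- A functional on the quotient by `S` turns the hypothesis into a scalar relation between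
  -- distinct power functions, whose coefficients must vanish.
  refine (Module.forall_dual_apply_eq_zero_iff E _).1 fun φ => ?_
  have hLI : LinearIndepOn E (fun l => (pwHom k E (α l) : k → E)) s :=
    ((linearIndependent_pwHom (E := E) hq).linearIndepOn (α '' s)).comp_of_image hα
  refine linearIndepOn_finset_iff.1 hLI (fun l => φ (Submodule.Quotient.mk (w l))) ?_ l hl
  ext t
  have := hw t
  rw [← Submodule.Quotient.mk_eq_zero] at this
  have := congrArg φ this
  rw [← Submodule.mkQ_apply, map_sum, map_sum, map_zero] at this
  simp only [map_smul, smul_eq_mul, Submodule.mkQ_apply] at this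
  simp only [Finset.sum_apply, Pi.smul_apply, smul_eq_mul, pwHom_apply, Pi.zero_apply]
  rw [← this]
  exact Finset.sum_congr rfl fun _ _ => mul_comm _ _

end Dedekind

/-! ### A normal form for the irreducible representations -/

section Model

variable {R : Type*} [CommRing R] [IsLocalRing R] {E : Type*} [Field E]
  [Algebra (ResidueField R) E] {p f : ℕ} [NeZero f]

/-- The vectors `b m`, for `m ≤ N`, form a basis of the representation `ρ`, in which the
generators of `GL₂(𝒪₂)` act as on the monomials `∏ i, X_i ^ m_i Y_i ^ (N_i - m_i)` of
`⨂ i, (det ^ e_i ⊗ Sym ^ N_i)^(i)`, twisted by `det ^ γ`. -/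
structure IsModel (ϖ : R) {W : Type*} [AddCommGroup W] [Module E W]
    (ρ : Representation E (G₂ R) W) (N e : ZMod f → ℕ) (γ : NTilde p f)
    (b : (ZMod f → ℕ) → W) : Prop where
  linearIndependent : LinearIndependent E fun m : Set.Iic N => b m
  span : ⊤ ≤ Submodule.span E (Set.range fun m : Set.Iic N => b m)
  unip : ∀ t, ∀ m ≤ N, ρ (unipMat (teich R t)) (b m) =
    ∑ l ∈ box (N - m), algebraMap (ResidueField R) E
      ((∏ i, (((N - m) i).choose (l i) : ResidueField R)) *
        pw (ofDigits l : NTilde p f) t) • b (m + l)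
  unip_eps : ∀ t, ∀ m ≤ N, ρ (unipMat (teich R t * Ideal.Quotient.mk _ ϖ)) (b m) = b m
  diag : ∀ s t : (R₂ R)ˣ, ∀ m ≤ N, ρ (diagMat s t) (b m) = algebraMap (ResidueField R) E
    (pw (ofDigits (m + e) : NTilde p f) (red R s) * pw (ofDigits (N - m + e) : NTilde p f) (red R t) *
      pw γ (red R s * red R t)) • b m
  swap : ∀ m ≤ N, ρ swapMat (b m) = algebraMap (ResidueField R) E
    (pw γ (-1) * pw (ofDigits e : NTilde p f) (-1)) • b (N - m)

namespace IsModel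

variable {ϖ : R} {W : Type*} [AddCommGroup W] [Module E W]
  {ρ : Representation E (G₂ R) W} {N e : ZMod f → ℕ} {γ : NTilde p f} {b : (ZMod f → ℕ) → W}

/-- The basis of a model. -/
def basis (H : IsModel ϖ ρ N e γ b) : Module.Basis (Set.Iic N) E W :=
  Module.Basis.mk H.linearIndependent H.span

theorem basis_apply (H : IsModel ϖ ρ N e γ b) (m : Set.Iic N) : H.basis m = b m :=
  Module.Basis.mk_apply _ _ _

/-- A model prescribes the matrices of a generating set, so matching the two bases is equivariant.
-/
theorem equiv_of_isModel (h : IsDualNumbers ϖ) {W' : Type*} [AddCommGroup W'] [Module E W']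
    {σ : Representation E (G₂ R) W'} {b' : (ZMod f → ℕ) → W'} (H : IsModel ϖ ρ N e γ b)
    (H' : IsModel ϖ σ N e γ b') : Nonempty (ρ.Equiv σ) := by
  set φ : W ≃ₗ[E] W' := H.basis.equiv H'.basis (Equiv.refl _) with hφ
  have hb : ∀ m ≤ N, φ (b m) = b' m := fun m hm => by
    have := H.basis.equiv_apply (i := ⟨m, hm⟩) (b' := H'.basis) (e := Equiv.refl _)
    rwa [basis_apply, Equiv.refl_apply, basis_apply] at this
  have hext : ∀ g, (∀ m ≤ N, φ (ρ g (b m)) = σ g (b' m)) → ∀ v, φ (ρ g v) = σ g (φ v) := by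
    intro g hg v
    have : φ.toLinearMap ∘ₗ ρ g = σ g ∘ₗ φ.toLinearMap := by
      refine H.basis.ext fun m => ?_
      rw [basis_apply, LinearMap.comp_apply, LinearMap.comp_apply, LinearEquiv.coe_coe, hg _ m.2,
        hb _ m.2]
    exact LinearMap.congr_fun this v
  have hnt : Nontrivial (R₂ R) := (red R).domain_nontrivial
  have : IsLocalRing (R₂ R) := IsLocalRing.of_surjective' (Ideal.Quotient.mk _)
    Ideal.Quotient.mk_surjective
  have key : ∀ g, ∀ v, φ (ρ g v) = σ g (φ v) := by
    intro g
    refine gl_two_induction (P := fun g => ∀ v, φ (ρ g v) = σ g (φ v)) ?_ ?_ ?_ ?_ g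
    · intro g g' hg hg' v
      rw [map_mul, map_mul, Module.End.mul_apply, Module.End.mul_apply, hg, hg']
    · intro x v
      rw [h.eq_teich_add x, unipMat_add, map_mul, map_mul, Module.End.mul_apply,
        Module.End.mul_apply, hext _ fun m hm => ?_, hext _ fun m hm => ?_]
      · rw [H.unip_eps _ _ hm, H'.unip_eps _ _ hm, hb _ hm]
      · rw [H.unip _ _ hm, H'.unip _ _ hm, map_sum]
        refine Finset.sum_congr rfl fun l hl => ?_
        rw [map_smul, hb]
        intro i
        have h1 : l i ≤ (N - m) i := mem_box.1 hl i
        have h2 : m i ≤ N i := hm i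
        simp only [Pi.sub_apply, Pi.add_apply] at h1 ⊢
        omega
    · intro s t
      refine hext _ fun m hm => ?_
      rw [H.diag _ _ _ hm, H'.diag _ _ _ hm, map_smul, hb _ hm]
    · refine hext _ fun m hm => ?_
      rw [H.swap _ hm, H'.swap _ hm, map_smul, hb _ tsub_le_self]
  exact ⟨Representation.Equiv.mk φ fun g => LinearMap.ext (key g)⟩

variable [Finite (ResidueField R)] [hp : Fact p.Prime] [CharP (ResidueField R) p]
  (hq : Nat.card (ResidueField R) = p ^ f)

include hq in
-- A nonzero subrepresentation contains every coefficient, as a function of `t`, of the translates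
-- of its vectors under `unipMat (teich R t)`. One such coefficient is a multiple of `b N`; the swap
-- carries `b N` to `b 0`; and the coefficients of the translates of `b 0` are nonzero multiples of
-- all `b m`.
theorem isIrreducible (H : IsModel ϖ ρ N e γ b) (hN : ∀ i, N i < p) : ρ.IsIrreducible := by
  have hinj : Set.InjOn (fun l : ZMod f → ℕ => (ofDigits l : NTilde p f)) (box N) := by
    intro l hl l' hl' hll
    have h1 : ∀ {l}, l ∈ box N → ∀ i, l i < p := fun hl i => (mem_box.1 hl i).trans_lt (hN i)
    have := congrArg NTilde.digit hll
    rwa [digit_ofDigits (h1 hl), digit_ofDigits (h1 hl')] at this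
  -- The index set is enlarged to one independent of `m`, the extra binomial coefficients being
  -- zero, so that coefficients can be compared across the basis.
  have hunip : ∀ t, ∀ m ≤ N, ρ (unipMat (teich R t)) (b m) =
      ∑ l ∈ box N, algebraMap (ResidueField R) E (pw (ofDigits l : NTilde p f) t) •
        algebraMap (ResidueField R) E (∏ i, (((N - m) i).choose (l i) : ResidueField R)) •
          b (m + l) := by
    intro t m hm
    rw [H.unip t m hm]
    simp only [smul_smul, ← map_mul, mul_comm (pw _ _)]
    refine Finset.sum_subset (fun l hl => ?_) fun l _ hl => ?_
    · exact mem_box.2 ((mem_box.1 hl).trans tsub_le_self)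
    · rw [mem_box, Pi.le_def, not_forall] at hl
      obtain ⟨i, hi⟩ := hl
      rw [Finset.prod_eq_zero (Finset.mem_univ i), zero_mul, map_zero, zero_smul]
      rw [Nat.choose_eq_zero_of_lt (not_le.1 hi), Nat.cast_zero]
  have hb0 : b 0 ≠ 0 := H.linearIndependent.ne_zero ⟨0, Set.mem_Iic.2 (fun _ => Nat.zero_le _)⟩
  have : Nontrivial (Subrepresentation ρ) := by
    refine ⟨⊥, ⊤, fun h => hb0 ?_⟩
    have h1 : b 0 ∈ (⊥ : Subrepresentation ρ).toSubmodule := by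
      rw [h]; exact Submodule.mem_top
    exact (Submodule.mem_bot E).1 h1
  refine ⟨fun S => or_iff_not_imp_left.2 fun hS => ?_⟩
  obtain ⟨v, hv, hv0⟩ : ∃ v ∈ S.toSubmodule, v ≠ 0 := by
    refine S.toSubmodule.exists_mem_ne_zero_of_ne_bot fun h => hS ?_
    exact Subrepresentation.toSubmodule_injective h
  -- the vector `b N` lies in `S`
  have hbN : b N ∈ S.toSubmodule := by
    have := Set.finite_Iic N |>.fintype
    have hsum := H.basis.sum_repr v
    obtain ⟨m₀, hm₀⟩ : ∃ m, H.basis.repr v m ≠ 0 := by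
      by_contra! h0
      exact hv0 (H.basis.repr.map_eq_zero_iff.1 (Finsupp.ext h0))
    -- In the coefficient of exponent `N - m₁`, a basis vector `b m` contributes only if `m ≤ m₁`.
    -- Minimality of `m₁` in the support of `v` leaves `m = m₁` alone, and it contributes a multiple
    -- of `b N`.
    obtain ⟨m₁, -, hmin⟩ := (Set.toFinite {m | H.basis.repr v m ≠ 0}).exists_le_minimal hm₀
    have hsub : (N - m₁.1) ∈ box N := mem_box.2 tsub_le_self
    have := mem_of_sum_pw_smul_mem hq S.toSubmodule (box N)
      (fun l : ZMod f → ℕ => (ofDigits l : NTilde p f)) hinj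
      (fun l => ∑ m, H.basis.repr v m • algebraMap (ResidueField R) E
        (∏ i, (((N - m.1) i).choose (l i) : ResidueField R)) • b (m + l)) (fun t => ?_) hsub
    · rw [Finset.sum_eq_single m₁] at this
      · have h1 : m₁.1 + (N - m₁.1) = N := add_tsub_cancel_of_le m₁.2
        rw [h1] at this
        simp only [Nat.choose_self, Nat.cast_one, Finset.prod_const_one, map_one, one_smul] at this
        exact (Submodule.smul_mem_iff _ hmin.1).1 this
      · intro m _ hm
        by_cases h0 : H.basis.repr v m = 0
        · rw [h0, zero_smul]
        · have h1 : ¬ m ≤ m₁ := fun hle => hm (le_antisymm hle (hmin.2 h0 hle))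
          obtain ⟨i, hi⟩ := not_forall.1 (show ¬ ∀ i, m.1 i ≤ m₁.1 i from h1)
          rw [Finset.prod_eq_zero (Finset.mem_univ i), map_zero, zero_smul, smul_zero]
          rw [Nat.choose_eq_zero_of_lt, Nat.cast_zero]
          have h2 : m.1 i ≤ N i := m.2 i
          simp only [Pi.sub_apply]
          omega
      · simp
    · have h1 := S.apply_mem_toSubmodule (unipMat (teich R t)) hv
      rw [← hsum, map_sum] at h1
      simp only [map_smul, basis_apply] at h1
      rw [Finset.sum_congr rfl fun m _ => by rw [hunip t m.1 m.2]] at h1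
      simp only [Finset.smul_sum] at h1 ⊢
      rw [Finset.sum_comm] at h1
      refine (congrArg (· ∈ S.toSubmodule) ?_).mp h1
      exact Finset.sum_congr rfl fun l _ => Finset.sum_congr rfl fun m _ => smul_comm _ _ _
  have hb0S : b 0 ∈ S.toSubmodule := by
    have h1 := S.apply_mem_toSubmodule swapMat hbN
    rw [H.swap N le_rfl, tsub_self] at h1
    refine (Submodule.smul_mem_iff _ ?_).1 h1
    rw [Ne, map_eq_zero_iff _ (algebraMap (ResidueField R) E).injective]
    exact mul_ne_zero (pw_ne_zero _ (neg_ne_zero.2 one_ne_zero))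
      (pw_ne_zero _ (neg_ne_zero.2 one_ne_zero))
  refine Subrepresentation.toSubmodule_injective (top_le_iff.1 (H.span.trans ?_))
  rw [Submodule.span_le]
  rintro _ ⟨⟨m, hm⟩, rfl⟩
  have := mem_of_sum_pw_smul_mem hq S.toSubmodule (box N)
    (fun l : ZMod f → ℕ => (ofDigits l : NTilde p f)) hinj
    (fun l => algebraMap (ResidueField R) E
      (∏ i, (((N - 0) i).choose (l i) : ResidueField R)) • b (0 + l)) (fun t => ?_)
    (mem_box.2 hm)
  · rw [zero_add] at this
    refine (Submodule.smul_mem_iff _ ?_).1 this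
    rw [Ne, map_eq_zero_iff _ (algebraMap (ResidueField R) E).injective, Finset.prod_eq_zero_iff]
    rintro ⟨i, -, hi⟩
    rw [CharP.cast_eq_zero_iff (ResidueField R) p] at hi
    rw [tsub_zero] at hi
    -- The binomial coefficient divides `N_i!`, which is prime to `p` as `N_i < p`.
    have h1 : p ∣ (N i).factorial := by
      rw [← Nat.choose_mul_factorial_mul_factorial (hm i), mul_assoc]
      exact hi.mul_right _
    exact absurd ((hp.out.dvd_factorial).1 h1) (not_le.2 (hN i))
  · rw [← hunip t 0 (fun _ => Nat.zero_le _)]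
    exact S.apply_mem_toSubmodule _ hb0S

end IsModel

end Model

end PrincipalSeries

end

noncomputable section

namespace PrincipalSeries

open NTilde Theta

/-! ### Linear independence of the basis vectors -/

theorem linearIndependent_of_eq {E M ι : Type*} [Semiring E] [AddCommMonoid M] [Module E M]
    {v w : ι → M} (hw : LinearIndependent E w) (h : v = w) : LinearIndependent E v := h ▸ hw

section Independence

variable {R : Type*} [CommRing R] [IsLocalRing R] {E : Type*} [Field E]
  [Algebra (ResidueField R) E] {p f : ℕ} {r : NTilde p f} {ϖ : R} (h : IsDualNumbers ϖ)

theorem row_swap : rowC (swapMat : G₂ R) = 1 ∧ rowD (swapMat : G₂ R) = 0 ∧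
    rowW h (swapMat : G₂ R) = 0 := by
  rw [rowW, rowC, rowD, coe_swapMat]
  refine ⟨by simp, by simp, ?_⟩
  simp [h.snd_zero]

variable [Finite (ResidueField R)] [hp : Fact p.Prime] [NeZero f]
  (hq : Nat.card (ResidueField R) = p ^ f)

include h hq in
-- Rows with `c₀ = 1` see only `b` and `γ`, so they cannot tell `a = 0` from `a = q - 1`. Rows with
-- `c₀ = 0` kill every monomial with `a ≠ 0` and give `z^γ` on those with `a = 0`. Hence the finite
-- part is independent inside `ker T₂`, and the part at `∞` is independent modulo it.
theorem linearIndependent_monVec (hr : r ≠ 0) :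
    LinearIndependent E (monVec R E ϖ : Theta p f r → V R E r) := by
  have hmon := fun (x : Theta p f r) (y : G₂ R) => toFun_monVec (E := E) h hq hr x y
  -- evaluation at the matrices with bottom row `(1, [x] + [z] ϖ)`
  let T₁ : V R E r →ₗ[E] (ResidueField R × ResidueField R → E) :=
    LinearMap.funLeft E E (fun x : ResidueField R × ResidueField R => (swapMat *
      unipMat (teich R x.1 + teich R x.2 * Ideal.Quotient.mk _ ϖ) : G₂ R)) ∘ₗ toFun
  -- evaluation at the matrices with bottom row `(-[z] ϖ, 1)`
  let T₂ : V R E r →ₗ[E] (ResidueField R → E) :=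
    LinearMap.funLeft E E (fun z : ResidueField R => (swapMat *
      unipMat (teich R (-z) * Ideal.Quotient.mk _ ϖ) * swapMat : G₂ R)) ∘ₗ toFun
  have hT₁ : ∀ (x : Theta p f r) y, T₁ (monVec R E ϖ x) y =
      algebraMap (ResidueField R) E (pw x.expB y.1 * pw x.expD y.2) := by
    intro x y
    change toFun (monVec R E ϖ x) _ = _
    obtain ⟨a1, a2, a3⟩ := row_mul_unip h (swapMat : G₂ R)
      (teich R y.1 + teich R y.2 * Ideal.Quotient.mk _ ϖ)
    obtain ⟨b1, b2, b3⟩ := row_swap h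
    obtain ⟨c1, c2⟩ := h.snd_unique (l := teich R y.1 + teich R y.2 * Ideal.Quotient.mk _ ϖ) rfl
    rw [hmon, mon, a1, a2, a3, b1, b2, b3, c1, c2, pw_one, one_mul, zero_add, zero_add, one_pow,
      mul_one, mul_one]
  have hT₂ : ∀ (x : Theta p f r) z, T₂ (monVec R E ϖ x) z =
      algebraMap (ResidueField R) E (pw x.expA 0 * pw x.expD z) := by
    intro x z
    change toFun (monVec R E ϖ x) _ = _
    obtain ⟨a1, a2, a3⟩ := row_mul_unip h (swapMat : G₂ R)
      (teich R (-z) * Ideal.Quotient.mk _ ϖ)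
    obtain ⟨b1, b2, b3⟩ := row_swap h
    obtain ⟨c1, c2, c3⟩ := row_mul_swap h
      (swapMat * unipMat (teich R (-z) * Ideal.Quotient.mk _ ϖ) : G₂ R)
    have c4 : red R (teich R (-z) * Ideal.Quotient.mk _ ϖ) = 0 := by
      rw [map_mul, h.red_eps, mul_zero]
    rw [hmon, mon, c1, c2, c3, a1, a2, a3, b1, b2, b3, h.snd_teich_mul, c4, pw_one, zero_mul,
      zero_add, zero_add, one_pow, mul_one, mul_one, neg_neg]
  have hfin : ∀ j : NTilde p f × NTilde p f, T₂ (monVec R E ϖ (.fin j.1 j.2 : Theta p f r)) = 0 := by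
    intro j
    ext z
    rw [hT₂, expA, pw_of_zero (sub_ne_zero (sub_ne_zero hr _) _), zero_mul, map_zero]
    rfl
  let u : NTilde p f × NTilde p f → LinearMap.ker T₂ := fun j => ⟨monVec R E ϖ (.fin j.1 j.2), hfin j⟩
  have hu : LinearIndependent E u := by
    refine .of_comp (T₁ ∘ₗ (LinearMap.ker T₂).subtype) ?_
    refine linearIndependent_of_eq (linearIndependent_pwHom_prod (E := E) hq) ?_
    funext j y
    rw [Function.comp_apply, LinearMap.comp_apply]
    change T₁ (monVec R E ϖ _) y = _
    rw [hT₁, map_mul]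
    rfl
  have hw : LinearIndependent E (Submodule.Quotient.mk (p := LinearMap.ker T₂) ∘
      fun j => monVec R E ϖ (.infty j : Theta p f r)) := by
    refine .of_comp ((LinearMap.ker T₂).liftQ T₂ le_rfl) ?_
    refine linearIndependent_of_eq (linearIndependent_pwHom (E := E) hq) ?_
    funext j z
    change T₂ (monVec R E ϖ _) z = _
    rw [hT₂, expA, pw_zero, one_mul]
    rfl
  have := hu.sumElim_of_quotient _ hw
  let φ : Theta p f r → (NTilde p f × NTilde p f) ⊕ NTilde p f
    | .fin j₀ j₁ => .inl (j₀, j₁)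
    | .infty j₁ => .inr j₁
  have hφ : Function.Injective φ := by
    rintro (⟨a, b⟩ | a) (⟨c, d⟩ | c) hh <;> simp [φ] at hh <;> simp [hh]
  refine linearIndependent_of_eq (this.comp φ hφ) ?_
  funext x
  cases x <;> rfl

end Independence

/-! ### The representations `L(θ)` -/

section Head

variable {R : Type*} [CommRing R] [IsLocalRing R] {E : Type*} [Field E]
  [Algebra (ResidueField R) E] {p f : ℕ} {r : NTilde p f} {ϖ : R}
  [Finite (ResidueField R)] [hp : Fact p.Prime] [NeZero f] [CharP (ResidueField R) p]
  {θ : Types p f r}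

variable (R E ϖ) in
/-- The underlying space of `L(θ)`. -/
abbrev Head (θ : Types p f r) : Type _ :=
  VSub R E r ϖ θ ⧸ (VSubLT R E r ϖ θ).comap (VSub R E r ϖ θ).subtype

variable (R E ϖ) in
open Classical in
/-- The class in `L(θ)` of the basis vector attached to `x`. -/
def headMk (θ : Types p f r) (x : Theta p f r) : Head R E ϖ θ :=
  -- The value `0` in the other case only makes the function total.
  if hx : typeOf x ≤ θ then Submodule.Quotient.mk ⟨monVec R E ϖ x, monVec_mem_VSub hx⟩ else 0

variable (R E ϖ) in
/-- The inclusion of `L(θ)` in the quotient of the principal series. -/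
def headIncl (θ : Types p f r) : Head R E ϖ θ →ₗ[E] V R E r ⧸ VSubLT R E r ϖ θ :=
  Submodule.mapQ _ _ (VSub R E r ϖ θ).subtype le_rfl

theorem headIncl_injective : Function.Injective (headIncl R E ϖ θ) := by
  rw [injective_iff_map_eq_zero]
  intro v hv
  obtain ⟨v, rfl⟩ := Submodule.Quotient.mk_surjective _ v
  rw [headIncl, Submodule.mapQ_apply, Submodule.Quotient.mk_eq_zero] at hv
  exact (Submodule.Quotient.mk_eq_zero _).2 hv

theorem headIncl_headMk {x : Theta p f r} (hx : typeOf x ≤ θ) :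
    headIncl R E ϖ θ (headMk R E ϖ θ x) = Submodule.Quotient.mk (monVec R E ϖ x) := by
  rw [headMk, dif_pos hx]; rfl

theorem VSubLT_eq_span : VSubLT R E r ϖ θ =
    Submodule.span E (monVec R E ϖ '' {x : Theta p f r | typeOf x < θ}) := by
  refine le_antisymm (iSup_le fun θ' => ?_) (Submodule.span_le.2 ?_)
  · rw [VSub_eq_span]
    refine Submodule.span_mono ?_
    rintro _ ⟨x, hx, rfl⟩
    exact ⟨x, hx.trans_lt θ'.2, rfl⟩
  · rintro _ ⟨x, hx, rfl⟩
    exact le_iSup (fun θ' : {θ' : Types p f r // θ' < θ} => VSub R E r ϖ θ'.1) ⟨typeOf x, hx⟩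
      (monVec_mem_VSub le_rfl)

theorem headMk_eq_zero {x : Theta p f r} (hx : typeOf x < θ) : headMk R E ϖ θ x = 0 := by
  refine headIncl_injective ?_
  rw [headIncl_headMk hx.le, map_zero, Submodule.Quotient.mk_eq_zero, VSubLT_eq_span]
  exact Submodule.subset_span ⟨x, hx, rfl⟩

/-- This transports an expansion in the principal series to the head, all of its terms lying in
`V_θ`. -/
theorem headRep_headMk (hV : AllStable R E r ϖ) {g : G₂ R} {x : Theta p f r} (hx : typeOf x ≤ θ)
    {ι : Type*} {s : Finset ι} {c : ι → E} {y : ι → Theta p f r} (hy : ∀ l ∈ s, y l ≤ x)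
    (H : principalSeries R E r g (monVec R E ϖ x) = ∑ l ∈ s, c l • monVec R E ϖ (y l)) :
    headRep hV θ g (headMk R E ϖ θ x) = ∑ l ∈ s, c l • headMk R E ϖ θ (y l) := by
  refine headIncl_injective ?_
  rw [map_sum, headMk, dif_pos hx]
  change Submodule.Quotient.mk (principalSeries R E r g (monVec R E ϖ x)) = _
  rw [H, ← Submodule.mkQ_apply, map_sum]
  refine Finset.sum_congr rfl fun l hl => ?_
  rw [map_smul, map_smul, headIncl_headMk ((typeOf_le.2 (hy l hl)).trans hx), Submodule.mkQ_apply]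

/-- Monomials of strictly smaller type die in the quotient, so those of type exactly `θ` remain. -/
theorem span_headMk : ⊤ ≤ Submodule.span E (headMk R E ϖ θ '' {x : Theta p f r | typeOf x = θ}) := by
  intro v _
  obtain ⟨⟨v, hv⟩, rfl⟩ := Submodule.Quotient.mk_surjective _ v
  have hv' := hv
  rw [VSub_eq_span] at hv'
  induction hv' using Submodule.span_induction with
  | mem v h =>
    obtain ⟨x, hx, rfl⟩ := h
    have e : Submodule.Quotient.mk ⟨monVec R E ϖ x, hv⟩ = headMk R E ϖ θ x := by
      rw [headMk, dif_pos hx]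
    rw [e]
    rcases hx.lt_or_eq with h1 | h1
    · rw [headMk_eq_zero h1]
      exact Submodule.zero_mem _
    · exact Submodule.subset_span ⟨x, h1, rfl⟩
  | zero => exact Submodule.zero_mem _
  | add v w h1 h2 ih1 ih2 =>
    rw [← VSub_eq_span] at h1 h2
    exact Submodule.add_mem _ (ih1 h1 trivial) (ih2 h2 trivial)
  | smul c v h1 ih1 =>
    rw [← VSub_eq_span] at h1
    exact Submodule.smul_mem _ c (ih1 h1 trivial)

end Head

/-! ### A basis of `L(θ)` -/

/-! ### Factorials modulo `p`. -/

section Factorials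

variable {p : ℕ} [hp : Fact p.Prime] {k : Type*} [Field k] [CharP k p]

/-- A variant of Wilson's theorem: passing from `j` to `j + 1` multiplies by `j + 1` and divides by
`p - 1 - j`, and these are opposite modulo `p`. -/
theorem factorial_mul_factorial (j : ℕ) (hj : j < p) :
    ((j.factorial : k) * ((p - 1 - j).factorial : k)) = (-1) ^ j * ((p - 1).factorial : k) := by
  induction j with
  | zero => simp
  | succ j ih =>
    have h1 := ih (by omega)
    obtain ⟨d, hd⟩ : ∃ d, p - 1 - j = d + 1 := ⟨p - 1 - j - 1, by omega⟩
    have h2 : p - 1 - (j + 1) = d := by omega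
    have h3 : ((j + 1 : ℕ) : k) + ((d + 1 : ℕ) : k) = 0 := by
      rw [← Nat.cast_add, show j + 1 + (d + 1) = p by omega, CharP.cast_eq_zero]
    rw [hd, Nat.factorial_succ, Nat.cast_mul] at h1
    rw [h2, Nat.factorial_succ, Nat.cast_mul, pow_succ]
    linear_combination (j.factorial : k) * (d.factorial : k) * h3 - h1

/-- If `i + j + e = p - 1`, then `i + e` and `j + e` are the complements of `j` and `i`, and
`factorial_mul_factorial` applies twice. This yields the sign `(-1)^e` by which the swap acts on the
rescaled basis. -/
theorem factorial_ratio {i j e : ℕ} (h : e = 0 ∨ i + j + e + 1 = p) :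
    (j.factorial : k) * ((i + e).factorial : k) =
      (-1) ^ e * ((i.factorial : k) * ((j + e).factorial : k)) := by
  rcases h with rfl | h
  · simp [mul_comm]
  · have h1 := factorial_mul_factorial (k := k) (p := p) j (by omega)
    have h2 := factorial_mul_factorial (k := k) (p := p) i (by omega)
    rw [show p - 1 - j = i + e by omega] at h1
    rw [show p - 1 - i = j + e by omega] at h2
    rw [h1, h2]
    have h3 : (-1 : k) ^ (i + j + e) = 1 := by
      have : (-1 : k) ^ (i + j + e) * (-1) = -1 := by
        rw [← pow_succ, h, neg_one_pow_char]
      linear_combination -this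
    have h4 : (-1 : k) ^ i * (-1) ^ i = 1 := by rw [← mul_pow]; simp
    have h5 : (-1 : k) ^ e * (-1) ^ e = 1 := by rw [← mul_pow]; simp
    rw [pow_add, pow_add] at h3
    linear_combination ((p - 1).factorial : k) * ((-1) ^ e * (-1) ^ i * h3 -
      (-1) ^ j * (-1) ^ i * (-1) ^ i * h5 - (-1) ^ j * h4)

theorem factorial_ne_zero_of_lt {j : ℕ} (hj : j < p) : (j.factorial : k) ≠ 0 := by
  rw [Ne, CharP.cast_eq_zero_iff k p, hp.out.dvd_factorial]
  omega

/-- Both sides equal `j! / (l! (j - l + e)!)`. So rescaling by `j! / (j + e)!` replaces the binomial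
coefficients of `j + e` by those of `j`. -/
theorem choose_ratio {j l e : ℕ} (hl : l ≤ j) (hj : j + e < p) :
    (j.factorial : k) / ((j + e).factorial : k) * (((j + e).choose l : ℕ) : k) =
      ((j.choose l : ℕ) : k) * (((j - l).factorial : k) / ((j - l + e).factorial : k)) := by
  have h1 := Nat.choose_mul_factorial_mul_factorial hl
  have h2 := Nat.choose_mul_factorial_mul_factorial (show l ≤ j + e by omega)
  rw [show j + e - l = j - l + e by omega] at h2
  have n1 := factorial_ne_zero_of_lt (k := k) (p := p) hj
  have n2 := factorial_ne_zero_of_lt (k := k) (p := p) (show j - l + e < p by omega)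
  have n3 := factorial_ne_zero_of_lt (k := k) (p := p) (show l < p by omega)
  have h1' : ((j.choose l : ℕ) : k) * l.factorial * (j - l).factorial = j.factorial := by
    rw [← h1]; push_cast; ring
  have h2' : (((j + e).choose l : ℕ) : k) * l.factorial * (j - l + e).factorial =
      (j + e).factorial := by
    rw [← h2]; push_cast; ring
  field_simp
  refine mul_left_cancel₀ n3 ?_
  linear_combination (j.factorial : k) * h2' - ((j + e).factorial : k) * h1'

end Factorials

/-! ### The rescaled monomial basis of a head and the group action on it. -/

section HeadModel

variable {R : Type*} [CommRing R] [IsLocalRing R] {E : Type*} [Field E]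
  [Algebra (ResidueField R) E] {p f : ℕ} {r : NTilde p f} {ϖ : R}
  [Finite (ResidueField R)] [hp : Fact p.Prime] [NeZero f] [CharP (ResidueField R) p]

/-- The element of `Θ` with exponents `m + e`, `N - m + e` and `γ`. -/
def modelTheta (r : NTilde p f) (N e : ZMod f → ℕ) (γ : NTilde p f) (m : ZMod f → ℕ) :
    Theta p f r := ofExp r (ofDigits (m + e)) (ofDigits (N - m + e)) γ

/-- The factor `∏ i, (N_i - m_i)! / (N_i - m_i + e_i)!`. -/
def modelScalar (k : Type*) [Field k] (N e m : ZMod f → ℕ) : k :=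
  ∏ i, (((N - m) i).factorial : k) / (((N - m + e) i).factorial : k)

variable (R E ϖ) in
/-- The basis of `L(θ)` in which the group acts as in `IsModel`. -/
def headBasis (θ : Types p f r) (N e : ZMod f → ℕ) (γ : NTilde p f) (m : ZMod f → ℕ) :
    Head R E ϖ θ :=
  algebraMap (ResidueField R) E (modelScalar (ResidueField R) N e m) •
    headMk R E ϖ θ (modelTheta r N e γ m)

variable {N e : ZMod f → ℕ} {γ : NTilde p f}

theorem modelTheta_add {m : ZMod f → ℕ} (hm : m ≤ N) :
    m + e + (N - m + e) = N + 2 • e := by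
  ext i
  have : m i ≤ N i := hm i
  simp only [Pi.add_apply, Pi.sub_apply, Pi.smul_apply, smul_eq_mul]; omega

theorem modelTheta_sum (hs : ofDigits (N + 2 • e) = sub r (2 • γ)) {m : ZMod f → ℕ} (hm : m ≤ N) :
    ofDigits (m + e) + ofDigits (N - m + e) = sub r (2 • γ) := by
  rw [← hs, ← map_add, modelTheta_add hm]

theorem modelTheta_lt (hNe : ∀ i, (N + e) i < p) {m : ZMod f → ℕ} (hm : m ≤ N) :
    (∀ i, (m + e) i < p) ∧ ∀ i, (N - m + e) i < p := by
  refine ⟨fun i => ?_, fun i => ?_⟩ <;>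
  · have h1 := hNe i
    have : m i ≤ N i := hm i
    simp only [Pi.add_apply, Pi.sub_apply] at *; omega

theorem typeOf_modelTheta (hr : r ≠ 0) (hNe : ∀ i, (N + e) i < p)
    (hs : ofDigits (N + 2 • e) = sub r (2 • γ)) {m : ZMod f → ℕ} (hm : m ≤ N) (x : Theta p f r) :
    typeOf (modelTheta r N e γ m) = typeOf x ↔
      x.expD = γ ∧ x.expA.digit + x.expB.digit = N + 2 • e := by
  obtain ⟨h1, h2⟩ := modelTheta_lt hNe hm
  have h3 := modelTheta_sum hs hm
  rw [typeOf_eq_iff hr, modelTheta, expD_ofExp, expA_ofExp h3, expB_ofExp h3, digit_ofDigits h1,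
    digit_ofDigits h2, modelTheta_add hm]
  exact and_congr eq_comm eq_comm

/-- Where `e_i > 0` the column sum is `p - 1 + e_i`; as neither digit exceeds `p - 1`, both are at
least `e_i`. So `m = a - e` parametrizes all monomials of the type. -/
theorem exists_modelTheta (hr : r ≠ 0) (he : ∀ i, e i = 0 ∨ N i + e i + 1 = p) {x : Theta p f r}
    (hD : x.expD = γ) (hx : x.expA.digit + x.expB.digit = N + 2 • e) :
    ∃ m ≤ N, x = modelTheta r N e γ m := by
  have hx' : ∀ i, x.expA.digit i + x.expB.digit i = N i + 2 * e i := fun i => congrFun hx i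
  have key : ∀ i, e i ≤ x.expA.digit i ∧ x.expA.digit i - e i ≤ N i := by
    intro i
    have h1 := hx' i
    have h2 := digit_lt x.expA i
    have h3 := digit_lt x.expB i
    have h4 := he i
    omega
  refine ⟨x.expA.digit - e, fun i => (key i).2, ?_⟩
  have e1 : x.expA.digit - e + e = x.expA.digit := by
    ext i
    have := (key i).1
    simp only [Pi.add_apply, Pi.sub_apply]; omega
  have e2 : N - (x.expA.digit - e) + e = x.expB.digit := by
    ext i
    have := key i
    have := hx' i
    simp only [Pi.add_apply, Pi.sub_apply]; omega
  rw [modelTheta, e1, e2, ofDigits_digit, ofDigits_digit, ← hD, ofExp_exp hr]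

theorem modelScalar_ne_zero (k : Type*) [Field k] [CharP k p] (hNe : ∀ i, (N + e) i < p)
    {m : ZMod f → ℕ} : modelScalar k N e m ≠ 0 := by
  refine Finset.prod_ne_zero_iff.2 fun i _ => div_ne_zero ?_ ?_ <;>
  · refine factorial_ne_zero_of_lt (p := p) ?_
    have := hNe i
    simp only [Pi.add_apply, Pi.sub_apply] at *
    omega

theorem rank_ofExp {a b : NTilde p f} (hs : a + b = sub r (2 • γ)) :
    (ofExp r a b γ).rank = 3 * digitSum γ + digitSum a + digitSum b := by
  rw [rank, expA_ofExp hs, expB_ofExp hs, expD_ofExp]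

theorem digitSum_sub_add {u l : ZMod f → ℕ} (hu : ∀ i, u i < p) (hl : l ∈ box u) :
    digitSum (ofDigits (u - l) : NTilde p f) + ∑ i, l i =
      digitSum (ofDigits u : NTilde p f) := by
  rw [digitSum_ofDigits hu, digitSum_ofDigits (u := u - l) fun i => (Nat.sub_le _ _).trans_lt (hu i),
    ← Finset.sum_add_distrib]
  exact Finset.sum_congr rfl fun i _ => congrFun (sub_add_of_mem_box hl) i

theorem sum_pos_of_ne_zero {l : ZMod f → ℕ} (hl : l ≠ 0) : 0 < ∑ i, l i := by
  rw [Nat.pos_iff_ne_zero]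
  intro h
  exact hl (funext fun i => Finset.sum_eq_zero_iff.1 h i (Finset.mem_univ i))

variable (h : IsDualNumbers ϖ) (hq : Nat.card (ResidueField R) = p ^ f)

include h hq

/-- The space divided out is spanned by monomials of strictly smaller type, a part of the
independent family disjoint from the monomials of type `θ`. -/
theorem linearIndependent_headBasis (hr : r ≠ 0) {θ : Types p f r} (hNe : ∀ i, (N + e) i < p)
    (hs : ofDigits (N + 2 • e) = sub r (2 • γ))
    (hθ : ∀ m ≤ N, typeOf (modelTheta r N e γ m) = θ) :
    LinearIndependent E fun m : Set.Iic N => headBasis R E ϖ θ N e γ m := by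
  have hinj : Function.Injective fun m : Set.Iic N => modelTheta r N e γ m := by
    rintro ⟨m, hm⟩ ⟨m', hm'⟩ heq
    have h1 := congrArg (fun x : Theta p f r => x.expA.digit) heq
    simp only [modelTheta, expA_ofExp (modelTheta_sum hs hm), expA_ofExp (modelTheta_sum hs hm'),
      digit_ofDigits (modelTheta_lt hNe hm).1, digit_ofDigits (modelTheta_lt hNe hm').1] at h1
    exact Subtype.ext (add_right_cancel h1)
  have hLI := linearIndependent_monVec (E := E) h hq hr
  have h1 : LinearIndependent E fun m : Set.Iic N => headMk R E ϖ θ (modelTheta r N e γ m) := by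
    refine .of_comp (headIncl R E ϖ θ) ?_
    have h2 := (hLI.comp _ hinj).map (f := (VSubLT R E r ϖ θ).mkQ) ?_
    · refine linearIndependent_of_eq h2 ?_
      funext m
      exact headIncl_headMk (hθ m m.2).le
    · rw [Submodule.ker_mkQ, VSubLT_eq_span, Set.range_comp]
      refine hLI.disjoint_span_image (Set.disjoint_left.2 ?_)
      rintro _ ⟨m, rfl⟩ hlt
      exact hlt.ne (hθ m m.2)
  have h2 : ∀ m, algebraMap (ResidueField R) E (modelScalar (ResidueField R) N e m) ≠ 0 := by
    intro m
    rw [Ne, map_eq_zero_iff _ (algebraMap (ResidueField R) E).injective]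
    exact modelScalar_ne_zero _ hNe
  exact h1.units_smul fun m => Units.mk0 _ (h2 m)

/-- In the head a term of an expansion survives only if its rank has not dropped. This removes all
terms that change `γ`, and all terms of `(d + tc)^b` that produce a carry. The factorials in
`headBasis` normalize the remaining coefficients. -/
theorem isModel_headRep (hr : r ≠ 0) (hV : AllStable R E r ϖ) {θ : Types p f r}
    (hNe : ∀ i, (N + e) i < p) (he : ∀ i, e i = 0 ∨ N i + e i + 1 = p)
    (hs : ofDigits (N + 2 • e) = sub r (2 • γ))
    (hθ : ∀ m ≤ N, typeOf (modelTheta r N e γ m) = θ) :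
    IsModel ϖ (headRep hV θ) N e γ (headBasis R E ϖ θ N e γ) := by
  have hγ := ofDigits_digit γ
  have hγlt := digit_lt γ
  -- in the expansions in powers of `D` only the term of index zero survives
  have hzero : ∀ {m : ZMod f → ℕ} (_ : m ≤ N) {l : ZMod f → ℕ} (_ : l ∈ box γ.digit) (_ : l ≠ 0)
      {a b : NTilde p f}, ofExp r a b (ofDigits (γ.digit - l)) ≤ modelTheta r N e γ m →
      a + b = sub r (2 • ofDigits (γ.digit - l)) →
      digitSum a + digitSum b ≤ digitSum (ofDigits (m + e) : NTilde p f) +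
        digitSum (ofDigits (N - m + e) : NTilde p f) + 2 * ∑ i, l i →
      headMk R E ϖ θ (ofExp r a b (ofDigits (γ.digit - l))) = 0 := by
    intro m hm l hl hl0 a b hle hab hds
    refine headMk_eq_zero ?_
    rw [← hθ m hm]
    refine typeOf_lt_of_le hr hle ?_
    -- The `γ` part of the rank falls by `3 ∑ l_i`, and the rest gains at most `2 ∑ l_i`.
    rw [rank_ofExp hab, modelTheta, rank_ofExp (modelTheta_sum hs hm)]
    have h1 := digitSum_sub_add hγlt hl
    have h2 := sum_pos_of_ne_zero hl0
    rw [hγ] at h1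
    omega
  have hdl : ∀ l : ZMod f → ℕ, digitSum (ofDigits l : NTilde p f) ≤ ∑ i, l i :=
    digitSum_ofDigits_le
  have hmem0 : (0 : ZMod f → ℕ) ∈ box γ.digit := mem_box.2 fun i => Nat.zero_le _
  refine ⟨linearIndependent_headBasis h hq hr hNe hs hθ, ?_, fun t m hm => ?_, fun t m hm => ?_,
    fun s t m hm => ?_, fun m hm => ?_⟩
  · refine span_headMk.trans (Submodule.span_le.2 ?_)
    rintro _ ⟨x, hx, rfl⟩
    have hx' := (typeOf_modelTheta hr hNe hs (le_refl N) x).1 ((hθ N le_rfl).trans hx.symm)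
    obtain ⟨m, hm, rfl⟩ := exists_modelTheta hr he hx'.1 hx'.2
    refine (Submodule.smul_mem_iff _ ?_).1 (Submodule.subset_span ⟨⟨m, hm⟩, rfl⟩)
    rw [Ne, map_eq_zero_iff _ (algebraMap (ResidueField R) E).injective]
    exact modelScalar_ne_zero _ hNe
  · have hsum := modelTheta_sum hs hm
    obtain ⟨hl1, hl2⟩ := modelTheta_lt hNe hm
    have hle : ∀ l ∈ box (N - m + e), ofExp r (ofDigits (m + e) + ofDigits l)
        (ofDigits (N - m + e - l)) γ ≤ modelTheta r N e γ m := by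
      intro l hl
      have e1 := sub_add_of_mem_box hl
      have := ofExp_add_le (a := ofDigits (m + e)) (r := r) (γ := γ) l (v := N - m + e - l)
        (by rwa [e1]) (by rwa [e1])
      rwa [e1] at this
    rw [headBasis, map_smul, headRep_headMk hV (hθ m hm).le hle (act_unip h hq hr hsum t),
      Finset.smul_sum]
    symm
    have hsub : box (N - m) ⊆ box (N - m + e) := fun l hl =>
      mem_box.2 ((mem_box.1 hl).trans le_self_add)
    refine Finset.sum_subset_zero_on_sdiff hsub (fun l hl => ?_) fun l hl => ?_
    · obtain ⟨hl, hl'⟩ := Finset.mem_sdiff.1 hl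
      rw [headMk_eq_zero, smul_zero, smul_zero]
      rw [← hθ m hm]
      refine typeOf_lt_of_le hr (hle l hl) ?_
      rw [rank_ofExp (add_ofDigits_sub hl hsum), modelTheta, rank_ofExp hsum, ← map_add]
      have h1 := digitSum_sub_add hl2 hl
      rw [mem_box] at hl'
      obtain ⟨i, hi⟩ := not_forall.1 (show ¬ ∀ i, l i ≤ (N - m) i from hl')
      -- From `N_i - m_i < l_i ≤ N_i - m_i + e_i` it follows that `e_i > 0`, so `N_i + e_i = p - 1`
      -- and column `i` of the first exponent overflows. The rank then drops.
      have h2 : p ≤ (m + e + l) i := by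
        have h3 : l i ≤ (N - m + e) i := mem_box.1 hl i
        have h4 := he i
        have h5 : m i ≤ N i := hm i
        simp only [Pi.add_apply, Pi.sub_apply] at *
        omega
      have h3 := digitSum_ofDigits_lt h2
      rw [digitSum_ofDigits hl1]
      simp only [Pi.add_apply, Finset.sum_add_distrib] at h3 ⊢
      omega
    · have hl' := mem_box.1 hl
      have hml : m + l ≤ N := by
        intro i
        have h1 : l i ≤ (N - m) i := hl' i
        have h2 : m i ≤ N i := hm i
        simp only [Pi.add_apply, Pi.sub_apply] at *
        omega
      have e1 : ofExp r (ofDigits (m + e) + ofDigits l) (ofDigits (N - m + e - l)) γ =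
          modelTheta r N e γ (m + l) := by
        rw [modelTheta, ← map_add]
        congr 2
        · abel
        · ext i
          have h1 : l i ≤ (N - m) i := hl' i
          simp only [Pi.add_apply, Pi.sub_apply] at *
          omega
      rw [e1, headBasis, smul_smul, smul_smul, ← map_mul, ← map_mul]
      congr 2
      have e2 : modelScalar (ResidueField R) N e m *
          ∏ i, (((N - m + e) i).choose (l i) : ResidueField R) =
          (∏ i, (((N - m) i).choose (l i) : ResidueField R)) *
            modelScalar (ResidueField R) N e (m + l) := by
        rw [modelScalar, modelScalar, ← Finset.prod_mul_distrib, ← Finset.prod_mul_distrib]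
        refine Finset.prod_congr rfl fun i _ => ?_
        have h1 := choose_ratio (k := ResidueField R) (p := p) (hl' i) (hl2 i)
        have h2 : (N - (m + l)) i = (N - m) i - l i := by
          simp only [Pi.add_apply, Pi.sub_apply]; omega
        rw [Pi.add_apply, Pi.add_apply, h2]
        exact h1
      linear_combination (-pw (ofDigits l : NTilde p f) t) * e2
  · have hsum := modelTheta_sum hs hm
    have hsum' := hsum
    rw [← hγ] at hsum'
    have hact := act_unip_eps (E := E) h hq hr hsum' t
    have hle : ∀ l ∈ box γ.digit, ofExp r (ofDigits (m + e) + 2 • ofDigits l)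
        (ofDigits (N - m + e)) (ofDigits (γ.digit - l)) ≤ modelTheta r N e γ m := by
      intro l hl
      have e1 := sub_add_of_mem_box hl
      have := ofExp_sq_add_le (a := ofDigits (m + e)) (b := ofDigits (N - m + e)) hr l
        (v := γ.digit - l) (by rwa [e1]) (by rwa [e1])
      rwa [e1, hγ] at this
    rw [hγ] at hact
    rw [headBasis, map_smul, headRep_headMk hV (hθ m hm).le hle hact,
      Finset.sum_eq_single_of_mem 0 hmem0]
    · rw [map_zero, smul_zero, add_zero, tsub_zero, hγ, modelTheta, pw_zero]
      simp
    · intro l hl hl0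
      rw [hzero hm hl hl0 (hle l hl), smul_zero]
      · rw [← sub_two_nsmul_of_mem_box hr hl hsum']; abel
      · have h1 := digitSum_add_le (ofDigits (m + e) : NTilde p f) (2 • ofDigits l)
        have h2 := digitSum_add_le (ofDigits l : NTilde p f) (ofDigits l)
        have h3 := hdl l
        rw [← two_smul ℕ] at h2
        omega
  · have hsum := modelTheta_sum hs hm
    have hsum' := hsum
    rw [← hγ] at hsum'
    have hact := act_diag (E := E) h hq hr hsum' s t
    have hle : ∀ l ∈ box γ.digit, ofExp r (ofDigits (m + e) + ofDigits l)
        (ofDigits (N - m + e) + ofDigits l) (ofDigits (γ.digit - l)) ≤ modelTheta r N e γ m := by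
      intro l hl
      have e1 := sub_add_of_mem_box hl
      have := ofExp_cross_add_le (a := ofDigits (m + e)) (b := ofDigits (N - m + e)) hr l
        (v := γ.digit - l) (by rwa [e1]) (by rwa [e1])
      rwa [e1, hγ] at this
    rw [hγ] at hact
    rw [headBasis, map_smul, headRep_headMk hV (hθ m hm).le hle hact,
      Finset.sum_eq_single_of_mem 0 hmem0]
    · rw [map_zero, add_zero, add_zero, tsub_zero, hγ, modelTheta, pw_zero, smul_comm]
      simp
    · intro l hl hl0
      rw [hzero hm hl hl0 (hle l hl), smul_zero]
      · rw [← sub_two_nsmul_of_mem_box hr hl hsum', two_smul]; abel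
      · have h1 := digitSum_add_le (ofDigits (m + e) : NTilde p f) (ofDigits l)
        have h2 := digitSum_add_le (ofDigits (N - m + e) : NTilde p f) (ofDigits l)
        have h3 := hdl l
        omega
  · have hsum := modelTheta_sum hs hm
    have hact := act_swap (E := E) h hq hr hsum
    have hact' := headRep_headMk (θ := θ) hV (s := {()}) (hθ m hm).le
      (fun _ _ => ofExp_swap_le hr hsum) (c := fun _ => _) (by rw [Finset.sum_singleton]; exact hact)
    rw [Finset.sum_singleton] at hact'
    have e1 : N - (N - m) = m := tsub_tsub_cancel_of_le hm
    rw [headBasis, map_smul]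
    rw [hact', headBasis, modelTheta, e1, smul_smul, smul_smul, ← map_mul, ← map_mul]
    congr 2
    -- The scalars attached to `m` and to `N - m` differ columnwise by `(-1)^{e_i}`. This is the
    -- sign of the factors `det^{e_i}` at the swap, where `(-1)^{p^i} = -1` in characteristic `p`.
    have e2 : modelScalar (ResidueField R) N e m =
        pw (ofDigits e : NTilde p f) (-1) * modelScalar (ResidueField R) N e (N - m) := by
      rw [modelScalar, modelScalar, pw_ofDigits hq, ← Finset.prod_mul_distrib, e1]
      refine Finset.prod_congr rfl fun i _ => ?_
      have h2 : m i ≤ N i := hm i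
      have h1 := factorial_ratio (k := ResidueField R) (p := p) (i := m i) (j := (N - m) i)
        (e := e i) (by
          have := he i
          simp only [Pi.sub_apply]; omega)
      have h3 : ((-1 : ResidueField R) ^ p ^ i.val) = -1 := by
        rw [neg_one_pow_char_pow]
      have n1 := factorial_ne_zero_of_lt (k := ResidueField R) (p := p) ((modelTheta_lt hNe hm).1 i)
      have n2 := factorial_ne_zero_of_lt (k := ResidueField R) (p := p) ((modelTheta_lt hNe hm).2 i)
      rw [h3, ← mul_div_assoc, div_eq_div_iff n2 n1]
      simp only [Pi.add_apply] at h1 ⊢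
      rw [h1]; ring
    rw [e2]; ring

end HeadModel

end PrincipalSeries

end

noncomputable section

namespace PrincipalSeries

open NTilde Theta

/-! ### Symmetric powers -/

section Sym

variable (E : Type*) [Field E]

/-- The monomial `X₀ ^ m * X₁ ^ (t - m)`, for `m ≤ t`. -/
def symMon (t m : ℕ) : MvPolynomial.homogeneousSubmodule (Fin 2) E t :=
  ⟨if m ≤ t then MvPolynomial.X 0 ^ m * MvPolynomial.X 1 ^ (t - m) else 0, by
    split_ifs with h
    · have := ((MvPolynomial.isHomogeneous_X E (0 : Fin 2)).pow m).mul
        ((MvPolynomial.isHomogeneous_X E (1 : Fin 2)).pow (t - m))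
      rwa [one_mul, one_mul, Nat.add_sub_cancel' h] at this
    · exact Submodule.zero_mem _⟩

variable {E}

theorem coe_symMon {t m : ℕ} (h : m ≤ t) : (symMon E t m : MvPolynomial (Fin 2) E) =
    MvPolynomial.X 0 ^ m * MvPolynomial.X 1 ^ (t - m) := if_pos h

theorem coe_symMon_eq_monomial {t m : ℕ} (h : m ≤ t) : (symMon E t m : MvPolynomial (Fin 2) E) =
    MvPolynomial.monomial (Finsupp.single 0 m + Finsupp.single 1 (t - m)) 1 := by
  rw [coe_symMon h, MvPolynomial.X_pow_eq_monomial, MvPolynomial.X_pow_eq_monomial,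
    MvPolynomial.monomial_mul, one_mul]

theorem linearIndependent_symMon (t : ℕ) :
    LinearIndependent E fun m : Fin (t + 1) => symMon E t m := by
  refine .of_comp (Submodule.subtype _) ?_
  have hinj : Function.Injective fun m : Fin (t + 1) =>
      (Finsupp.single 0 (m : ℕ) + Finsupp.single 1 (t - m) : Fin 2 →₀ ℕ) := by
    intro m m' h
    have := DFunLike.congr_fun h 0
    simpa [Fin.ext_iff] using this
  refine linearIndependent_of_eq
    ((MvPolynomial.basisMonomials (Fin 2) E).linearIndependent.comp _ hinj) ?_
  funext m
  rw [Function.comp_apply, Function.comp_apply, MvPolynomial.coe_basisMonomials]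
  exact coe_symMon_eq_monomial (Nat.lt_succ_iff.1 m.2)

theorem span_symMon (t : ℕ) :
    ⊤ ≤ Submodule.span E (Set.range fun m : Fin (t + 1) => symMon E t m) := by
  rintro ⟨P, hP⟩ -
  have key : (⟨P, hP⟩ : MvPolynomial.homogeneousSubmodule (Fin 2) E t) = ∑ m : Fin (t + 1),
      P.coeff (Finsupp.single 0 (m : ℕ) + Finsupp.single 1 (t - m)) • symMon E t m := by
    refine Subtype.ext ?_
    rw [Submodule.coe_sum]
    simp only [Submodule.coe_smul]
    have h1 : ∀ m : Fin (t + 1), (symMon E t m : MvPolynomial (Fin 2) E) =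
      MvPolynomial.monomial (Finsupp.single 0 (m : ℕ) + Finsupp.single 1 (t - m)) 1 :=
      fun m => coe_symMon_eq_monomial (Nat.lt_succ_iff.1 m.2)
    simp only [h1]
    refine MvPolynomial.ext _ _ fun d => ?_
    rw [MvPolynomial.coeff_sum]
    simp only [MvPolynomial.coeff_smul, MvPolynomial.coeff_monomial, smul_eq_mul, mul_ite, mul_one,
      mul_zero]
    by_cases hd : d 0 + d 1 = t
    · rw [Finset.sum_eq_single ⟨d 0, by omega⟩]
      · have : (Finsupp.single 0 (d 0) + Finsupp.single 1 (t - d 0) : Fin 2 →₀ ℕ) = d := by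
          ext i
          fin_cases i
          · simp
          · simp; omega
        rw [if_pos this]
        exact congrArg P.coeff this.symm
      · intro m _ hm
        refine if_neg fun h => hm (Fin.ext ?_)
        have := DFunLike.congr_fun h 0
        simpa using this
      · simp
    · have h0 : P.coeff d = 0 := by
        by_contra hne
        refine hd ?_
        have := hP hne
        rw [Finsupp.weight_apply, Finsupp.sum_fintype _ _ (by simp)] at this
        simpa [Fin.sum_univ_two] using this
      rw [h0]
      symm
      refine Finset.sum_eq_zero fun m _ => if_neg fun h => hd ?_
      rw [← h]
      have := m.2
      simp
      omega
  rw [key]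
  exact Submodule.sum_mem _ fun m _ => Submodule.smul_mem _ _ (Submodule.subset_span ⟨m, rfl⟩)

/-- The basis of monomials of a symmetric power. -/
def symBasis (t : ℕ) :
    Module.Basis (Fin (t + 1)) E (MvPolynomial.homogeneousSubmodule (Fin 2) E t) :=
  Module.Basis.mk (linearIndependent_symMon t) (span_symMon t)

theorem symBasis_apply (t : ℕ) (m : Fin (t + 1)) : symBasis t m = symMon E t m :=
  Module.Basis.mk_apply _ _ _

theorem coe_symRep (t : ℕ) (g : Matrix (Fin 2) (Fin 2) E)
    (P : MvPolynomial.homogeneousSubmodule (Fin 2) E t) :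
    (symRep E t g P : MvPolynomial (Fin 2) E) = subst g P.1 := rfl

theorem subst_X (g : Matrix (Fin 2) (Fin 2) E) (j : Fin 2) : subst g (MvPolynomial.X j) =
    MvPolynomial.C (g 0 j) * MvPolynomial.X 0 + MvPolynomial.C (g 1 j) * MvPolynomial.X 1 := by
  rw [subst, MvPolynomial.aeval_X, Fin.sum_univ_two]

theorem symRep_unip {t m : ℕ} (hm : m ≤ t) (x : E) : symRep E t !![1, x; 0, 1] (symMon E t m) =
    ∑ l ∈ Finset.range (t - m + 1), (((t - m).choose l : E) * x ^ l) • symMon E t (m + l) := by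
  refine Subtype.ext ?_
  rw [coe_symRep, Submodule.coe_sum, coe_symMon hm, map_mul, map_pow, map_pow, subst_X, subst_X]
  simp only [Matrix.of_apply, Matrix.cons_val', Matrix.cons_val_zero, Matrix.cons_val_one,
    Matrix.cons_val_fin_one, map_one, map_zero, one_mul, zero_mul, add_zero]
  rw [add_pow, Finset.mul_sum]
  refine Finset.sum_congr rfl fun l hl => ?_
  have hl := Finset.mem_range.1 hl
  rw [Submodule.coe_smul, coe_symMon (show m + l ≤ t by omega), MvPolynomial.smul_eq_C_mul,
    map_mul, map_pow, map_natCast, Nat.sub_add_eq, pow_add]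
  ring

theorem symRep_diag {t m : ℕ} (hm : m ≤ t) (x y : E) :
    symRep E t !![x, 0; 0, y] (symMon E t m) = (x ^ m * y ^ (t - m)) • symMon E t m := by
  refine Subtype.ext ?_
  rw [coe_symRep, Submodule.coe_smul, coe_symMon hm, map_mul, map_pow, map_pow, subst_X, subst_X]
  simp only [Matrix.of_apply, Matrix.cons_val', Matrix.cons_val_zero, Matrix.cons_val_one,
    Matrix.cons_val_fin_one, map_zero, zero_mul, add_zero, zero_add]
  rw [MvPolynomial.smul_eq_C_mul, map_mul, map_pow, map_pow]
  ring

theorem symRep_swap {t m : ℕ} (hm : m ≤ t) :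
    symRep E t !![0, 1; 1, 0] (symMon E t m) = symMon E t (t - m) := by
  refine Subtype.ext ?_
  rw [coe_symRep, coe_symMon hm, coe_symMon (Nat.sub_le t m), map_mul, map_pow, map_pow, subst_X,
    subst_X]
  simp only [Matrix.of_apply, Matrix.cons_val', Matrix.cons_val_zero, Matrix.cons_val_one,
    Matrix.cons_val_fin_one, map_zero, zero_mul, add_zero, zero_add, map_one, one_mul]
  rw [Nat.sub_sub_self hm, mul_comm]

end Sym

/-! ### Serre weights -/

section Serre

variable {k : Type*} [Field k] (E : Type*) [Field E] [Algebra k E] (p f : ℕ)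

/-- The monomial basis of the space of a Serre weight. -/
def serreMon (n : ℕ) (m : Fin f → ℕ) : SerreSpace E p f n :=
  PiTensorProduct.tprod E fun i : Fin f => symMon E (n / p ^ (i : ℕ) % p) (m i)

variable {E p f}

/-- The tensor products of monomial bases, reindexed by the functions `m ≤ N` that `IsModel` uses.
-/
theorem serreMon_basis (n : ℕ) (N : Fin f → ℕ) (hN : ∀ i, N i = n / p ^ (i : ℕ) % p) :
    LinearIndependent E (fun m : Set.Iic N => serreMon E p f n m) ∧
      ⊤ ≤ Submodule.span E (Set.range fun m : Set.Iic N => serreMon E p f n m) := by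
  set B := Basis.piTensorProduct fun i : Fin f => symBasis (E := E) (n / p ^ (i : ℕ) % p) with hB
  have hBapp : ∀ m, B m = serreMon E p f n fun i => m i := by
    intro m
    rw [hB, Basis.piTensorProduct_apply]
    simp only [symBasis_apply]
    rfl
  have hlt : ∀ m : Set.Iic N, ∀ i, m.1 i < n / p ^ (i : ℕ) % p + 1 := by
    intro m i
    have : m.1 i ≤ N i := m.2 i
    rw [hN] at this
    omega
  let φ : Set.Iic N → (i : Fin f) → Fin (n / p ^ (i : ℕ) % p + 1) := fun m i => ⟨m.1 i, hlt m i⟩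
  have hφ : Function.Injective φ := by
    intro m m' h
    refine Subtype.ext (funext fun i => ?_)
    exact congrArg Fin.val (congrFun h i)
  constructor
  · refine linearIndependent_of_eq (B.linearIndependent.comp φ hφ) ?_
    funext m
    rw [Function.comp_apply, hBapp]
  · rw [← B.span_eq, Submodule.span_le]
    rintro _ ⟨m, rfl⟩
    refine Submodule.subset_span ⟨⟨fun i => m i, fun i => ?_⟩, (hBapp m).symm⟩
    have := (m i).2
    have h2 := hN i
    change (m i : ℕ) ≤ N i
    omega

variable [Fact p.Prime] [CharP k p] (a₁ a₂ : ℤ) (N : Fin f → ℕ)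
  (hN : ∀ i : Fin f, N i = (a₁ - a₂).toNat / p ^ (i : ℕ) % p)

theorem serreWeight_serreMon (g : Matrix.GeneralLinearGroup (Fin 2) k) (m : Fin f → ℕ) :
    serreWeight k E p f a₁ a₂ g (serreMon E p f (a₁ - a₂).toNat m) =
      algebraMap k E ((Matrix.GeneralLinearGroup.det g ^ a₂ : kˣ) : k) •
        PiTensorProduct.tprod E fun i : Fin f => symRep E _
          ((g : Matrix (Fin 2) (Fin 2) k).map fun x => algebraMap k E (x ^ p ^ (i : ℕ)))
          (symMon E ((a₁ - a₂).toNat / p ^ (i : ℕ) % p) (m i)) := by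
  exact congrArg (algebraMap k E ((Matrix.GeneralLinearGroup.det g ^ a₂ : kˣ) : k) • ·)
    (PiTensorProduct.map_tprod (fun i : Fin f => symRep E _
      ((g : Matrix (Fin 2) (Fin 2) k).map fun x => algebraMap k E (x ^ p ^ (i : ℕ)))) _)

theorem det_unipMat {A : Type*} [CommRing A] (x : A) :
    Matrix.GeneralLinearGroup.det (unipMat x) = 1 := by
  refine Units.ext ?_
  rw [Matrix.GeneralLinearGroup.val_det_apply, coe_unipMat, Matrix.det_fin_two]
  simp

theorem det_diagMat {A : Type*} [CommRing A] (s t : Aˣ) :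
    Matrix.GeneralLinearGroup.det (diagMat s t) = s * t := by
  refine Units.ext ?_
  rw [Matrix.GeneralLinearGroup.val_det_apply, coe_diagMat, Matrix.det_fin_two]
  simp

theorem det_swapMat {A : Type*} [CommRing A] :
    Matrix.GeneralLinearGroup.det (swapMat : Matrix.GeneralLinearGroup (Fin 2) A) = -1 := by
  refine Units.ext ?_
  rw [Matrix.GeneralLinearGroup.val_det_apply, coe_swapMat, Matrix.det_fin_two]
  simp

theorem map_of_two {A B : Type*} (φ : A → B) (a b c d : A) :
    (!![a, b; c, d]).map φ = !![φ a, φ b; φ c, φ d] := by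
  ext i j; fin_cases i <;> fin_cases j <;> rfl

include hN

theorem serreWeight_unip (t : k) {m : Fin f → ℕ} (hm : m ≤ N) :
    serreWeight k E p f a₁ a₂ (unipMat t) (serreMon E p f (a₁ - a₂).toNat m) =
      ∑ l ∈ Fintype.piFinset fun i => Finset.range (N i - m i + 1), algebraMap k E
        ((∏ i : Fin f, (((N i - m i).choose (l i) : ℕ) : k)) * ∏ i : Fin f, (t ^ p ^ (i : ℕ)) ^ l i) •
          serreMon E p f (a₁ - a₂).toNat (m + l) := by
  have h0 := (Fact.out : p.Prime).ne_zero
  have h1 : ∀ i : Fin f, symRep E _ ((unipMat t : Matrix (Fin 2) (Fin 2) k).map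
      fun x => algebraMap k E (x ^ p ^ (i : ℕ)))
      (symMon E ((a₁ - a₂).toNat / p ^ (i : ℕ) % p) (m i)) =
      ∑ l ∈ Finset.range (N i - m i + 1), (((N i - m i).choose l : E) *
        algebraMap k E (t ^ p ^ (i : ℕ)) ^ l) •
          symMon E ((a₁ - a₂).toNat / p ^ (i : ℕ) % p) (m i + l) := by
    intro i
    rw [coe_unipMat, map_of_two, one_pow, zero_pow (pow_ne_zero _ h0), map_one, map_zero,
      symRep_unip (by rw [← hN]; exact hm i), ← hN]
  rw [serreWeight_serreMon, det_unipMat, one_zpow, Units.val_one, map_one, one_smul]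
  simp only [h1]
  rw [MultilinearMap.map_sum_finset]
  refine Finset.sum_congr rfl fun l _ => ?_
  rw [MultilinearMap.map_smul_univ, Finset.prod_mul_distrib, map_mul, map_prod, map_prod]
  simp only [map_natCast, map_pow]
  rfl

theorem serreWeight_diag (s t : kˣ) {m : Fin f → ℕ} (hm : m ≤ N) :
    serreWeight k E p f a₁ a₂ (diagMat s t) (serreMon E p f (a₁ - a₂).toNat m) =
      algebraMap k E (((s * t) ^ a₂ : kˣ) * ((∏ i : Fin f, ((s : k) ^ p ^ (i : ℕ)) ^ m i) *
        ∏ i : Fin f, ((t : k) ^ p ^ (i : ℕ)) ^ (N i - m i))) • serreMon E p f (a₁ - a₂).toNat m := by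
  have h0 := (Fact.out : p.Prime).ne_zero
  have h1 : ∀ i : Fin f, symRep E _ ((diagMat s t : Matrix (Fin 2) (Fin 2) k).map
      fun x => algebraMap k E (x ^ p ^ (i : ℕ)))
      (symMon E ((a₁ - a₂).toNat / p ^ (i : ℕ) % p) (m i)) =
      (algebraMap k E (s ^ p ^ (i : ℕ)) ^ m i * algebraMap k E (t ^ p ^ (i : ℕ)) ^ (N i - m i)) •
          symMon E ((a₁ - a₂).toNat / p ^ (i : ℕ) % p) (m i) := by
    intro i
    rw [coe_diagMat, map_of_two, zero_pow (pow_ne_zero _ h0), map_zero,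
      symRep_diag (by rw [← hN]; exact hm i), ← hN]
  rw [serreWeight_serreMon, det_diagMat]
  simp only [h1]
  rw [MultilinearMap.map_smul_univ, Finset.prod_mul_distrib, smul_smul]
  simp only [map_mul, map_prod, map_pow]
  rfl

theorem serreWeight_swap {m : Fin f → ℕ} (hm : m ≤ N) :
    serreWeight k E p f a₁ a₂ swapMat (serreMon E p f (a₁ - a₂).toNat m) =
      algebraMap k E (((-1) ^ a₂ : kˣ) : k) • serreMon E p f (a₁ - a₂).toNat (N - m) := by
  have h0 := (Fact.out : p.Prime).ne_zero
  have h1 : ∀ i : Fin f, symRep E _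
      (((swapMat : Matrix.GeneralLinearGroup (Fin 2) k) : Matrix (Fin 2) (Fin 2) k).map
      fun x => algebraMap k E (x ^ p ^ (i : ℕ)))
      (symMon E ((a₁ - a₂).toNat / p ^ (i : ℕ) % p) (m i)) =
          symMon E ((a₁ - a₂).toNat / p ^ (i : ℕ) % p) (N i - m i) := by
    intro i
    rw [coe_swapMat, map_of_two, one_pow, zero_pow (pow_ne_zero _ h0), map_one, map_zero,
      symRep_swap (by rw [← hN]; exact hm i), ← hN]
  rw [serreWeight_serreMon, det_swapMat]
  simp only [h1]
  rfl

end Serre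

/-! ### Twisted and inflated Serre weights -/

section Inflate

variable {R : Type*} [CommRing R] [IsLocalRing R] [Finite (ResidueField R)] {E : Type*} [Field E]
  [Algebra (ResidueField R) E] {p n : ℕ} [Fact p.Prime] [CharP (ResidueField R) p]

theorem map_unipMat {A B : Type*} [CommRing A] [CommRing B] (φ : A →+* B) (x : A) :
    Matrix.GeneralLinearGroup.map φ (unipMat x) = unipMat (φ x) := by
  refine Units.ext ?_
  ext i j; fin_cases i <;> fin_cases j <;> simp [coe_unipMat]

theorem map_diagMat {A B : Type*} [CommRing A] [CommRing B] (φ : A →+* B) (s t : Aˣ) :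
    Matrix.GeneralLinearGroup.map φ (diagMat s t) =
      diagMat (Units.map (φ : A →* B) s) (Units.map (φ : A →* B) t) := by
  refine Units.ext ?_
  ext i j; fin_cases i <;> fin_cases j <;> simp [coe_diagMat]

theorem map_swapMat {A B : Type*} [CommRing A] [CommRing B] (φ : A →+* B) :
    Matrix.GeneralLinearGroup.map φ swapMat = swapMat := by
  refine Units.ext ?_
  ext i j; fin_cases i <;> fin_cases j <;> simp [coe_swapMat]

theorem inflate_detTwist_apply {f : ℕ} {W : Type*} [AddCommMonoid W] [Module E W] (γ : NTilde p f)
    (σ : Representation E (Matrix.GeneralLinearGroup (Fin 2) (ResidueField R)) W) (g : G₂ R)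
    (v : W) : inflate R (detTwist γ σ) g v = algebraMap (ResidueField R) E
      (pw γ ((Matrix.GeneralLinearGroup.det (Matrix.GeneralLinearGroup.map (red R) g) :
        (ResidueField R)ˣ) : ResidueField R)) •
        σ (Matrix.GeneralLinearGroup.map (red R) g) v := by
  rw [pw, map_pow]
  rfl

/-- The outer power `det^s` with `s = ∑ e_i p^i` is the product of the Frobenius twists of
`det^{e_i}`, which is how the model records it. Writing `f` as `n + 1` makes `ZMod f` and `Fin f`
definitionally equal. -/
theorem isModel_serreWeight {ϖ : R} (h : IsDualNumbers ϖ)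
    (hq : Nat.card (ResidueField R) = p ^ (n + 1)) (γ : NTilde p (n + 1))
    {N e : ZMod (n + 1) → ℕ} (a₁ : ℤ) (s : ℕ) (hs : s = ∑ i : ZMod (n + 1), e i * p ^ i.val)
    (hN : ∀ i : ZMod (n + 1), N i = (a₁ - s).toNat / p ^ i.val % p) :
    IsModel ϖ (inflate R (detTwist γ (serreWeight (ResidueField R) E p (n + 1) a₁ s))) N e γ
      (serreMon E p (n + 1) (a₁ - s).toNat) := by
  obtain ⟨h1, h2⟩ := serreMon_basis (E := E) (p := p) (f := n + 1) (a₁ - s).toNat N hN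
  have hpw : ∀ (l : ZMod (n + 1) → ℕ) (x : ResidueField R), pw (ofDigits l : NTilde p (n + 1)) x =
      ∏ i : Fin (n + 1), (x ^ p ^ (i : ℕ)) ^ (l i) := fun l x => pw_ofDigits hq l x
  have hpe : ∀ x : ResidueField R, pw (ofDigits e : NTilde p (n + 1)) x = x ^ s := fun x => by
    rw [ofDigits_apply, ← hs, pw_mk hq]
  refine ⟨h1, h2, fun t m hm => ?_, fun t m hm => ?_, fun u t m hm => ?_, fun m hm => ?_⟩
  · rw [inflate_detTwist_apply, map_unipMat, h.red_teich, det_unipMat, Units.val_one, pw_one,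
      map_one, one_smul]
    simp only [hpw]
    exact serreWeight_unip a₁ s N hN t hm
  · have h3 : (unipMat 0 : Matrix.GeneralLinearGroup (Fin 2) (ResidueField R)) = 1 := by
      refine Units.ext ?_
      rw [coe_unipMat, Units.val_one, Matrix.one_fin_two]
    rw [inflate_detTwist_apply, map_unipMat, map_mul, h.red_eps, mul_zero, h3, map_one, map_one,
      Units.val_one, pw_one, map_one, one_smul]
    rfl
  · rw [inflate_detTwist_apply, map_diagMat, det_diagMat]
    have h3 := serreWeight_diag (E := E) a₁ s N hN (Units.map (red R : R₂ R →* ResidueField R) u)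
      (Units.map (red R : R₂ R →* ResidueField R) t) hm
    rw [h3, smul_smul, ← map_mul]
    congr 2
    have h4 : ∀ x : ResidueField R, pw (ofDigits (N - m) : NTilde p (n + 1)) x =
      ∏ i : Fin (n + 1), (x ^ p ^ (i : ℕ)) ^ (N i - m i) := hpw (N - m)
    rw [map_add, map_add, pw_add hq, pw_add hq, hpe, hpe, hpw, h4, zpow_natCast]
    simp only [Units.val_mul, Units.val_pow_eq_pow_val, Units.coe_map, MonoidHom.coe_coe]
    ring
  · rw [inflate_detTwist_apply, map_swapMat, det_swapMat]
    have h3 := serreWeight_swap (E := E) (k := ResidueField R) a₁ s N hN hm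
    rw [h3, smul_smul, ← map_mul, hpe, zpow_natCast]
    simp only [Units.val_neg, Units.val_one, Units.val_pow_eq_pow_val]
    rfl

end Inflate

end PrincipalSeries

end

noncomputable section

namespace PrincipalSeries

open NTilde Theta

/-! ### The digits attached to a carry set -/

section Digits

variable {p f : ℕ} [hp : Fact p.Prime] [NeZero f]

/-- The excess of the column sums of `a` and `b` over `p - 1`. -/
def excess (a b : NTilde p f) (i : ZMod f) : ℕ := a.digit i + b.digit i - (p - 1)

/-- The column sums of `a` and `b`, reflected in `p - 1` where they exceed it, minus the excess. -/
def defect (a b : NTilde p f) (i : ZMod f) : ℕ := a.digit i + b.digit i - 2 * excess a b i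

variable {a b : NTilde p f}

theorem excess_defect (a b : NTilde p f) (i : ZMod f) :
    defect a b i + 2 * excess a b i = a.digit i + b.digit i ∧ defect a b i + excess a b i < p ∧
      (excess a b i = 0 ∨ defect a b i + excess a b i + 1 = p) := by
  have h1 := digit_lt a i
  have h2 := digit_lt b i
  rw [defect, excess]
  omega

theorem defect_add_two_nsmul (a b : NTilde p f) :
    defect a b + 2 • excess a b = a.digit + b.digit := by
  funext i
  exact (excess_defect a b i).1

theorem ofDigits_defect (a b : NTilde p f) :
    (ofDigits (defect a b + 2 • excess a b) : NTilde p f) = a + b := by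
  rw [defect_add_two_nsmul, map_add, ofDigits_digit, ofDigits_digit]

/-- By `digit_add_digit`, a carrying column has sum `ρ_i + p` without an incoming carry and `ρ_i + p
- 1` with one, where `ρ = a + b`. Its excess over `p - 1` is thus `ρ_i + 1` or `ρ_i`. A column that
does not carry has no excess. -/
theorem sJ_carrySet (h0 : a + b ≠ 0) :
    sJ (carrySet a b) (a + b) = ∑ i, excess a b i * p ^ i.val := by
  classical
  refine Finset.sum_congr rfl fun i _ => congrArg (· * _) ?_
  have h1 := digit_add_digit h0 i
  have h2 := (isCarrySet_carrySet a b).out_out i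
  have h3 := (isCarrySet_carrySet a b).in_out i
  have h4 := hp.out.two_le
  rw [excess]
  by_cases hi : i ∈ carrySet a b <;> by_cases hi' : i - 1 ∈ carrySet a b <;>
    simp only [hi, hi', not_true_eq_false, not_false_eq_true, forall_const, IsEmpty.forall_iff,
      if_true, if_false] at h1 h2 h3 ⊢ <;> omega

theorem carrySet_eq_empty (h : ∀ i, excess a b i = 0) : carrySet a b = ∅ := by
  refine Set.eq_empty_of_forall_notMem fun i hi => ?_
  have hlt : ∀ i, a.digit i + b.digit i < p := fun i => by
    have h1 := h i
    have h2 := hp.out.two_le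
    rw [excess] at h1
    omega
  induction hi with
  | start i h' => exact absurd (hlt i) (by omega)
  | step i _ _ ih => exact ih

/-- With `M` and `S` the integers whose columns are `defect` and `excess`, the total `M + 2S`
represents `a + b`, so `M ≡ ρ - 2S` modulo `q - 1` for `ρ = a + b`. It remains to see that `M` lies
in the prescribed range. For an empty carry set `S = 0`, and `M < q` is the least representative, `q
- 1` being allowed. -/
theorem toNat_aJ_sub_sJ (h0 : a + b ≠ 0) :
    (aJ (carrySet a b) (a + b) - sJ (carrySet a b) (a + b)).toNat =
      ∑ i, defect a b i * p ^ i.val := by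
  have hs := sJ_carrySet h0
  have hT : ∑ i, defect a b i * p ^ i.val + 2 * ∑ i, excess a b i * p ^ i.val =
      ∑ i, (a.digit + b.digit) i * p ^ i.val := by
    rw [Finset.mul_sum, ← Finset.sum_add_distrib, ← defect_add_two_nsmul]
    refine Finset.sum_congr rfl fun i _ => ?_
    simp only [Pi.add_apply, Pi.smul_apply, smul_eq_mul]
    ring
  have hT' : (mk (∑ i, (a.digit + b.digit) i * p ^ i.val) : NTilde p f) = a + b := by
    rw [← ofDigits_apply, map_add, ofDigits_digit, ofDigits_digit]
  have hq : 2 ≤ p ^ f := two_le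
  have hlt := sum_lt_pow (fun i => defect a b i + excess a b i) fun i => (excess_defect a b i).2.1
  simp only [add_mul, Finset.sum_add_distrib] at hlt
  rw [aJ]
  split_ifs with hI
  · have h1 : ∀ i, excess a b i = 0 := fun i => by
      have h1 := (isCarrySet_carrySet a b).out_out i (by rw [hI]; exact id) (by rw [hI]; exact id)
      rw [excess]
      omega
    have h2 : ∑ i, excess a b i * p ^ i.val = 0 :=
      Finset.sum_eq_zero fun i _ => by rw [h1, zero_mul]
    rw [hs]
    rw [h2] at hT hlt ⊢
    rw [← hT', ← hT, rep_mk (by omega), Nat.cast_zero, sub_zero, Int.toNat_natCast]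
    rfl
  · have h1 : 0 < ∑ i, excess a b i * p ^ i.val := by
      rw [Nat.pos_iff_ne_zero]
      intro h1
      refine hI (carrySet_eq_empty fun i => ?_)
      have := (Finset.sum_eq_zero_iff.1 h1) i (Finset.mem_univ i)
      exact (Nat.mul_eq_zero.1 this).resolve_right (pow_ne_zero _ hp.out.ne_zero)
    rw [hs]
    rw [← NTilde.mk_rep (a + b), mk_eq_mk, ← hT] at hT'
    have h2 := (Nat.modEq_iff_dvd.1 hT'.2)
    generalize ∑ i, excess a b i * p ^ i.val = S at *
    generalize ∑ i, defect a b i * p ^ i.val = M at *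
    rw [Nat.cast_sub (by omega)] at h2
    have h3 : (((a + b).rep : ℤ) - 2 * S) % ((p : ℤ) ^ f - 1) = M := by
      -- The columns of `M + S` are less than `p`, so `M + S < q`; as `S ≥ 1`, this gives `M < q -
      -- 1`.
      have h4 : (M : ℤ) % ((p : ℤ) ^ f - 1) = M := by
        refine Int.emod_eq_of_lt (by positivity) ?_
        zify at hlt
        linarith [show (1 : ℤ) ≤ S by exact_mod_cast h1]
      rw [← h4]
      refine (Int.modEq_iff_dvd.2 ?_).symm
      convert h2 using 1 <;> push_cast <;> ring
    rw [h3]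
    simp

end Digits

/-! ### The ring of integers -/

theorem isDualNumbers_of_irreducible {R : Type*} [CommRing R] [IsDomain R]
    [IsDiscreteValuationRing R] [Finite (ResidueField R)] {p f : ℕ} [Fact p.Prime]
    (hq : Nat.card (ResidueField R) = p ^ f)
    (he : 2 ≤ IsDiscreteValuationRing.addVal R (p : R)) {ϖ : R} (hϖ : Irreducible ϖ) :
    IsDualNumbers ϖ := by
  have h1 : maximalIdeal R = Ideal.span {ϖ} := hϖ.maximalIdeal_eq
  refine isDualNumbers hq ?_ h1 fun x hx => ?_
  · rw [h1, Ideal.span_singleton_pow, Ideal.mem_span_singleton,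
      ← IsDiscreteValuationRing.addVal_le_iff_dvd, hϖ.addVal_pow]
    exact he
  · rw [h1, Ideal.span_singleton_pow, Ideal.mem_span_singleton, pow_two] at hx
    rw [h1, Ideal.mem_span_singleton]
    exact (mul_dvd_mul_iff_right hϖ.ne_zero).1 hx

end PrincipalSeries

end

/-! ### The main theorem. -/

open PrincipalSeries in
theorem mainTheorem5 (p f : ℕ) [Fact p.Prime] [NeZero f]
    {F : Type*} [Field F] [ValuativeRel F] [TopologicalSpace F] [IsNonarchimedeanLocalField F]
    [CharP 𝓀[F] p] (hq : Nat.card 𝓀[F] = p ^ f)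
    (he : 2 ≤ IsDiscreteValuationRing.addVal 𝒪[F] (p : 𝒪[F]))
    (ϖ : 𝒪[F]) (hϖ : Irreducible ϖ)
    {E : Type*} [Field E] [Algebra 𝓀[F] E]
    (r : NTilde p f) (hr : r ≠ 0) :
    ∃ hV : AllStable 𝒪[F] E r ϖ,
      ∀ (θ : Types p f r) (I : Set (ZMod f)) (γ : NTilde p f), IsPair θ I γ →
        (headRep hV θ).IsIrreducible ∧
        Nonempty ((headRep hV θ).Equiv
          (inflate 𝒪[F] (detTwist γ (sigmaJ 𝓀[F] E I (NTilde.sub r (2 • γ)))))) := by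
  obtain ⟨n, rfl⟩ : ∃ n, f = n + 1 := Nat.exists_eq_succ_of_ne_zero (NeZero.ne f)
  have h := isDualNumbers_of_irreducible hq he hϖ
  have hV : AllStable 𝒪[F] E r ϖ := allStable h hq hr
  refine ⟨hV, ?_⟩
  rintro _ _ γ ⟨b, rfl, rfl⟩
  have hs : NTilde.sub r (2 • γ) ≠ 0 := NTilde.sub_ne_zero hr _
  set a := NTilde.sub (NTilde.sub r (2 • γ)) b with ha
  have hab : b + a = NTilde.sub r (2 • γ) := NTilde.add_sub hs b
  have h0 : b + a ≠ 0 := hab ▸ hs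
  have hNe : ∀ i, (defect b a + excess b a) i < p := fun i => (excess_defect b a i).2.1
  have hof := (ofDigits_defect b a).trans hab
  have hM := isModel_headRep h hq hr hV hNe (fun i => (excess_defect b a i).2.2) hof
    -- The carry set is formed from `(b, a)`, while `Θ` lists the exponent `a` first; column sums do
    -- not depend on the order.
    fun m hm => (typeOf_modelTheta hr hNe hof hm (.fin b γ)).2
      ⟨rfl, (add_comm _ _).trans (defect_add_two_nsmul b a).symm⟩
  have hN : ∀ i, defect b a i < p := fun i => (Nat.le_add_right _ _).trans_lt (hNe i)
  refine ⟨hM.isIrreducible hq hN, ?_⟩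
  have hn := toNat_aJ_sub_sJ h0
  rw [← hab]
  exact IsModel.equiv_of_isModel h hM (isModel_serreWeight h hq γ _ _ (sJ_carrySet h0) fun i => by
    rw [hn, digit_sum _ hN])
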